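/- **Conventions.** $\lambda$ is the security parameter. A function $f\colon\mathbb N\to\mathbb N$ is $\mathrm{poly}(\lambda)$ if $f(\lambda)=\lambda^{O(1)}$. A function $\mu\colon\mathbb N\to\mathbb R_{\ge 0}$ is negligible if for every $c$, $\mu(\lambda)\le \lambda^{-c}$ for all sufficiently large $\lambda$. Efficient algorithms are (non-uniform) families of circuits of size $\mathrm{poly}(\lambda)$: Boolean (reversible, with ancillas) circuits for deterministic classical algorithms, the same with additional uniformly random input bits for randomized classical algorithms, and quantum circuits over a fixed universal gate set (NOT, CNOT, Toffoli, Hadamard, $T$), with ancillas initialized to $|0\rangle$ and with discarding of qubits, for quantum polynomial-time (QPT) algorithms. **Puzzles.** Let $k=k(\lambda)$. A 1-of-$2^k$ puzzle is a tuple $\mathcal Z=(\mathsf{KeyGen},\mathsf{Obligate},\mathsf{Solve},\mathsf{Ver})$ of efficient algorithms: a classical randomized $(\mathsf{pk},\mathsf{sk})\gets\mathsf{KeyGen}(1^\lambda)$; a quantum $(y,\rho)\gets\mathsf{Obligate}(\mathsf{pk})$ with $y$ a classical string and $\rho$ a quantum state; a quantum $\mathsf{ans}\gets\mathsf{Solve}(\mathsf{pk},y,\rho,b)$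 with $b\in\{0,1\}^k$ and $\mathsf{ans}$ classical; and a classical deterministic $\mathsf{Ver}(\mathsf{sk},y,b,\mathsf{ans})\in\{0,1\}$. A 1-of-2 puzzle is the case $k=1$. * $\mathcal Z$ has *completeness* $c$ if for all $\lambda$, with $b$ uniform in $\{0,1\}^k$, $(\mathsf{pk},\mathsf{sk})\gets\mathsf{KeyGen}(1^\lambda)$, $(y,\rho)\gets\mathsf{Obligate}(\mathsf{pk})$ and $\mathsf{ans}\gets\mathsf{Solve}(\mathsf{pk},y,\rho,b)$, one has $\Pr[\mathsf{Ver}(\mathsf{sk},y,b,\mathsf{ans})=1]\ge c(\lambda)$. It has completeness $1-\mathsf{negl}$ if it has completeness $1-\mu$ for some negligible $\mu$. * A QPT *non-local player* $(\mathcal A,\mathcal B,\mathcal C)$ plays the following game. The challenger samples $(\mathsf{pk},\mathsf{sk})\gets\mathsf{KeyGen}(1^\lambda)$; $\mathcal A(\mathsf{pk})$ outputs a classical $y$ and a bipartite state $\sigma_{BC}$; the challenger samples $b\gets\{0,1\}^k$ uniformly; $\mathcal B(\sigma_B,b)$ and $\mathcal C(\sigma_C,b)$, acting locally and without communication, output $\mathsf{ans}_{\mathcal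 B}$ and $\mathsf{ans}_{\mathcal C}$; the player wins if $\mathsf{Ver}(\mathsf{sk},y,b,\mathsf{ans}_{\mathcal B})=\mathsf{Ver}(\mathsf{sk},y,b,\mathsf{ans}_{\mathcal C})=1$. $\mathcal Z$ has *1-of-$2^k$ non-local soundness* $\tau$ if for every QPT non-local player there is a negligible $\mu$ such that for all $\lambda$ the player wins with probability at most $\tau(\lambda)+\mu(\lambda)$. * A 1-of-2 puzzle has *0-challenge-public-verifiability* if for every $(\mathsf{pk},\mathsf{sk})$ that $\mathsf{KeyGen}(1^\lambda)$ can output and all $y,\mathsf{ans}$, the bit $\mathsf{Ver}(\mathsf{sk},y,0,\mathsf{ans})$ is computed correctly with probability $1$ by an efficient (possibly quantum) algorithm from $(\mathsf{pk},y,\mathsf{ans})$ only. * The *$k$-fold parallel repetition* $\mathcal Z^k$ of a 1-of-2 puzzle $\mathcal Z$ runs $\mathsf{KeyGen},\mathsf{Obligate},\mathsf{Solve}$ independently $k$ times, the $i$-th instance receiving the $i$-th bit of $b\in\{0,1\}^k$; its $\mathsf{Ver}$ accepts if and only if all $k$ instances accept. **Theorem.** Let $\mathcal Z$ be a 1-of-2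 puzzle with completeness $1-\mathsf{negl}$, 1-of-2 non-local soundness $\tfrac12$, and 0-challenge-public-verifiability. Then for any $k=\mathrm{poly}(\lambda)$, $\mathcal Z^k$ is a 1-of-$2^k$ puzzle (in particular its algorithms are efficient) with completeness $1-\mathsf{negl}$ and 1-of-$2^k$ non-local soundness $2^{-k}$; that is, for every QPT non-local player against $\mathcal Z^k$ there is a negligible $\mu$ such that it wins with probability at most $2^{-k(\lambda)}+\mu(\lambda)$ for all $\lambda$. -/

import Mathlib

open scoped BigOperators Matrix Kronecker

noncomputable section

namespace OneOfTwo

/-! ### Growth rates -/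

/-- `f(n) = poly(n)`, i.e. `f(n) = n^{O(1)}`. -/
def PolyBounded (f : ℕ → ℕ) : Prop :=
  ∃ c : ℕ, ∀ n, f n ≤ n ^ c + c

/-- A nonnegative function that is eventually below every inverse polynomial. -/
def Negligible (f : ℕ → ℝ) : Prop :=
  (∀ n, 0 ≤ f n) ∧ ∀ c : ℕ, ∀ᶠ n in Filter.atTop, f n ≤ 1 / (n : ℝ) ^ c

/-! ### Gates and circuits

Wires are the elements of a finite type; the computational basis of the qubits on the wires `ι`
is `Bits ι`. -/

/-- Bit strings indexed by the wires `ι`. -/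
abbrev Bits (ι : Type) : Type := ι → Bool

/-- Classical reversible gates: NOT, controlled NOT and Toffoli, the target last. -/
inductive RevGate (ι : Type) : Type
  | x (i : ι) : RevGate ι
  | cx (c i : ι) (h : c ≠ i) : RevGate ι
  | ccx (c d i : ι) (hc : c ≠ i) (hd : d ≠ i) : RevGate ι

/-- The action of a reversible gate on bit strings. -/
def RevGate.act {ι : Type} [DecidableEq ι] : RevGate ι → Bits ι → Bits ι
  | .x i, s => Function.update s i (!(s i))
  | .cx c i _, s => Function.update s i (xor (s i) (s c))
  | .ccx c d i _ _, s => Function.update s i (xor (s i) (s c && s d))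

/-- The same gate on other wires. -/
def RevGate.map {ι κ : Type} (f : ι ↪ κ) : RevGate ι → RevGate κ
  | .x i => .x (f i)
  | .cx c i h => .cx (f c) (f i) (fun e => h (f.injective e))
  | .ccx c d i hc hd =>
      .ccx (f c) (f d) (f i) (fun e => hc (f.injective e)) (fun e => hd (f.injective e))

/-- Quantum gates: the reversible gates, the Hadamard gate, and the `T` (`π/8`) gate. -/
inductive Gate (ι : Type) : Type
  | rev (g : RevGate ι) : Gate ι
  | had (i : ι) : Gate ι
  | tee (i : ι) : Gate ι

/-- The unitary matrix of a gate on all wires; columns are indexed by the input basis state. -/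
def Gate.toMatrix {ι : Type} [Fintype ι] [DecidableEq ι] :
    Gate ι → Matrix (Bits ι) (Bits ι) ℂ
  | .rev g => Matrix.of fun s t => if s = g.act t then 1 else 0
  | .had i => Matrix.of fun s t =>
      if s = Function.update t i (s i) then
        (if s i && t i then -1 else 1) / (Real.sqrt 2 : ℂ)
      else 0
  | .tee i => Matrix.of fun s t =>
      if s = t then (if s i then Complex.exp (Real.pi / 4 * Complex.I) else 1) else 0

/-- The same gate on other wires. -/
def Gate.map {ι κ : Type} (f : ι ↪ κ) : Gate ι → Gate κ
  | .rev g => .rev (g.map f)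
  | .had i => .had (f i)
  | .tee i => .tee (f i)

/-- A classical circuit with input wires `ι` and output wires `ο`. The output wires and the
work wires start at `0`; the first gate of the list acts first. -/
structure ClassicalCircuit (ι ο : Type) : Type 1 where
  work : Type
  [fintypeWork : Fintype work]
  [decEqWork : DecidableEq work]
  gates : List (RevGate (ι ⊕ (ο ⊕ work)))

attribute [instance] ClassicalCircuit.fintypeWork ClassicalCircuit.decEqWork

namespace ClassicalCircuit

variable {ι ο : Type} [Fintype ι] [DecidableEq ι] [Fintype ο] [DecidableEq ο]

/-- Number of wires plus number of gates. -/
def size (C : ClassicalCircuit ι ο) : ℕ :=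
  Fintype.card ι + Fintype.card ο + Fintype.card C.work + C.gates.length

/-- The function computed by the circuit: the final content of the output wires. -/
def eval (C : ClassicalCircuit ι ο) (x : Bits ι) : Bits ο := fun j =>
  C.gates.foldl (fun s g => g.act s) (Sum.elim x fun _ => false) (Sum.inr (Sum.inl j))

end ClassicalCircuit

/-- A quantum circuit with input wires `ι` and output wires `ο`. The output wires and the work
wires start in the state `|0⟩`; the first gate of the list acts first; at the end the output
wires are kept and all the other wires are discarded. -/
structure QCircuit (ι ο : Type) : Type 1 where
  work : Type
  [fintypeWork : Fintype work]
  [decEqWork : DecidableEq work]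
  gates : List (Gate (ι ⊕ (ο ⊕ work)))

attribute [instance] QCircuit.fintypeWork QCircuit.decEqWork

namespace QCircuit

variable {ι ο ι' ο' : Type}

/-- The same circuit with its input and output wires renamed. -/
def relabel (C : QCircuit ι ο) (e : ι ≃ ι') (f : ο ≃ ο') : QCircuit ι' ο' where
  work := C.work
  gates := C.gates.map
    (Gate.map (Equiv.sumCongr e (Equiv.sumCongr f (Equiv.refl C.work))).toEmbedding)

/-- `m` copies of the circuit, on disjoint sets of wires. -/
def replicate (m : ℕ) (C : QCircuit ι ο) : QCircuit (Fin m × ι) (Fin m × ο) where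
  work := Fin m × C.work
  gates := (List.finRange m).flatMap fun i => C.gates.map (Gate.map
    ((Function.Embedding.sectR i ι).sumMap
      ((Function.Embedding.sectR i ο).sumMap (Function.Embedding.sectR i C.work))))

variable [Fintype ι] [DecidableEq ι] [Fintype ο] [DecidableEq ο]

/-- Number of wires plus number of gates. -/
def size (C : QCircuit ι ο) : ℕ :=
  Fintype.card ι + Fintype.card ο + Fintype.card C.work + C.gates.length

/-- The product of the gates. -/
def unitary (C : QCircuit ι ο) :
    Matrix (Bits (ι ⊕ (ο ⊕ C.work))) (Bits (ι ⊕ (ο ⊕ C.work))) ℂ :=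
  C.gates.foldl (fun U g => g.toMatrix * U) 1

/-- The Kraus operator, from the input qubits to the output qubits, that belongs to the final
content `u` of the discarded wires. -/
def kraus (C : QCircuit ι ο) (u : Bits ι × Bits C.work) : Matrix (Bits ο) (Bits ι) ℂ :=
  Matrix.of fun o x =>
    C.unitary (Sum.elim u.1 (Sum.elim o u.2)) (Sum.elim x fun _ => false)

/-- The density operator of the output qubits when the circuit is run on the classical input
`x`: `∑_u K_u |x⟩⟨x| K_u†`. -/
def output (C : QCircuit ι ο) (x : Bits ι) : Matrix (Bits ο) (Bits ο) ℂ :=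
  ∑ u, C.kraus u * Matrix.single x x (1 : ℂ) * (C.kraus u)ᴴ

/-- The measurement operator on the input qubits for running the circuit, measuring its output
qubits in the computational basis and seeing `o`: `∑_u K_u† |o⟩⟨o| K_u`. -/
def effect (C : QCircuit ι ο) (o : Bits ο) : Matrix (Bits ι) (Bits ι) ℂ :=
  ∑ u, (C.kraus u)ᴴ * Matrix.single o o (1 : ℂ) * C.kraus u

end QCircuit

/-- The measurement operator with some of the input wires set to classical values: `pl`
inserts those values, next to the content of the remaining wires. -/
abbrev restrict {ι κ : Type} (M : Matrix (Bits ι) (Bits ι) ℂ) (pl : Bits κ → Bits ι) :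
    Matrix (Bits κ) (Bits κ) ℂ :=
  M.submatrix pl pl

/-- The unnormalised state of the wires `β` after a computational basis measurement of the
wires `α` has returned `y`; its trace is the probability of `y`. -/
def postMeasure {α β : Type} (ρ : Matrix (Bits (α ⊕ β)) (Bits (α ⊕ β)) ℂ) (y : Bits α) :
    Matrix (Bits β) (Bits β) ℂ :=
  ρ.submatrix (Sum.elim y) (Sum.elim y)

/-- The tensor product of operators on two disjoint registers. -/
def tensor {α β : Type} (M : Matrix (Bits α) (Bits α) ℂ) (N : Matrix (Bits β) (Bits β) ℂ) :
    Matrix (Bits (α ⊕ β)) (Bits (α ⊕ β)) ℂ :=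
  (M ⊗ₖ N).submatrix (Equiv.sumArrowEquivProdArrow α β Bool)
    (Equiv.sumArrowEquivProdArrow α β Bool)

/-- The Born rule: the probability of the measurement operator `M` in the state `σ`. -/
def born {α : Type} [Fintype α] [DecidableEq α] (M σ : Matrix (Bits α) (Bits α) ℂ) : ℝ :=
  (M * σ).trace.re

/-! ### Puzzles -/

/-- A register for every value of the security parameter, given by its finite set of wires. -/
structure Reg : Type 1 where
  wires : ℕ → Type
  [fintypeWires : ∀ n, Fintype (wires n)]
  [decEqWires : ∀ n, DecidableEq (wires n)]

attribute [instance] Reg.fintypeWires Reg.decEqWires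

instance : CoeFun Reg (fun _ => ℕ → Type) := ⟨Reg.wires⟩

/-- `k(n)` copies of a register. -/
def Reg.pow (A : Reg) (k : ℕ → ℕ) : Reg where
  wires n := Fin (k n) × A n

/-- The content of the `i`-th copy. -/
def block {m : ℕ} {α : Type} (s : Bits (Fin m × α)) (i : Fin m) : Bits α := fun j => s (i, j)

/-- A family of functions computed by classical circuits of polynomial size. -/
def PolyComputable {ι ο : ℕ → Type} [∀ n, Fintype (ι n)] [∀ n, DecidableEq (ι n)]
    [∀ n, Fintype (ο n)] [∀ n, DecidableEq (ο n)] (f : ∀ n, Bits (ι n) → Bits (ο n)) : Prop :=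
  ∃ C : ∀ n, ClassicalCircuit (ι n) (ο n),
    PolyBounded (fun n => (C n).size) ∧ ∀ n x, (C n).eval x = f n x

/-- The four algorithms of a 1-of-`2^k` puzzle. The classical algorithms are given as
functions, `keyGen` as a function of its uniformly random coins; the quantum algorithms are
given as circuits. The efficiency of all four is `Puzzle.Efficient`. -/
structure Puzzle (k : ℕ → ℕ) : Type 1 where
  /-- random coins of `keyGen` -/
  Coins : Reg
  /-- public keys -/
  PK : Reg
  /-- secret keys -/
  SK : Reg
  /-- obligations -/
  Y : Reg
  /-- the quantum state produced together with the obligation -/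
  R : Reg
  /-- answers -/
  Ans : Reg
  keyGen : ∀ n, Bits (Coins n) → Bits (PK n) × Bits (SK n)
  obligate : ∀ n, QCircuit (PK n) (Y n ⊕ R n)
  solve : ∀ n, QCircuit (PK n ⊕ (Y n ⊕ (R n ⊕ Fin (k n)))) (Ans n)
  ver : ∀ n, Bits (SK n) → Bits (Y n) → Bits (Fin (k n)) → Bits (Ans n) → Bool

namespace Puzzle

variable {k : ℕ → ℕ}

/-- The four algorithms are efficient. -/
def Efficient (Z : Puzzle k) : Prop :=
  PolyComputable (ι := fun n => Z.Coins n) (ο := fun n => Z.PK n ⊕ Z.SK n)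
    (fun n r => Sum.elim (Z.keyGen n r).1 (Z.keyGen n r).2) ∧
  PolyBounded (fun n => (Z.obligate n).size) ∧
  PolyBounded (fun n => (Z.solve n).size) ∧
  PolyComputable (ι := fun n => Z.SK n ⊕ (Z.Y n ⊕ (Fin (k n) ⊕ Z.Ans n))) (ο := fun _ => Unit)
    (fun n x _ => Z.ver n (fun j => x (.inl j)) (fun j => x (.inr (.inl j)))
      (fun j => x (.inr (.inr (.inl j)))) (fun j => x (.inr (.inr (.inr j)))))

/-- The probability that the honest solver answers a uniformly random challenge correctly. -/
def successProb (Z : Puzzle k) (n : ℕ) : ℝ :=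
  𝔼 r : Bits (Z.Coins n), 𝔼 b : Bits (Fin (k n)),
    ∑ y : Bits (Z.Y n), ∑ ans : Bits (Z.Ans n),
      if Z.ver n (Z.keyGen n r).2 y b ans = true then
        born
          (restrict ((Z.solve n).effect ans)
            (fun s => Sum.elim (Z.keyGen n r).1 (Sum.elim y (Sum.elim s b))))
          (postMeasure ((Z.obligate n).output (Z.keyGen n r).1) y)
      else 0

def HasCompleteness (Z : Puzzle k) (c : ℕ → ℝ) : Prop :=
  ∀ n, c n ≤ Z.successProb n

/-- Non-local players `(𝒜, ℬ, 𝒞)`. -/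
structure Player (Z : Puzzle k) : Type 1 where
  /-- the register handed to `ℬ` -/
  B : Reg
  /-- the register handed to `𝒞` -/
  C : Reg
  algA : ∀ n, QCircuit (Z.PK n) (Z.Y n ⊕ (B n ⊕ C n))
  algB : ∀ n, QCircuit (B n ⊕ Fin (k n)) (Z.Ans n)
  algC : ∀ n, QCircuit (C n ⊕ Fin (k n)) (Z.Ans n)

/-- The player is quantum polynomial time. -/
def Player.QPT {Z : Puzzle k} (W : Z.Player) : Prop :=
  PolyBounded (fun n => (W.algA n).size) ∧
  PolyBounded (fun n => (W.algB n).size) ∧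
  PolyBounded (fun n => (W.algC n).size)

/-- The probability that the player wins the non-local solving game: `𝒜` outputs a classical
`y` and a state of the registers `B` and `C`; then `ℬ` and `𝒞` both get the uniformly random
challenge `b`, act locally, and both of their answers have to be accepted. -/
def nonLocalWinProb (Z : Puzzle k) (W : Z.Player) (n : ℕ) : ℝ :=
  𝔼 r : Bits (Z.Coins n), 𝔼 b : Bits (Fin (k n)),
    ∑ y : Bits (Z.Y n), ∑ ansB : Bits (Z.Ans n), ∑ ansC : Bits (Z.Ans n),
      if Z.ver n (Z.keyGen n r).2 y b ansB = true ∧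
          Z.ver n (Z.keyGen n r).2 y b ansC = true then
        born
          (tensor
            (restrict ((W.algB n).effect ansB) (fun s => Sum.elim s b))
            (restrict ((W.algC n).effect ansC) (fun s => Sum.elim s b)))
          (postMeasure ((W.algA n).output (Z.keyGen n r).1) y)
      else 0

def HasNonLocalSoundness (Z : Puzzle k) (τ : ℕ → ℝ) : Prop :=
  ∀ W : Z.Player, W.QPT →
    ∃ μ : ℕ → ℝ, Negligible μ ∧ ∀ n, Z.nonLocalWinProb W n ≤ τ n + μ n

/-- For all key pairs that `keyGen` can output and all `y`, `ans`, the value of `ver` on the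
challenge `0` is computed with probability `1` from the public key, `y` and `ans` by circuits of
polynomial size; these may be quantum, which includes classical ones. -/
def ZeroChallengePubliclyVerifiable (Z : Puzzle (fun _ => 1)) : Prop :=
  ∃ V : ∀ n, QCircuit (Z.PK n ⊕ (Z.Y n ⊕ Z.Ans n)) Unit,
    PolyBounded (fun n => (V n).size) ∧
    ∀ (n : ℕ) (r : Bits (Z.Coins n)) (y : Bits (Z.Y n)) (ans : Bits (Z.Ans n)),
      (V n).output (Sum.elim (Z.keyGen n r).1 (Sum.elim y ans))
        (fun _ => Z.ver n (Z.keyGen n r).2 y (fun _ => false) ans)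
        (fun _ => Z.ver n (Z.keyGen n r).2 y (fun _ => false) ans) = 1

/-- Regrouping of `m` copies of the input registers of a solver. -/
def solveWires (m : ℕ) (α β γ : Type) :
    Fin m × (α ⊕ (β ⊕ (γ ⊕ Fin 1))) ≃
      (Fin m × α) ⊕ ((Fin m × β) ⊕ ((Fin m × γ) ⊕ Fin m)) :=
  (Equiv.prodSumDistrib _ _ _).trans (Equiv.sumCongr (Equiv.refl _)
    ((Equiv.prodSumDistrib _ _ _).trans (Equiv.sumCongr (Equiv.refl _)
      ((Equiv.prodSumDistrib _ _ _).trans (Equiv.sumCongr (Equiv.refl _)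
        (Equiv.prodUnique _ _))))))

/-- The `k`-fold parallel repetition of a 1-of-2 puzzle: key generation, obligation and solver
are run `k` times independently, the `i`-th instance gets the `i`-th challenge bit, and all
instances have to be accepted. -/
def parallelRepetition (Z : Puzzle (fun _ => 1)) (k : ℕ → ℕ) : Puzzle k where
  Coins := Z.Coins.pow k
  PK := Z.PK.pow k
  SK := Z.SK.pow k
  Y := Z.Y.pow k
  R := Z.R.pow k
  Ans := Z.Ans.pow k
  keyGen n r :=
    (fun p => (Z.keyGen n (block r p.1)).1 p.2, fun p => (Z.keyGen n (block r p.1)).2 p.2)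
  obligate n :=
    ((Z.obligate n).replicate (k n)).relabel (Equiv.refl _) (Equiv.prodSumDistrib _ _ _)
  solve n :=
    ((Z.solve n).replicate (k n)).relabel (solveWires (k n) _ _ _) (Equiv.refl _)
  ver n sk y b ans :=
    decide (∀ i : Fin (k n),
      Z.ver n (block sk i) (block y i) (fun _ => b i) (block ans i) = true)

end Puzzle

end OneOfTwo

end

/-! Soundness. Fix the keys and defer all measurements. Then `𝒜` prepares a pure state ψ, and on the
challenge b the two local parties apply a unitary U_b. Let P_b project onto the basis states in
which both answers are accepted, and let Π_b = U_b† P_b U_b. The player wins on b with probability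
p_b = ‖Π_b ψ‖² = ⟨ψ, Π_b ψ⟩. Let X be the average of the p_b over the N = 2^k challenges.
Cauchy–Schwarz against ψ bounds (∑ p_b)² by ‖∑ Π_b ψ‖², which is ∑ p_b plus the overlaps ⟨Π_b ψ,
Π_b' ψ⟩ with b ≠ b'. Division by N² gives X² ≤ X/N + δ, with δ the average size of the overlaps, and
hence X ≤ 1/N + √δ (`sq_expect_le_of_inner_le`, `sq_expect_gateProd_le`, `le_add_sqrt_of_sq_le`).
The overlaps enter only through their average, so nothing is lost although there are exponentially
many of them.

It remains to bound one overlap, on average over the keys. Its size is at most the square root of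
q(b, b') = ‖Π_b' Π_b ψ‖², the probability of succeeding on b and, after undoing that round, on b' as
well (`sequentialProb`). By symmetry q(b', b) serves too, so the order may be chosen such that some
coordinate i carries 0 in the first challenge b₀ and 1 in the second challenge b₁.

A player with large q(b₀, b₁) breaks a single instance. Put the given public key into copy i and
generate the other keys. Run the player on b₀, record coherently in a flag whether both answers are
accepted, and undo the round. This verdict is computable: copy i has challenge 0 and is publicly
verifiable, and the other secret keys are known. If the flag is set, the obligation is that of copy
i, and on the challenge c both parties run the player on b_c and return the i-th answer. If the flag
is not set, the obligation is an honest one, and both parties return the same honest answer to the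
challenge 0, which is classical and can be copied. Let p be the probability of the flag and h the
honest success probability on the challenge 0. On c = 0, repeating the undone round reproduces the
accepted state, so the reduction wins with probability at least p + (1 - p)h ≥ h; on c = 1 it wins
with probability at least q(b₀, b₁). Therefore h + q(b₀, b₁) is at most twice the winning
probability, that is 1 plus a negligible amount (`reduction_bound`). Completeness makes h almost 1
on average over the keys, so q(b₀, b₁) is negligible on average. Since circuits are non-uniform, the
best choice of i, b₀, b₁ and of the other coins can be hardwired, and one negligible bound covers
all pairs of challenges (`exists_negligible_sequential`).

Completeness and efficiency are the statement that everything factors over the copies: amplitudes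
multiply, so the success probability is the k-th power of that of one copy
(`successProb_parallelRepetition`), and circuit sizes grow by polynomial factors.

States are functions from bit strings to ℂ, a circuit is placed on part of a register along an
embedding of wires, and `Function.extend f u s` is the string `s` with the wires in the range of `f`
overwritten by `u`. -/

open scoped BigOperators Matrix Kronecker

noncomputable section

namespace OneOfTwo

/-! ### Products of gates -/

section GateProd

variable {ι κ : Type} [Fintype ι] [DecidableEq ι] [Fintype κ] [DecidableEq κ]

/-- The unitary of a list of gates, the first gate acting first. -/
def gateProd (gs : List (Gate ι)) : Matrix (Bits ι) (Bits ι) ℂ :=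
  gs.foldl (fun U g => g.toMatrix * U) 1

theorem foldl_gate_mul (gs : List (Gate ι)) (M : Matrix (Bits ι) (Bits ι) ℂ) :
    gs.foldl (fun U g => g.toMatrix * U) M = gateProd gs * M := by
  induction gs generalizing M with
  | nil => simp [gateProd]
  | cons g gs ih =>
    rw [gateProd, List.foldl_cons, List.foldl_cons, ih, ih (g.toMatrix * 1)]
    simp [Matrix.mul_assoc]

@[simp] theorem gateProd_nil : gateProd ([] : List (Gate ι)) = 1 := rfl

theorem gateProd_cons (g : Gate ι) (gs : List (Gate ι)) :
    gateProd (g :: gs) = gateProd gs * g.toMatrix := by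
  rw [gateProd, List.foldl_cons, foldl_gate_mul, Matrix.mul_one]

@[simp] theorem gateProd_singleton (g : Gate ι) : gateProd [g] = g.toMatrix := by
  simp [gateProd_cons]

theorem gateProd_append (gs hs : List (Gate ι)) :
    gateProd (gs ++ hs) = gateProd hs * gateProd gs := by
  rw [gateProd, List.foldl_append, foldl_gate_mul]; rfl

omit [Fintype ι] in
theorem RevGate.act_act (g : RevGate ι) (s : Bits ι) : g.act (g.act s) = s := by
  cases g with
  | x i => ext j; by_cases h : j = i <;> simp [RevGate.act, h]
  | cx c i h =>
    ext j; by_cases hj : j = i <;> simp [RevGate.act, hj, h]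
  | ccx c d i hc hd =>
    ext j; by_cases hj : j = i <;> simp [RevGate.act, hj, hc, hd]

omit [Fintype ι] in
theorem RevGate.eq_act_iff (g : RevGate ι) (s t : Bits ι) : s = g.act t ↔ t = g.act s :=
  ⟨fun h => by rw [h, act_act], fun h => by rw [h, act_act]⟩

theorem rev_mulVec (g : RevGate ι) (v : Bits ι → ℂ) (s : Bits ι) :
    ((Gate.rev g).toMatrix *ᵥ v) s = v (g.act s) := by
  simp only [Matrix.mulVec, dotProduct, Gate.toMatrix, Matrix.of_apply]
  rw [Finset.sum_eq_single (g.act s)]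
  · simp [RevGate.act_act]
  · intro t _ ht
    rw [if_neg, zero_mul]
    exact fun h => ht ((g.eq_act_iff s t).1 h)
  · simp

theorem had_mulVec (i : ι) (v : Bits ι → ℂ) (s : Bits ι) :
    ((Gate.had i).toMatrix *ᵥ v) s =
      (v (Function.update s i false) + (if s i then -1 else 1) * v (Function.update s i true)) /
        (Real.sqrt 2 : ℂ) := by
  simp only [Matrix.mulVec, dotProduct, Gate.toMatrix, Matrix.of_apply]
  have key : ∀ t : Bits ι, s = Function.update t i (s i) ↔
      (t = Function.update s i false ∨ t = Function.update s i true) := by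
    intro t
    constructor
    · intro h
      have : t = Function.update s i (t i) := by rw [h]; simp
      cases ht : t i <;> rw [ht] at this <;> tauto
    · rintro (rfl | rfl) <;> simp
  have hne : Function.update s i false ≠ Function.update s i true := by
    intro h; simpa using congrFun h i
  rw [← Finset.sum_subset (Finset.subset_univ {Function.update s i false, Function.update s i true}),
    Finset.sum_pair hne]
  · rw [if_pos ((key _).2 (Or.inl rfl)), if_pos ((key _).2 (Or.inr rfl))]
    cases s i <;> simp <;> ring
  · intro t _ ht
    rw [if_neg, zero_mul]
    simpa [key] using ht

theorem tee_mulVec (i : ι) (v : Bits ι → ℂ) (s : Bits ι) :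
    ((Gate.tee i).toMatrix *ᵥ v) s =
      (if s i then Complex.exp (Real.pi / 4 * Complex.I) else 1) * v s := by
  simp only [Matrix.mulVec, dotProduct, Gate.toMatrix, Matrix.of_apply]
  rw [Finset.sum_eq_single s]
  · simp
  · intro t _ ht; rw [if_neg ht.symm, zero_mul]
  · simp

omit [Fintype ι] [Fintype κ] in
-- Overwriting a sub-register by its own content with one bit changed is the change of that bit in
-- the large register; this carries single gates along embeddings.
theorem extend_update (f : ι ↪ κ) (s : Bits κ) (i : ι) (x : Bool) :
    Function.extend f (Function.update (s ∘ f) i x) s = Function.update s (f i) x := by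
  ext w
  by_cases h : ∃ j, f j = w
  · obtain ⟨j, rfl⟩ := h
    rw [f.injective.extend_apply]
    by_cases hj : j = i
    · subst hj; simp
    · rw [Function.update_of_ne hj, Function.update_of_ne (fun h => hj (f.injective h))]; rfl
  · rw [Function.extend_apply' _ _ _ h, Function.update_of_ne]
    rintro rfl; exact h ⟨i, rfl⟩

omit [Fintype ι] [Fintype κ] in
theorem RevGate.act_map (f : ι ↪ κ) (g : RevGate ι) (s : Bits κ) :
    (g.map f).act s = Function.extend f (g.act (s ∘ f)) s := by
  cases g <;> simp only [RevGate.act, RevGate.map, extend_update, Function.comp]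

theorem Gate.map_mulVec (f : ι ↪ κ) (g : Gate ι) (v : Bits κ → ℂ) (s : Bits κ) :
    ((g.map f).toMatrix *ᵥ v) s =
      (g.toMatrix *ᵥ fun u => v (Function.extend f u s)) (s ∘ f) := by
  cases g with
  | rev g => rw [Gate.map, rev_mulVec, rev_mulVec, RevGate.act_map]
  | had i => rw [Gate.map, had_mulVec, had_mulVec, extend_update, extend_update]; rfl
  | tee i =>
    rw [Gate.map, tee_mulVec, tee_mulVec]
    have : Function.extend f (s ∘ f) s = s := by
      ext w
      by_cases h : ∃ j, f j = w
      · obtain ⟨j, rfl⟩ := h; rw [f.injective.extend_apply]; rfl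
      · rw [Function.extend_apply' _ _ _ h]
    rw [this]; rfl

omit [Fintype ι] [DecidableEq ι] [Fintype κ] [DecidableEq κ] in
theorem extend_extend (f : ι ↪ κ) (u u' : Bits ι) (s : Bits κ) :
    Function.extend f u (Function.extend f u' s) = Function.extend f u s := by
  ext w
  by_cases h : ∃ j, f j = w
  · obtain ⟨j, rfl⟩ := h; rw [f.injective.extend_apply, f.injective.extend_apply]
  · rw [Function.extend_apply' _ _ _ h, Function.extend_apply' _ _ _ h,
      Function.extend_apply' _ _ _ h]

omit [Fintype ι] [DecidableEq ι] [Fintype κ] [DecidableEq κ] in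
theorem extend_comp_embedding (f : ι ↪ κ) (u : Bits ι) (s : Bits κ) :
    Function.extend f u s ∘ f = u := by
  ext j; exact f.injective.extend_apply _ _ _

omit [Fintype ι] [DecidableEq ι] [Fintype κ] [DecidableEq κ] in
theorem extend_comp_self (f : ι ↪ κ) (s t : Bits κ)
    (h : ∀ w, w ∉ Set.range f → s w = t w) : Function.extend f (s ∘ f) t = s := by
  ext w
  by_cases hw : ∃ j, f j = w
  · obtain ⟨j, rfl⟩ := hw; rw [f.injective.extend_apply]; rfl
  · rw [Function.extend_apply' _ _ _ hw, h w hw]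

/-- Gates on some of the wires act on the slices of a vector. -/
theorem map_mulVec (f : ι ↪ κ) (gs : List (Gate ι)) (v : Bits κ → ℂ) (s : Bits κ) :
    (gateProd (gs.map (Gate.map f)) *ᵥ v) s =
      (gateProd gs *ᵥ fun u => v (Function.extend f u s)) (s ∘ f) := by
  induction gs generalizing v with
  | nil => simp [extend_comp_self f s s (fun _ _ => rfl)]
  | cons g gs ih =>
    rw [List.map_cons, gateProd_cons, gateProd_cons, ← Matrix.mulVec_mulVec, ih,
      ← Matrix.mulVec_mulVec]
    congr 2
    funext u
    rw [Gate.map_mulVec, extend_comp_embedding]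
    simp only [extend_extend]

/-- A circuit on a sub-register is its unitary tensored with the identity: the spectator wires must
agree, and then only the sub-register matters. -/
theorem gateProd_map_apply (f : ι ↪ κ) (gs : List (Gate ι)) (s t : Bits κ)
    (h : ∀ w, w ∉ Set.range f → s w = t w) :
    gateProd (gs.map (Gate.map f)) s t = gateProd gs (s ∘ f) (t ∘ f) := by
  have h1 := map_mulVec f gs (Pi.single t 1) s
  rw [Matrix.mulVec_single_one, Matrix.col_apply] at h1
  rw [h1, Matrix.mulVec, dotProduct, Finset.sum_eq_single (t ∘ f)]
  · rw [extend_comp_self f t s (fun w hw => (h w hw).symm)]; simp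
  · intro u _ hu
    rw [Pi.single_eq_of_ne, mul_zero]
    intro e; apply hu; rw [← e, extend_comp_embedding]
  · simp

theorem gateProd_map_apply_eq_zero (f : ι ↪ κ) (gs : List (Gate ι)) (s t : Bits κ)
    (h : ¬ ∀ w, w ∉ Set.range f → s w = t w) :
    gateProd (gs.map (Gate.map f)) s t = 0 := by
  have h1 := map_mulVec f gs (Pi.single t 1) s
  rw [Matrix.mulVec_single_one, Matrix.col_apply] at h1
  rw [h1, Matrix.mulVec, dotProduct, Finset.sum_eq_zero]
  intro u _
  rw [Pi.single_eq_of_ne, mul_zero]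
  intro e; apply h; intro w hw
  rw [← e, Function.extend_apply' _ _ _ hw]

omit [Fintype ι] [DecidableEq ι] [Fintype κ] [DecidableEq κ] in
theorem Gate.map_map {μ : Type} (f : ι ↪ κ) (h : κ ↪ μ) (g : Gate ι) :
    (g.map f).map h = g.map (f.trans h) := by
  cases g with
  | rev g => cases g <;> rfl
  | had i => rfl
  | tee i => rfl

omit [Fintype ι] [DecidableEq ι] [Fintype κ] [DecidableEq κ] in
theorem map_gate_map {μ : Type} (f : ι ↪ κ) (h : κ ↪ μ) (gs : List (Gate ι)) :
    (gs.map (Gate.map f)).map (Gate.map h) = gs.map (Gate.map (f.trans h)) := by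
  rw [List.map_map]
  exact List.map_congr_left fun g _ => Gate.map_map f h g

/-- Lists of gates on disjoint sets of wires commute. -/
theorem gateProd_map_commute {μ : Type} [Fintype μ] [DecidableEq μ] (f : ι ↪ μ) (h : κ ↪ μ)
    (hd : ∀ i j, f i ≠ h j) (gs : List (Gate ι)) (hs : List (Gate κ)) :
    gateProd (gs.map (Gate.map f)) * gateProd (hs.map (Gate.map h)) =
      gateProd (hs.map (Gate.map h)) * gateProd (gs.map (Gate.map f)) := by
  apply Matrix.ext_of_mulVec_single
  intro i
  generalize (Pi.single i 1 : Bits μ → ℂ) = v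
  funext s
  have e1 : ∀ u, Function.extend f u s ∘ h = s ∘ h := by
    intro u; ext j
    exact Function.extend_apply' _ _ _ (by rintro ⟨i, hi⟩; exact hd i j hi)
  have e2 : ∀ u, Function.extend h u s ∘ f = s ∘ f := by
    intro u; ext j
    exact Function.extend_apply' _ _ _ (by rintro ⟨i, hi⟩; exact hd j i hi.symm)
  have e3 : ∀ u u', Function.extend h u' (Function.extend f u s) =
      Function.extend f u (Function.extend h u' s) := by
    intro u u'; ext w
    by_cases hw : ∃ j, f j = w
    · obtain ⟨j, rfl⟩ := hw
      rw [Function.extend_apply' _ _ _ (by rintro ⟨i, hi⟩; exact hd j i hi.symm),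
        f.injective.extend_apply, f.injective.extend_apply]
    · rw [Function.extend_apply' u (Function.extend h u' s) w hw]
      by_cases hw' : ∃ j, h j = w
      · obtain ⟨j, rfl⟩ := hw'
        rw [h.injective.extend_apply, h.injective.extend_apply]
      · rw [Function.extend_apply' _ _ _ hw', Function.extend_apply' _ _ _ hw',
          Function.extend_apply' _ _ _ hw]
  rw [← Matrix.mulVec_mulVec, ← Matrix.mulVec_mulVec, map_mulVec, map_mulVec]
  -- By `e3` the two overwritings commute, so both orders of the gates give the same double sum over
  -- the contents `u` and `u'` of the two sub-registers.
  have l1 : (fun u => (gateProd (hs.map (Gate.map h)) *ᵥ v) (Function.extend f u s)) =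
      fun u => ∑ u', gateProd hs (s ∘ h) u' * v (Function.extend f u (Function.extend h u' s)) := by
    funext u; rw [map_mulVec, e1]; simp only [e3]; rfl
  have l2 : (fun u => (gateProd (gs.map (Gate.map f)) *ᵥ v) (Function.extend h u s)) =
      fun u' => ∑ u, gateProd gs (s ∘ f) u * v (Function.extend f u (Function.extend h u' s)) := by
    funext u; rw [map_mulVec, e2]; rfl
  rw [l1, l2]
  simp only [Matrix.mulVec, dotProduct, Finset.mul_sum]
  rw [Finset.sum_comm]
  refine Finset.sum_congr rfl fun u _ => Finset.sum_congr rfl fun u' _ => by ring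

/-! ### Unitarity and inverses -/

theorem Gate.conjTranspose_rev (g : RevGate ι) :
    (Gate.rev g).toMatrixᴴ = (Gate.rev g).toMatrix := by
  ext s t
  simp only [Gate.toMatrix, Matrix.conjTranspose_apply, Matrix.of_apply]
  by_cases h : s = g.act t
  · rw [if_pos h, if_pos ((g.eq_act_iff _ _).1 h), star_one]
  · rw [if_neg h, if_neg (fun h' => h ((g.eq_act_iff _ _).1 h')), star_zero]

theorem Gate.rev_mul_rev (g : RevGate ι) :
    (Gate.rev g).toMatrix * (Gate.rev g).toMatrix = 1 := by
  apply Matrix.ext_of_mulVec_single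
  intro i
  funext s
  rw [← Matrix.mulVec_mulVec, rev_mulVec, rev_mulVec, RevGate.act_act, Matrix.one_mulVec]

theorem Gate.conjTranspose_had (i : ι) :
    (Gate.had i).toMatrixᴴ = (Gate.had i).toMatrix := by
  ext s t
  simp only [Gate.toMatrix, Matrix.conjTranspose_apply, Matrix.of_apply]
  have : t = Function.update s i (t i) ↔ s = Function.update t i (s i) := by
    constructor <;> intro h <;> rw [h] <;> simp
  by_cases h : s = Function.update t i (s i)
  · rw [if_pos h, if_pos (this.2 h)]
    cases s i <;> cases t i <;> simp
  · rw [if_neg h, if_neg (fun h' => h (this.1 h')), star_zero]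

theorem Gate.had_mul_had (i : ι) : (Gate.had i).toMatrix * (Gate.had i).toMatrix = 1 := by
  apply Matrix.ext_of_mulVec_single
  intro t
  generalize (Pi.single t 1 : Bits ι → ℂ) = v
  funext s
  rw [← Matrix.mulVec_mulVec, had_mulVec, had_mulVec, had_mulVec, Matrix.one_mulVec]
  have h2 : (Real.sqrt 2 : ℂ) * (Real.sqrt 2 : ℂ) = 2 := by
    rw [← Complex.ofReal_mul, Real.mul_self_sqrt (by norm_num)]; norm_num
  have h0 : (Real.sqrt 2 : ℂ) ≠ 0 := by
    intro h; rw [h] at h2; norm_num at h2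
  simp only [Function.update_idem, Function.update_self]
  conv_rhs => rw [← Function.update_eq_self i s]
  have h3 : (Real.sqrt 2 : ℂ) ^ 2 = 2 := by rw [sq, h2]
  cases s i <;> simp <;> field_simp <;> rw [h3] <;> ring

theorem star_phase_mul_phase : star (Complex.exp (Real.pi / 4 * Complex.I)) *
    Complex.exp (Real.pi / 4 * Complex.I) = 1 := by
  have : star (Complex.exp (Real.pi / 4 * Complex.I)) =
      Complex.exp (-(Real.pi / 4 * Complex.I)) := by
    rw [Complex.star_def, ← Complex.exp_conj]
    congr 1
    rw [map_mul, map_div₀, Complex.conj_ofReal, Complex.conj_I, map_ofNat]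
    ring
  rw [this, ← Complex.exp_add]; simp

/-- The inverse of a gate, as a list of gates. -/
def Gate.inv : Gate ι → List (Gate ι)
  | .rev g => [.rev g]
  | .had i => [.had i]
  | .tee i => List.replicate 7 (.tee i)

/-- The `T` gate has order eight, so its adjoint is its seventh power; the other gates are
self-adjoint. Undoing a circuit thus stays within the gate set. -/
theorem gateProd_gate_inv (g : Gate ι) : gateProd g.inv = g.toMatrixᴴ := by
  cases g with
  | rev g => rw [Gate.inv, gateProd_singleton, Gate.conjTranspose_rev]
  | had i => rw [Gate.inv, gateProd_singleton, Gate.conjTranspose_had]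
  | tee i =>
    have hpow : ∀ m : ℕ, gateProd (List.replicate m (Gate.tee i)) = Matrix.diagonal
        (fun s : Bits ι => (if s i then Complex.exp (Real.pi / 4 * Complex.I) else 1) ^ m) := by
      intro m
      induction m with
      | zero => simp
      | succ m ih =>
        rw [List.replicate_succ, gateProd_cons, ih]
        have : (Gate.tee i).toMatrix = Matrix.diagonal
            (fun s : Bits ι => if s i then Complex.exp (Real.pi / 4 * Complex.I) else 1) := by
          ext s t
          by_cases h : s = t <;> simp [Gate.toMatrix, h]
        rw [this, Matrix.diagonal_mul_diagonal]
        congr 1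
    have h8 : Complex.exp (Real.pi / 4 * Complex.I) ^ 8 = 1 := by
      rw [← Complex.exp_nat_mul]
      convert Complex.exp_two_pi_mul_I using 2
      push_cast; ring
    have hc := star_phase_mul_phase
    rw [mul_comm] at hc
    rw [Gate.inv, hpow]
    ext s t
    rw [Matrix.conjTranspose_apply, Matrix.diagonal_apply]
    by_cases h : s = t
    · subst h
      simp only [Gate.toMatrix, Matrix.of_apply, if_true]
      cases s i
      · simp
      · simp only [if_true]
        calc Complex.exp (Real.pi / 4 * Complex.I) ^ 7
            = Complex.exp (Real.pi / 4 * Complex.I) ^ 7 * (Complex.exp (Real.pi / 4 * Complex.I) *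
                star (Complex.exp (Real.pi / 4 * Complex.I))) := by rw [hc, mul_one]
          _ = Complex.exp (Real.pi / 4 * Complex.I) ^ 8 *
                star (Complex.exp (Real.pi / 4 * Complex.I)) := by ring
          _ = _ := by rw [h8, one_mul]
    · simp [Gate.toMatrix, h, Ne.symm h]

theorem Gate.conjTranspose_mul_self (g : Gate ι) : g.toMatrixᴴ * g.toMatrix = 1 := by
  cases g with
  | rev g => rw [Gate.conjTranspose_rev, Gate.rev_mul_rev]
  | had i => rw [Gate.conjTranspose_had, Gate.had_mul_had]
  | tee i =>
    have hc := star_phase_mul_phase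
    have : (Gate.tee i).toMatrix = Matrix.diagonal
        (fun s : Bits ι => if s i then Complex.exp (Real.pi / 4 * Complex.I) else 1) := by
      ext s t
      by_cases h : s = t <;> simp [Gate.toMatrix, h]
    rw [this, Matrix.diagonal_conjTranspose, Matrix.diagonal_mul_diagonal, ← Matrix.diagonal_one]
    congr 1
    funext s
    cases h : s i
    · simp [h]
    · simp only [Pi.star_apply, h, if_true]; exact hc

/-- The inverse of a list of gates. -/
def invGates (gs : List (Gate ι)) : List (Gate ι) := gs.reverse.flatMap Gate.inv

theorem gateProd_invGates (gs : List (Gate ι)) : gateProd (invGates gs) = (gateProd gs)ᴴ := by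
  induction gs with
  | nil => simp [invGates]
  | cons g gs ih =>
    have : invGates (g :: gs) = invGates gs ++ g.inv := by simp [invGates]
    rw [this, gateProd_append, gateProd_cons, Matrix.conjTranspose_mul, ih, gateProd_gate_inv]

omit [Fintype ι] [DecidableEq ι] in
theorem length_invGates_le (gs : List (Gate ι)) : (invGates gs).length ≤ 7 * gs.length := by
  induction gs with
  | nil => simp [invGates]
  | cons g gs ih =>
    have : invGates (g :: gs) = invGates gs ++ g.inv := by simp [invGates]
    rw [this, List.length_append, List.length_cons]
    have : g.inv.length ≤ 7 := by cases g <;> simp [Gate.inv]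
    omega

theorem gateProd_conjTranspose_mul_self (gs : List (Gate ι)) :
    (gateProd gs)ᴴ * gateProd gs = 1 := by
  induction gs with
  | nil => simp
  | cons g gs ih =>
    rw [gateProd_cons, Matrix.conjTranspose_mul, Matrix.mul_assoc, ← Matrix.mul_assoc _ (gateProd gs),
      ih, Matrix.one_mul, Gate.conjTranspose_mul_self]

theorem gateProd_mul_conjTranspose_self (gs : List (Gate ι)) :
    gateProd gs * (gateProd gs)ᴴ = 1 :=
  mul_eq_one_comm.1 (gateProd_conjTranspose_mul_self gs)

/-- The squared norm of a vector. -/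
def normSq (v : Bits ι → ℂ) : ℝ := ∑ s, ‖v s‖ ^ 2

theorem normSq_eq_re (v : Bits ι → ℂ) : (normSq v : ℂ) = star v ⬝ᵥ v := by
  simp only [normSq, dotProduct, Pi.star_apply, Complex.star_def]
  push_cast
  exact Finset.sum_congr rfl fun s _ => by rw [Complex.conj_mul']

theorem normSq_gateProd (gs : List (Gate ι)) (v : Bits ι → ℂ) :
    normSq (gateProd gs *ᵥ v) = normSq v := by
  have : (normSq (gateProd gs *ᵥ v) : ℂ) = normSq v := by
    rw [normSq_eq_re, normSq_eq_re, Matrix.star_mulVec, Matrix.dotProduct_mulVec,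
      Matrix.vecMul_vecMul, gateProd_conjTranspose_mul_self, Matrix.vecMul_one]
  exact_mod_cast this

theorem normSq_single (t : Bits ι) : normSq (Pi.single t 1 : Bits ι → ℂ) = 1 := by
  rw [normSq, Finset.sum_eq_single t]
  · simp
  · intro s _ hs; simp [hs]
  · simp

/-- By unitarity the final basis states of a circuit started on a basis state carry a probability
distribution. -/
theorem sum_normSq_gateProd (gs : List (Gate ι)) (t : Bits ι) :
    ∑ s, ‖gateProd gs s t‖ ^ 2 = 1 := by
  have h := normSq_gateProd gs (Pi.single t 1)
  rw [normSq_single, Matrix.mulVec_single_one] at h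
  exact h

/-! ### Reversible gates -/

omit [Fintype ι] in
/-- The action of a list of reversible gates, the first gate acting first. -/
def actList (gs : List (RevGate ι)) (s : Bits ι) : Bits ι := gs.foldl (fun s g => g.act s) s

omit [Fintype ι] in
@[simp] theorem actList_nil (s : Bits ι) : actList [] s = s := rfl

omit [Fintype ι] in
theorem actList_cons (g : RevGate ι) (gs : List (RevGate ι)) (s : Bits ι) :
    actList (g :: gs) s = actList gs (g.act s) := rfl

omit [Fintype ι] in
theorem actList_append (gs hs : List (RevGate ι)) (s : Bits ι) :
    actList (gs ++ hs) s = actList hs (actList gs s) := by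
  simp [actList]

omit [Fintype ι] in
theorem actList_reverse_act (gs : List (RevGate ι)) (s : Bits ι) :
    actList gs.reverse (actList gs s) = s := by
  induction gs generalizing s with
  | nil => rfl
  | cons g gs ih =>
    rw [List.reverse_cons, actList_append, actList_cons g gs, ih, actList_cons, actList_nil,
      RevGate.act_act]

omit [Fintype ι] in
theorem actList_act_reverse (gs : List (RevGate ι)) (s : Bits ι) :
    actList gs (actList gs.reverse s) = s := by
  simpa using actList_reverse_act gs.reverse s

omit [Fintype ι] in
/-- A list of reversible gates permutes the bit strings. -/
def actEquiv (gs : List (RevGate ι)) : Bits ι ≃ Bits ι where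
  toFun := actList gs
  invFun := actList gs.reverse
  left_inv := actList_reverse_act gs
  right_inv := actList_act_reverse gs

/-- The vector is evaluated at the image of `s`, so that the inverse permutation never has to be
written down. -/
theorem gateProd_rev_mulVec (gs : List (RevGate ι)) (v : Bits ι → ℂ) (s : Bits ι) :
    (gateProd (gs.map Gate.rev) *ᵥ v) (actList gs s) = v s := by
  induction gs generalizing v s with
  | nil => simp
  | cons g gs ih =>
    rw [List.map_cons, gateProd_cons, ← Matrix.mulVec_mulVec, actList_cons, ih, rev_mulVec,
      RevGate.act_act]

theorem gateProd_rev_single (gs : List (RevGate ι)) (t : Bits ι) :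
    gateProd (gs.map Gate.rev) *ᵥ Pi.single t 1 = Pi.single (actList gs t) 1 := by
  funext s
  obtain ⟨s, rfl⟩ := (actEquiv gs).surjective s
  change (gateProd (gs.map Gate.rev) *ᵥ Pi.single t 1) (actList gs s) =
    (Pi.single (actList gs t) 1 : Bits ι → ℂ) (actList gs s)
  rw [gateProd_rev_mulVec, Pi.single_apply, Pi.single_apply]
  congr 1
  exact propext ((actEquiv gs).injective.eq_iff).symm

theorem gateProd_rev_apply (gs : List (RevGate ι)) (s t : Bits ι) :
    gateProd (gs.map Gate.rev) s t = if s = actList gs t then 1 else 0 := by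
  have h := congrFun (gateProd_rev_single gs t) s
  rw [Matrix.mulVec_single_one, Matrix.col_apply] at h
  rw [h, Pi.single_apply]

/-- Two lists of reversible gates which agree on the support of a vector. -/
theorem gateProd_rev_congr (gs hs : List (RevGate ι)) (v : Bits ι → ℂ)
    (h : ∀ t, v t ≠ 0 → actList gs t = actList hs t) :
    gateProd (gs.map Gate.rev) *ᵥ v = gateProd (hs.map Gate.rev) *ᵥ v := by
  have e : v = ∑ t, v t • (Pi.single t 1 : Bits ι → ℂ) := by
    funext s; simp [Finset.sum_apply, Pi.single_apply]
  rw [e, Matrix.mulVec_sum, Matrix.mulVec_sum]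
  refine Finset.sum_congr rfl fun t _ => ?_
  rw [Matrix.mulVec_smul, Matrix.mulVec_smul, gateProd_rev_single, gateProd_rev_single]
  by_cases hv : v t = 0
  · simp [hv]
  · rw [h t hv]

end GateProd

/-! ### Families of circuits on disjoint wires, and compute–uncompute -/

section Families

variable {ι κ : Type} [Fintype ι] [DecidableEq ι] [Fintype κ] [DecidableEq κ]

/-- Circuits on pairwise disjoint sub-registers form a tensor product, so a matrix entry is a
product over the copies times the identity on the wires outside all of them. This is the source of
every factorization over the `k` instances. -/
theorem gateProd_flatMap {J : Type} (f : J → ι ↪ κ)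
    (hf : ∀ i j a b, f i a = f j b → i = j) (g : J → List (Gate ι)) (l : List J) (hl : l.Nodup)
    (s t : Bits κ) :
    ((∀ w, (∀ j ∈ l, w ∉ Set.range (f j)) → s w = t w) →
      gateProd (l.flatMap fun j => (g j).map (Gate.map (f j))) s t =
        (l.map fun j => gateProd (g j) (s ∘ f j) (t ∘ f j)).prod) ∧
    ((¬ ∀ w, (∀ j ∈ l, w ∉ Set.range (f j)) → s w = t w) →
      gateProd (l.flatMap fun j => (g j).map (Gate.map (f j))) s t = 0) := by
  induction l generalizing s t with
  | nil =>
    constructor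
    · intro h
      have : s = t := funext fun w => h w (by simp)
      simp [this]
    · intro h
      have : s ≠ t := fun e => h (by simp [e])
      simp [this]
  | cons j l ih =>
    have hjl : j ∉ l := (List.nodup_cons.1 hl).1
    have ih := ih (List.nodup_cons.1 hl).2
    -- The only intermediate basis state that contributes: block `j` already has its final content
    -- and all other wires still have their initial one.
    set m₀ : Bits κ := Function.extend (f j) (s ∘ f j) t with hm₀
    have hm1 : m₀ ∘ f j = s ∘ f j := extend_comp_embedding _ _ _
    have hm2 : ∀ w, w ∉ Set.range (f j) → m₀ w = t w :=
      fun w hw => Function.extend_apply' _ _ _ hw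
    have hdis : ∀ i ∈ l, m₀ ∘ f i = t ∘ f i := by
      intro i hi
      funext a
      apply hm2
      rintro ⟨b, hb⟩
      exact hjl (hf _ _ _ _ hb ▸ hi)
    have hsum : gateProd ((j :: l).flatMap fun j => (g j).map (Gate.map (f j))) s t =
        gateProd (l.flatMap fun j => (g j).map (Gate.map (f j))) s m₀ *
          gateProd (g j) (s ∘ f j) (t ∘ f j) := by
      rw [List.flatMap_cons, gateProd_append, Matrix.mul_apply, Finset.sum_eq_single m₀]
      · rw [gateProd_map_apply _ _ _ _ hm2, hm1]
      · intro m _ hm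
        by_cases h1 : ∀ w, w ∉ Set.range (f j) → m w = t w
        · rw [(ih s m).2, zero_mul]
          intro h2
          apply hm
          funext w
          by_cases hw : w ∈ Set.range (f j)
          · obtain ⟨a, rfl⟩ := hw
            rw [← h2]
            · exact (congrFun hm1 a).symm
            · rintro i hi ⟨b, hb⟩
              exact hjl (hf _ _ _ _ hb ▸ hi)
          · rw [h1 w hw, hm2 w hw]
        · rw [gateProd_map_apply_eq_zero _ _ _ _ h1, mul_zero]
      · simp
    have hiff : (∀ w, (∀ i ∈ l, w ∉ Set.range (f i)) → s w = m₀ w) ↔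
        (∀ w, (∀ i ∈ j :: l, w ∉ Set.range (f i)) → s w = t w) := by
      constructor
      · intro h w hw
        rw [← hm2 w (hw j (by simp))]
        exact h w fun i hi => hw i (by simp [hi])
      · intro h w hw
        by_cases hwj : w ∈ Set.range (f j)
        · obtain ⟨a, rfl⟩ := hwj
          exact (congrFun hm1 a).symm
        · rw [hm2 w hwj]
          refine h w fun i hi => ?_
          rcases List.mem_cons.1 hi with rfl | hi
          · exact hwj
          · exact hw i hi
    constructor
    · intro h
      rw [hsum, (ih s m₀).1 (hiff.2 h), List.map_cons, List.prod_cons, mul_comm]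
      congr 2
      exact List.map_congr_left fun i hi => by rw [hdis i hi]
    · intro h
      rw [hsum, (ih s m₀).2 (fun h' => h (hiff.1 h')), zero_mul]

/-- Gates on some of the wires, acting on a vector that factors. -/
theorem map_mulVec_mul (f : ι ↪ κ) (gs : List (Gate ι)) (Φ : Bits ι → ℂ) (χ : Bits κ → ℂ)
    (hχ : ∀ u s, χ (Function.extend f u s) = χ s) :
    gateProd (gs.map (Gate.map f)) *ᵥ (fun s => Φ (s ∘ f) * χ s) =
      fun s => (gateProd gs *ᵥ Φ) (s ∘ f) * χ s := by
  funext s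
  rw [map_mulVec]
  simp only [hχ, extend_comp_embedding, Matrix.mulVec, dotProduct, Finset.sum_mul, mul_assoc]

/-- Compute a bit into `o`, copy it to `a`, uncompute. -/
theorem gateProd_compute_uncompute (gs : List (Gate ι)) (o a : ι) (h : o ≠ a)
    (hcomm : (Gate.rev (.x a)).toMatrix * gateProd gs = gateProd gs * (Gate.rev (.x a)).toMatrix)
    (t : Bits ι) (b : Bool) (hb : ∀ s, gateProd gs s t ≠ 0 → s o = b) :
    gateProd (gs ++ [Gate.rev (.cx o a h)] ++ invGates gs) *ᵥ Pi.single t 1 =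
      Pi.single (Function.update t a (xor (t a) b)) 1 := by
  have hinv : (gateProd gs)ᴴ *ᵥ (gateProd gs *ᵥ (Pi.single t 1 : Bits ι → ℂ)) = Pi.single t 1 := by
    rw [Matrix.mulVec_mulVec, gateProd_conjTranspose_mul_self, Matrix.one_mulVec]
  -- The target wire is not involved in the computation, so a NOT on it passes through the
  -- uncomputation.
  have hx : ∀ v : Bits ι → ℂ, (Gate.rev (.x a)).toMatrix *ᵥ ((gateProd gs)ᴴ *ᵥ v) =
      (gateProd gs)ᴴ *ᵥ ((Gate.rev (.x a)).toMatrix *ᵥ v) := by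
    intro v
    rw [Matrix.mulVec_mulVec, Matrix.mulVec_mulVec]
    congr 1
    have := congrArg Matrix.conjTranspose hcomm
    rw [Matrix.conjTranspose_mul, Matrix.conjTranspose_mul, Gate.conjTranspose_rev] at this
    exact this.symm
  rw [gateProd_append, gateProd_append, gateProd_singleton, gateProd_invGates,
    ← Matrix.mulVec_mulVec, ← Matrix.mulVec_mulVec]
  set w := gateProd gs *ᵥ (Pi.single t 1 : Bits ι → ℂ) with hw
  -- The control bit is constant on the support of the computed state, even if that state is a
  -- superposition. The CNOT therefore acts there as the identity or as a NOT, and uncomputing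
  -- restores everything else.
  have hws : ∀ s, w s ≠ 0 → s o = b := by
    intro s hs
    rw [hw, Matrix.mulVec_single_one, Matrix.col_apply] at hs
    exact hb s hs
  cases b with
  | false =>
    have : (Gate.rev (.cx o a h)).toMatrix *ᵥ w = w := by
      have := gateProd_rev_congr [.cx o a h] [] w (fun s hs => by
        simp [actList_cons, RevGate.act, hws s hs])
      simpa using this
    rw [this, hinv]; simp
  | true =>
    have : (Gate.rev (.cx o a h)).toMatrix *ᵥ w = (Gate.rev (.x a)).toMatrix *ᵥ w := by
      have := gateProd_rev_congr [.cx o a h] [.x a] w (fun s hs => by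
        simp [actList_cons, RevGate.act, hws s hs])
      simpa using this
    rw [this, ← hx, hinv]
    have := gateProd_rev_single [.x a] t
    simp only [List.map_cons, List.map_nil, gateProd_singleton] at this
    rw [this]
    simp [actList_cons, RevGate.act]

/-! ### Layers of reversible gates -/

omit [Fintype ι] [Fintype κ] in
theorem actList_map (f : ι ↪ κ) (gs : List (RevGate ι)) (s : Bits κ) :
    actList (gs.map (RevGate.map f)) s = Function.extend f (actList gs (s ∘ f)) s := by
  induction gs generalizing s with
  | nil => exact (extend_comp_self f s s fun _ _ => rfl).symm
  | cons g gs ih =>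
    rw [List.map_cons, actList_cons, actList_cons, ih, RevGate.act_map, extend_comp_embedding,
      extend_extend]

omit [Fintype ι] [DecidableEq ι] [Fintype κ] [DecidableEq κ] in
theorem map_rev_map (f : ι ↪ κ) (gs : List (RevGate ι)) :
    (gs.map Gate.rev).map (Gate.map f) = (gs.map (RevGate.map f)).map Gate.rev := by
  simp [Gate.map]

/-- One list of gates for every element of a finite type. -/
def layer {J : Type} [Fintype J] (g : J → List (RevGate ι)) : List (RevGate ι) :=
  Finset.univ.toList.flatMap g

omit [Fintype ι] [DecidableEq ι] in
theorem length_layer_le {J : Type} [Fintype J] (g : J → List (RevGate ι)) (c : ℕ)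
    (h : ∀ j, (g j).length ≤ c) : (layer g).length ≤ Fintype.card J * c := by
  rw [layer, List.length_flatMap]
  refine (List.sum_le_card_nsmul _ c ?_).trans ?_
  · simp only [List.mem_map]
    rintro x ⟨j, -, rfl⟩
    exact h j
  · simp

omit [Fintype ι] in
-- The functions `φ` ignore all target wires, so none of the writes affects another one and the
-- arbitrary order of enumeration in `layer` is immaterial.
theorem actList_layer {J : Type} [Fintype J] (g : J → List (RevGate ι)) (tgt : J → ι)
    (htgt : Function.Injective tgt) (φ : J → Bits ι → Bool)
    (hact : ∀ j s, actList (g j) s = Function.update s (tgt j) (xor (s (tgt j)) (φ j s)))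
    (hφ : ∀ i j s x, φ i (Function.update s (tgt j) x) = φ i s) (s : Bits ι) :
    (∀ j, actList (layer g) s (tgt j) = xor (s (tgt j)) (φ j s)) ∧
    (∀ w, (∀ j, tgt j ≠ w) → actList (layer g) s w = s w) := by
  have key : ∀ l : List J, l.Nodup → ∀ s : Bits ι,
      (∀ j ∈ l, actList (l.flatMap g) s (tgt j) = xor (s (tgt j)) (φ j s)) ∧
      (∀ w, (∀ j ∈ l, tgt j ≠ w) → actList (l.flatMap g) s w = s w) := by
    intro l
    induction l with
    | nil => intro _ s; simp
    | cons i l ih =>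
      intro hl s
      obtain ⟨hil, hl⟩ := List.nodup_cons.1 hl
      obtain ⟨ih1, ih2⟩ := ih hl (actList (g i) s)
      rw [List.flatMap_cons, actList_append]
      constructor
      · intro j hj
        rcases List.mem_cons.1 hj with rfl | hj
        · rw [ih2 (tgt j) (fun k hk e => hil (htgt e ▸ hk)), hact, Function.update_self]
        · rw [ih1 j hj, hact, hφ, Function.update_of_ne]
          exact fun e => hil (htgt e ▸ hj)
      · intro w hw
        rw [ih2 w (fun j hj => hw j (by simp [hj])), hact, Function.update_of_ne]
        exact (hw i (by simp)).symm
  obtain ⟨h1, h2⟩ := key _ (Finset.nodup_toList _) s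
  exact ⟨fun j => h1 j (by simp), fun w hw => h2 w fun j _ => hw j⟩

end Families

/-! ### Growth rates -/

/-- The form `(n + 2) ^ c` is convenient for sums and products, because its base is at least 2 for
every `n`. -/
theorem PolyBounded.of_le_pow {f : ℕ → ℕ} {c : ℕ} (h : ∀ n, f n ≤ (n + 2) ^ c) :
    PolyBounded f := by
  -- For `n ≥ 2` one has `n + 2 ≤ n ^ 2`, which costs the exponent `2 * c`; the summand `3 ^ c`
  -- covers `n = 0` and `n = 1`.
  refine ⟨2 * c + 3 ^ c, fun n => (h n).trans ?_⟩
  rcases Nat.lt_or_ge n 2 with hn | hn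
  · calc (n + 2) ^ c ≤ 3 ^ c := Nat.pow_le_pow_left (by omega) c
      _ ≤ _ := (Nat.le_add_left _ _).trans (Nat.le_add_left _ _)
  · calc (n + 2) ^ c ≤ (n ^ 2) ^ c := Nat.pow_le_pow_left (by nlinarith) c
      _ = n ^ (2 * c) := by rw [pow_mul]
      _ ≤ n ^ (2 * c + 3 ^ c) := Nat.pow_le_pow_right (by omega) (Nat.le_add_right _ _)
      _ ≤ _ := Nat.le_add_right _ _

theorem PolyBounded.exists_le_pow {f : ℕ → ℕ} (h : PolyBounded f) :
    ∃ c, ∀ n, f n ≤ (n + 2) ^ c := by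
  obtain ⟨c, hc⟩ := h
  refine ⟨c + 1, fun n => (hc n).trans ?_⟩
  have h1 : n ^ c ≤ (n + 2) ^ c := Nat.pow_le_pow_left (by omega) c
  have h2 : c ≤ (n + 2) ^ c :=
    (Nat.lt_two_pow_self).le.trans (Nat.pow_le_pow_left (by omega) c)
  rw [pow_succ]
  nlinarith [Nat.zero_le (n * (n + 2) ^ c)]

theorem PolyBounded.mono {f g : ℕ → ℕ} (hg : PolyBounded g) (h : ∀ n, f n ≤ g n) :
    PolyBounded f := by
  obtain ⟨c, hc⟩ := hg
  exact ⟨c, fun n => (h n).trans (hc n)⟩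

theorem PolyBounded.add {f g : ℕ → ℕ} (hf : PolyBounded f) (hg : PolyBounded g) :
    PolyBounded fun n => f n + g n := by
  obtain ⟨a, ha⟩ := hf.exists_le_pow
  obtain ⟨b, hb⟩ := hg.exists_le_pow
  refine PolyBounded.of_le_pow (c := a + b + 1) fun n => ?_
  have h1 : (n + 2) ^ a ≤ (n + 2) ^ (a + b) := Nat.pow_le_pow_right (by omega) (by omega)
  have h2 : (n + 2) ^ b ≤ (n + 2) ^ (a + b) := Nat.pow_le_pow_right (by omega) (by omega)
  have := ha n
  have := hb n
  rw [pow_succ]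
  nlinarith [Nat.zero_le (n * (n + 2) ^ (a + b))]

theorem PolyBounded.mul {f g : ℕ → ℕ} (hf : PolyBounded f) (hg : PolyBounded g) :
    PolyBounded fun n => f n * g n := by
  obtain ⟨a, ha⟩ := hf.exists_le_pow
  obtain ⟨b, hb⟩ := hg.exists_le_pow
  refine PolyBounded.of_le_pow (c := a + b) fun n => ?_
  rw [pow_add]
  exact Nat.mul_le_mul (ha n) (hb n)

theorem PolyBounded.const (c : ℕ) : PolyBounded fun _ => c := ⟨c, fun _ => Nat.le_add_left _ _⟩

theorem Negligible.add {f g : ℕ → ℝ} (hf : Negligible f) (hg : Negligible g) :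
    Negligible fun n => f n + g n := by
  refine ⟨fun n => add_nonneg (hf.1 n) (hg.1 n), fun c => ?_⟩
  -- One additional power of `n` absorbs the factor 2 as soon as `n ≥ 2`.
  filter_upwards [hf.2 (c + 1), hg.2 (c + 1), Filter.eventually_ge_atTop 2] with n h1 h2 hn
  have hn' : (2 : ℝ) ≤ n := by exact_mod_cast hn
  calc f n + g n ≤ 1 / (n : ℝ) ^ (c + 1) + 1 / (n : ℝ) ^ (c + 1) := add_le_add h1 h2
    _ = 2 / (n : ℝ) * (1 / (n : ℝ) ^ c) := by field_simp; ring
    _ ≤ 1 * (1 / (n : ℝ) ^ c) := by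
        gcongr
        rw [div_le_one (by linarith)]; exact hn'
    _ = _ := one_mul _

theorem Negligible.mul_poly {f : ℕ → ℝ} {p : ℕ → ℕ} (hf : Negligible f) (hp : PolyBounded p) :
    Negligible fun n => p n * f n := by
  refine ⟨fun n => mul_nonneg (Nat.cast_nonneg _) (hf.1 n), fun c => ?_⟩
  obtain ⟨a, ha⟩ := hp.exists_le_pow
  -- The polynomial is at most `(n + 2) ^ a ≤ n ^ (2 * a)`, so `2 * a` additional powers of `n`
  -- absorb it.
  filter_upwards [hf.2 (c + 2 * a), Filter.eventually_ge_atTop 2] with n h1 hn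
  have hn' : (2 : ℝ) ≤ n := by exact_mod_cast hn
  have hn0 : (0 : ℝ) < n := by linarith
  have h2 : (p n : ℝ) ≤ (n : ℝ) ^ (2 * a) := by
    calc (p n : ℝ) ≤ ((n : ℝ) + 2) ^ a := by exact_mod_cast ha n
      _ ≤ ((n : ℝ) ^ 2) ^ a := by gcongr; nlinarith
      _ = _ := by rw [pow_mul]
  calc (p n : ℝ) * f n ≤ (n : ℝ) ^ (2 * a) * (1 / (n : ℝ) ^ (c + 2 * a)) :=
        mul_le_mul h2 h1 (hf.1 n) (by positivity)
    _ = 1 / (n : ℝ) ^ c := by rw [pow_add]; field_simp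

theorem Negligible.sqrt {f : ℕ → ℝ} (hf : Negligible f) : Negligible fun n => √(f n) := by
  refine ⟨fun n => Real.sqrt_nonneg _, fun c => ?_⟩
  filter_upwards [hf.2 (2 * c)] with n h1
  rw [Real.sqrt_le_left (by positivity), div_pow, one_pow, ← pow_mul, mul_comm c]
  exact h1

/-! ### Efficiency of the parallel repetition -/

section Efficiency

set_option linter.unusedSectionVars false
set_option synthInstance.maxSize 1000

/-- The classical case of `gateProd_flatMap`: the entry of a permutation matrix at the image of `t`
is 1, so no factor of the product vanishes, and each block is the image of its own block. -/
theorem actList_flatMap {ι κ J : Type} [Fintype ι] [DecidableEq ι] [Fintype κ] [DecidableEq κ]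
    (f : J → ι ↪ κ) (hf : ∀ i j a b, f i a = f j b → i = j) (g : J → List (RevGate ι))
    (l : List J) (hl : l.Nodup) (t : Bits κ) :
    (∀ j ∈ l, actList (l.flatMap fun j => (g j).map (RevGate.map (f j))) t ∘ f j =
      actList (g j) (t ∘ f j)) ∧
    (∀ w, (∀ j ∈ l, w ∉ Set.range (f j)) →
      actList (l.flatMap fun j => (g j).map (RevGate.map (f j))) t w = t w) := by
  set s := actList (l.flatMap fun j => (g j).map (RevGate.map (f j))) t with hs
  have h1 : gateProd (l.flatMap fun j => ((g j).map Gate.rev).map (Gate.map (f j))) s t = 1 := by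
    have : (l.flatMap fun j => ((g j).map Gate.rev).map (Gate.map (f j))) =
        (l.flatMap fun j => (g j).map (RevGate.map (f j))).map Gate.rev := by
      simp only [map_rev_map, List.map_flatMap]
    rw [this, gateProd_rev_apply, if_pos hs]
  obtain ⟨ha, hb⟩ := gateProd_flatMap f hf (fun j => (g j).map Gate.rev) l hl s t
  have hag : ∀ w, (∀ j ∈ l, w ∉ Set.range (f j)) → s w = t w := by
    by_contra h
    rw [hb h] at h1
    exact zero_ne_one h1
  refine ⟨fun j hj => ?_, hag⟩
  rw [ha hag] at h1
  by_contra hne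
  refine one_ne_zero (h1.symm.trans (List.prod_eq_zero ?_))
  refine List.mem_map.2 ⟨j, hj, ?_⟩
  rw [gateProd_rev_apply, if_neg hne]

/-- The conjunction of the bits on the first `k` wires, on the last of the work wires. -/
def andGates : (k : ℕ) → List (RevGate (Fin k ⊕ Fin (k + 1)))
  | 0 => [.x (.inr 0)]
  | k + 1 => (andGates k).map (RevGate.map (Fin.castSuccEmb.sumMap Fin.castSuccEmb)) ++
      [.ccx (.inl (Fin.last k)) (.inr (Fin.castSucc (Fin.last k))) (.inr (Fin.last (k + 1)))
        (by simp) (by simp [Fin.ext_iff])]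

theorem length_andGates (k : ℕ) : (andGates k).length = k + 1 := by
  induction k with
  | zero => rfl
  | succ k ih => simp [andGates, ih]

/-- Work wire `j` holds the conjunction of the first `j` inputs, starting with the empty conjunction
on wire 0; that is why there are `k + 1` work wires. -/
theorem actList_andGates (k : ℕ) (s : Bits (Fin k ⊕ Fin (k + 1))) (hs : ∀ j, s (.inr j) = false) :
    (∀ j, actList (andGates k) s (.inl j) = s (.inl j)) ∧
    actList (andGates k) s (.inr (Fin.last k)) = decide (∀ j, s (.inl j) = true) := by
  induction k with
  | zero =>
    constructor
    · intro j; exact j.elim0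
    · simp [andGates, actList_cons, RevGate.act, hs]
  | succ k ih =>
    set f : Fin k ⊕ Fin (k + 1) ↪ Fin (k + 1) ⊕ Fin (k + 2) :=
      Fin.castSuccEmb.sumMap Fin.castSuccEmb with hf
    obtain ⟨ih1, ih2⟩ := ih (s ∘ f) (fun j => hs _)
    rw [andGates, actList_append, actList_map]
    set u := Function.extend f (actList (andGates k) (s ∘ f)) s with hu
    have hu1 : ∀ j, u (.inl j) = s (.inl j) := by
      intro j
      refine Fin.lastCases ?_ (fun j => ?_) j
      · rw [hu, Function.extend_apply']
        rintro ⟨a | a, ha⟩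
        · simp [hf, Fin.ext_iff] at ha; omega
        · simp [hf] at ha
      · have := f.injective.extend_apply (actList (andGates k) (s ∘ f)) s (.inl j)
        rw [ih1] at this
        exact this
    have hu2 : u (.inr (Fin.castSucc (Fin.last k))) =
        decide (∀ j : Fin k, s (.inl (Fin.castSucc j)) = true) := by
      have := f.injective.extend_apply (actList (andGates k) (s ∘ f)) s (.inr (Fin.last k))
      rw [ih2] at this
      exact this
    have hu3 : u (.inr (Fin.last (k + 1))) = false := by
      rw [hu, Function.extend_apply', hs]
      rintro ⟨a | a, ha⟩
      · simp [hf] at ha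
      · simp [hf, Fin.ext_iff] at ha; omega
    rw [actList_cons, actList_nil, RevGate.act]
    constructor
    · intro j
      rw [Function.update_of_ne (by simp), hu1]
    · rw [Function.update_self, hu3, hu2, hu1]
      simp only [Fin.forall_fin_succ', Bool.false_xor]
      by_cases h1 : ∀ j : Fin k, s (.inl (Fin.castSucc j)) = true <;>
        cases h2 : s (.inl (Fin.last k)) <;> simp [h1]

/-! ### Copies of circuits and the repeated verification -/

theorem ClassicalCircuit.eval_eq {ι ο : Type} [Fintype ι] [DecidableEq ι] [Fintype ο]
    [DecidableEq ο] (C : ClassicalCircuit ι ο) (x : Bits ι) (j : ο) :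
    C.eval x j = actList C.gates (Sum.elim x fun _ => false) (.inr (.inl j)) := rfl

/-- `m` copies of a classical circuit, with the wires renamed. -/
def ClassicalCircuit.replicate {ι ο ι' ο' : Type} (m : ℕ) (C : ClassicalCircuit ι ο)
    (e : Fin m × ι ≃ ι') (f : Fin m × ο ≃ ο') : ClassicalCircuit ι' ο' where
  work := Fin m × C.work
  gates := (List.finRange m).flatMap fun i => C.gates.map (RevGate.map
    (((Function.Embedding.sectR i ι).trans e.toEmbedding).sumMap
      (((Function.Embedding.sectR i ο).trans f.toEmbedding).sumMap
        (Function.Embedding.sectR i C.work))))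

variable {ι ο ι' ο' : Type} [Fintype ι] [DecidableEq ι] [Fintype ο] [DecidableEq ο]
  [Fintype ι'] [DecidableEq ι'] [Fintype ο'] [DecidableEq ο']

theorem ClassicalCircuit.eval_replicate (m : ℕ) (C : ClassicalCircuit ι ο)
    (e : Fin m × ι ≃ ι') (f : Fin m × ο ≃ ο') (x : Bits ι') (i : Fin m) (o : ο) :
    (C.replicate m e f).eval x (f (i, o)) = C.eval (fun a => x (e (i, a))) o := by
  have h := (actList_flatMap (fun i => ((Function.Embedding.sectR i ι).trans e.toEmbedding).sumMap
      (((Function.Embedding.sectR i ο).trans f.toEmbedding).sumMap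
        (Function.Embedding.sectR i C.work))) (by
          rintro i j (a | a | a) (b | b | b) h <;> simp_all) (fun _ => C.gates)
      (List.finRange m) (List.nodup_finRange m) (Sum.elim x fun _ => false)).1 i (by simp)
  have h' := congrFun h (.inr (.inl o))
  rw [ClassicalCircuit.eval_eq, ClassicalCircuit.eval_eq]
  refine Eq.trans h' ?_
  congr 1
  funext w
  rcases w with a | a | a <;> rfl

theorem ClassicalCircuit.size_replicate (m : ℕ) (C : ClassicalCircuit ι ο)
    (e : Fin m × ι ≃ ι') (f : Fin m × ο ≃ ο') : (C.replicate m e f).size = m * C.size := by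
  have h3 : Fintype.card (C.replicate m e f).work = m * Fintype.card C.work := by
    change Fintype.card (Fin m × C.work) = _
    simp
  have h4 : (C.replicate m e f).gates.length = m * C.gates.length := by
    simp [ClassicalCircuit.replicate, List.length_flatMap]
  rw [ClassicalCircuit.size, ClassicalCircuit.size, h3, h4, ← Fintype.card_congr e,
    ← Fintype.card_congr f]
  simp only [Fintype.card_prod, Fintype.card_fin]
  ring

theorem QCircuit.size_replicate_relabel (m : ℕ) (C : QCircuit ι ο)
    (e : Fin m × ι ≃ ι') (f : Fin m × ο ≃ ο') :
    ((C.replicate m).relabel e f).size = m * C.size := by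
  have h3 : Fintype.card ((C.replicate m).relabel e f).work = m * Fintype.card C.work := by
    change Fintype.card (Fin m × C.work) = _
    simp
  have h4 : ((C.replicate m).relabel e f).gates.length = m * C.gates.length := by
    simp [QCircuit.replicate, QCircuit.relabel, List.length_flatMap]
  rw [QCircuit.size, QCircuit.size, h3, h4, ← Fintype.card_congr e,
    ← Fintype.card_congr f]
  simp only [Fintype.card_prod, Fintype.card_fin]
  ring

/-- The wires of the `i`-th copy of the verification circuit. -/
def verWiresFun {α β γ ω : Type} {m : ℕ} (i : Fin m) :
    (α ⊕ (β ⊕ (Fin 1 ⊕ γ))) ⊕ (Unit ⊕ ω) →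
      ((Fin m × α) ⊕ ((Fin m × β) ⊕ (Fin m ⊕ (Fin m × γ)))) ⊕
        (Unit ⊕ ((Fin m × (Unit ⊕ ω)) ⊕ Fin (m + 1)))
  | .inl (.inl a) => .inl (.inl (i, a))
  | .inl (.inr (.inl a)) => .inl (.inr (.inl (i, a)))
  | .inl (.inr (.inr (.inl _))) => .inl (.inr (.inr (.inl i)))
  | .inl (.inr (.inr (.inr a))) => .inl (.inr (.inr (.inr (i, a))))
  | .inr a => .inr (.inr (.inl (i, a)))

theorem verWiresFun_disjoint {α β γ ω : Type} {m : ℕ} (i j : Fin m)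
    (a b : (α ⊕ (β ⊕ (Fin 1 ⊕ γ))) ⊕ (Unit ⊕ ω)) (h : verWiresFun i a = verWiresFun j b) :
    i = j := by
  rcases a with (a | a | a | a) | a <;> rcases b with (b | b | b | b) | b <;>
    simp_all [verWiresFun]

/-- `verWiresFun` as an embedding. -/
def verWires {α β γ ω : Type} {m : ℕ} (i : Fin m) :
    (α ⊕ (β ⊕ (Fin 1 ⊕ γ))) ⊕ (Unit ⊕ ω) ↪
      ((Fin m × α) ⊕ ((Fin m × β) ⊕ (Fin m ⊕ (Fin m × γ)))) ⊕
        (Unit ⊕ ((Fin m × (Unit ⊕ ω)) ⊕ Fin (m + 1))) where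
  toFun := verWiresFun i
  inj' := by
    rintro ((a | a | a | a) | a) ((b | b | b | b) | b) h <;> simp_all [verWiresFun]
    exact Subsingleton.elim _ _

@[simp] theorem verWires_apply {α β γ ω : Type} {m : ℕ} (i : Fin m)
    (a : (α ⊕ (β ⊕ (Fin 1 ⊕ γ))) ⊕ (Unit ⊕ ω)) : verWires i a = verWiresFun i a := rfl

/-- The wires of the conjunction of the verdicts. -/
def verdictWires {I ω : Type} {m : ℕ} :
    Fin m ⊕ Fin (m + 1) ↪ I ⊕ (Unit ⊕ ((Fin m × (Unit ⊕ ω)) ⊕ Fin (m + 1))) where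
  toFun
    | .inl i => .inr (.inr (.inl (i, .inl ())))
    | .inr i => .inr (.inr (.inr i))
  inj' := by rintro (a | a) (b | b) h <;> simp_all

@[simp] theorem verdictWires_inl {I ω : Type} {m : ℕ} (i : Fin m) :
    verdictWires (I := I) (ω := ω) (.inl i) = .inr (.inr (.inl (i, .inl ()))) := rfl

@[simp] theorem verdictWires_inr {I ω : Type} {m : ℕ} (i : Fin (m + 1)) :
    verdictWires (I := I) (ω := ω) (.inr i) = .inr (.inr (.inr i)) := rfl

/-- The gates of `m` verification circuits, followed by the conjunction of their verdicts. -/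
def verAllGates {α β γ ω : Type} (m : ℕ)
    (gs : List (RevGate ((α ⊕ (β ⊕ (Fin 1 ⊕ γ))) ⊕ (Unit ⊕ ω)))) :
    List (RevGate (((Fin m × α) ⊕ ((Fin m × β) ⊕ (Fin m ⊕ (Fin m × γ)))) ⊕
        (Unit ⊕ ((Fin m × (Unit ⊕ ω)) ⊕ Fin (m + 1))))) :=
  ((List.finRange m).flatMap fun i => gs.map (RevGate.map (verWires i))) ++
    (andGates m).map (RevGate.map verdictWires) ++
    [.cx (.inr (.inr (.inr (Fin.last m)))) (.inr (.inl ())) (by simp)]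

/-- The verifications use disjoint wires, and the wires of the conjunction and the output are still
0 when they are reached. -/
theorem actList_verAllGates {α β γ ω : Type} [Fintype α] [DecidableEq α] [Fintype β]
    [DecidableEq β] [Fintype γ] [DecidableEq γ] [Fintype ω] [DecidableEq ω] (m : ℕ)
    (gs : List (RevGate ((α ⊕ (β ⊕ (Fin 1 ⊕ γ))) ⊕ (Unit ⊕ ω)))) (x) :
    actList (verAllGates m gs) (Sum.elim x fun _ => false) (.inr (.inl ())) =
      decide (∀ i : Fin m, actList gs (Sum.elim
      (Sum.elim (fun a => x (.inl (i, a))) (Sum.elim (fun a => x (.inr (.inl (i, a))))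
        (Sum.elim (fun _ => x (.inr (.inr (.inl i)))) (fun a => x (.inr (.inr (.inr (i, a))))))))
          fun _ => false) (.inr (.inl ())) = true) := by
  obtain ⟨h1, h2⟩ := actList_flatMap (verWires (α := α) (β := β) (γ := γ) (ω := ω) (m := m))
      verWiresFun_disjoint
      (fun _ => gs) (List.finRange m) (List.nodup_finRange m) (Sum.elim x fun _ => false)
  rw [verAllGates, actList_append, actList_append]
  set s := actList ((List.finRange m).flatMap fun i => gs.map (RevGate.map (verWires i)))
    (Sum.elim x fun _ => false) with hs
  have h3 := (actList_andGates m (s ∘ verdictWires) (fun j => by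
    refine (h2 _ ?_).trans rfl
    rintro i - ⟨(a | a | a | a) | a, ha⟩ <;> simp [verWiresFun] at ha)).2
  rw [actList_map, actList_cons, actList_nil, RevGate.act, Function.update_self,
    Function.extend_apply', h2]
  · have := verdictWires.injective.extend_apply (actList (andGates m) (s ∘ verdictWires)) s
      (.inr (Fin.last m))
    refine (congrArg₂ xor rfl (this.trans h3)).trans ?_
    rw [Sum.elim_inr, Bool.false_xor]
    congr 1
    refine forall_congr fun i => ?_
    have h4 := congrFun (h1 i (by simp)) (.inr (.inl ()))
    have h5 : (s ∘ verdictWires) (.inl i) = (s ∘ verWires i) (.inr (.inl ())) := rfl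
    rw [h5, h4]
    congr 2
    funext w
    rcases w with (a | a | a | a) | a <;> rfl
  · rintro i - ⟨(a | a | a | a) | a, ha⟩ <;> simp [verWiresFun] at ha
  · rintro ⟨a | a, ha⟩ <;> simp at ha

/-- All of the `m` copies of a verification circuit have to accept. -/
def ClassicalCircuit.verAll {α β γ : Type} (m : ℕ)
    (C : ClassicalCircuit (α ⊕ (β ⊕ (Fin 1 ⊕ γ))) Unit) :
    ClassicalCircuit ((Fin m × α) ⊕ ((Fin m × β) ⊕ (Fin m ⊕ (Fin m × γ)))) Unit where
  work := (Fin m × (Unit ⊕ C.work)) ⊕ Fin (m + 1)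
  gates := verAllGates m C.gates

theorem ClassicalCircuit.eval_verAll {α β γ : Type} [Fintype α] [DecidableEq α] [Fintype β]
    [DecidableEq β] [Fintype γ] [DecidableEq γ] (m : ℕ)
    (C : ClassicalCircuit (α ⊕ (β ⊕ (Fin 1 ⊕ γ))) Unit) (x) :
    (C.verAll m).eval x () = decide (∀ i : Fin m, C.eval
      (Sum.elim (fun a => x (.inl (i, a))) (Sum.elim (fun a => x (.inr (.inl (i, a))))
        (Sum.elim (fun _ => x (.inr (.inr (.inl i)))) (fun a => x (.inr (.inr (.inr (i, a)))))))) ()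
      = true) :=
  actList_verAllGates m C.gates x

theorem ClassicalCircuit.size_verAll_le {α β γ : Type} [Fintype α] [DecidableEq α] [Fintype β]
    [DecidableEq β] [Fintype γ] [DecidableEq γ] (m : ℕ)
    (C : ClassicalCircuit (α ⊕ (β ⊕ (Fin 1 ⊕ γ))) Unit) :
    (C.verAll m).size ≤ (m + 1) * (C.size + 4) := by
  have h3 : Fintype.card (C.verAll m).work = m * (1 + Fintype.card C.work) + (m + 1) := by
    change Fintype.card ((Fin m × (Unit ⊕ C.work)) ⊕ Fin (m + 1)) = _
    simp
  have h4 : (C.verAll m).gates.length = m * C.gates.length + (m + 1) + 1 := by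
    simp [ClassicalCircuit.verAll, verAllGates, List.length_flatMap, length_andGates]
    omega
  rw [ClassicalCircuit.size, ClassicalCircuit.size, h3, h4]
  simp only [Fintype.card_sum, Fintype.card_prod, Fintype.card_fin, Fintype.card_unit]
  nlinarith [Nat.zero_le (Fintype.card C.work), Nat.zero_le C.gates.length]

/-- Key generation, obligation and solver grow exactly by the factor `k n`; the verifier also pays
for the conjunction of the `k n` verdicts. -/
theorem Puzzle.efficient_parallelRepetition {Z : Puzzle (fun _ => 1)} (hZ : Z.Efficient)
    {k : ℕ → ℕ} (hk : PolyBounded k) : (Z.parallelRepetition k).Efficient := by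
  obtain ⟨⟨K, hK, hK'⟩, hO, hS, V, hV, hV'⟩ := hZ
  refine ⟨⟨fun n => (K n).replicate (k n) (Equiv.refl _) (Equiv.prodSumDistrib _ _ _), ?_, ?_⟩,
    ?_, ?_, fun n => (V n).verAll (k n), ?_, ?_⟩
  · exact (hk.mul hK).mono fun n => (ClassicalCircuit.size_replicate _ _ _ _).le
  · intro n x
    funext j
    obtain ⟨⟨i, j⟩, rfl⟩ := (Equiv.prodSumDistrib _ _ _).surjective j
    refine (ClassicalCircuit.eval_replicate _ _ _ _ _ _ _).trans ?_
    rw [hK']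
    rcases j with j | j <;> rfl
  · exact (hk.mul hO).mono fun n => (QCircuit.size_replicate_relabel _ _ _ _).le
  · exact (hk.mul hS).mono fun n => (QCircuit.size_replicate_relabel _ _ _ _).le
  · exact ((hk.add (.const 1)).mul (hV.add (.const 4))).mono fun n =>
      ClassicalCircuit.size_verAll_le _ _
  · intro n x
    funext u
    refine (ClassicalCircuit.eval_verAll (k n) (V n) x).trans ?_
    simp only [hV']
    rfl

end Efficiency

/-! ### Probabilities as sums over amplitudes -/

section Amplitudes

set_option linter.unusedSectionVars false
set_option synthInstance.maxSize 1000

variable {ι ο : Type} [Fintype ι] [DecidableEq ι] [Fintype ο] [DecidableEq ο]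

/-- Measurement operator and state are both sums of rank-one operators, and the trace of a product
of two such operators is a squared overlap. -/
theorem born_eq_sum {U W : Type} [Fintype U] [Fintype W] (M σ : Matrix (Bits ι) (Bits ι) ℂ)
    (f : U → Bits ι → ℂ) (g : W → Bits ι → ℂ)
    (hM : ∀ s t, M s t = ∑ u, star (f u s) * f u t)
    (hσ : ∀ s t, σ s t = ∑ w, g w s * star (g w t)) :
    born M σ = ∑ u, ∑ w, ‖∑ s, f u s * g w s‖ ^ 2 := by
  have h1 : ∀ u w, ((‖∑ s, f u s * g w s‖ ^ 2 : ℝ) : ℂ) =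
      ∑ s, ∑ t, (star (f u s) * f u t) * (g w t * star (g w s)) := by
    intro u w
    push_cast
    rw [← Complex.conj_mul', map_sum, Finset.sum_mul_sum]
    refine Finset.sum_congr rfl fun s _ => Finset.sum_congr rfl fun t _ => ?_
    rw [map_mul]
    simp only [Complex.star_def]
    ring
  have h2 : (M * σ).trace = ((∑ u, ∑ w, ‖∑ s, f u s * g w s‖ ^ 2 : ℝ) : ℂ) := by
    rw [Complex.ofReal_sum]
    simp only [Complex.ofReal_sum, h1]
    simp only [Matrix.trace, Matrix.diag_apply, Matrix.mul_apply, hM, hσ, Finset.sum_mul_sum]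
    calc ∑ s, ∑ t, ∑ u, ∑ w, (star (f u s) * f u t) * (g w t * star (g w s))
        = ∑ s, ∑ u, ∑ t, ∑ w, (star (f u s) * f u t) * (g w t * star (g w s)) :=
          Finset.sum_congr rfl fun _ _ => Finset.sum_comm
      _ = ∑ u, ∑ s, ∑ t, ∑ w, (star (f u s) * f u t) * (g w t * star (g w s)) :=
          Finset.sum_comm
      _ = ∑ u, ∑ s, ∑ w, ∑ t, (star (f u s) * f u t) * (g w t * star (g w s)) :=
          Finset.sum_congr rfl fun _ _ => Finset.sum_congr rfl fun _ _ => Finset.sum_comm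
      _ = _ := Finset.sum_congr rfl fun _ _ => Finset.sum_comm
  rw [born, h2, Complex.ofReal_re]

theorem QCircuit.effect_apply (C : QCircuit ι ο) (o : Bits ο) (s t : Bits ι) :
    C.effect o s t = ∑ u, star (C.kraus u o s) * C.kraus u o t := by
  rw [QCircuit.effect, Matrix.sum_apply]
  refine Finset.sum_congr rfl fun u _ => ?_
  rw [Matrix.mul_apply, Finset.sum_eq_single o]
  · rw [Matrix.mul_single_apply_same, mul_one, Matrix.conjTranspose_apply]
  · intro o' _ h
    rw [Matrix.mul_single_apply_of_ne _ _ _ _ _ h, zero_mul]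
  · simp

theorem QCircuit.output_apply (C : QCircuit ι ο) (x : Bits ι) (s t : Bits ο) :
    C.output x s t = ∑ u, C.kraus u s x * star (C.kraus u t x) := by
  rw [QCircuit.output, Matrix.sum_apply]
  refine Finset.sum_congr rfl fun u _ => ?_
  rw [Matrix.mul_apply, Finset.sum_eq_single x]
  · rw [Matrix.mul_single_apply_same, mul_one, Matrix.conjTranspose_apply]
  · intro o' _ h
    rw [Matrix.mul_single_apply_of_ne _ _ _ _ _ h, zero_mul]
  · simp

theorem tensor_apply {α β : Type} (M : Matrix (Bits α) (Bits α) ℂ) (N : Matrix (Bits β) (Bits β) ℂ)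
    (s t : Bits (α ⊕ β)) : tensor M N s t =
      M (fun i => s (.inl i)) (fun i => t (.inl i)) * N (fun i => s (.inr i)) (fun i => t (.inr i)) :=
  rfl

theorem born_tensor_eq_sum {α β U U' W : Type} [Fintype α] [DecidableEq α] [Fintype β]
    [DecidableEq β] [Fintype U] [Fintype U'] [Fintype W] (M : Matrix (Bits α) (Bits α) ℂ)
    (N : Matrix (Bits β) (Bits β) ℂ) (σ : Matrix (Bits (α ⊕ β)) (Bits (α ⊕ β)) ℂ)
    (f : U → Bits α → ℂ) (f' : U' → Bits β → ℂ) (g : W → Bits (α ⊕ β) → ℂ)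
    (hM : ∀ s t, M s t = ∑ u, star (f u s) * f u t)
    (hN : ∀ s t, N s t = ∑ u, star (f' u s) * f' u t)
    (hσ : ∀ s t, σ s t = ∑ w, g w s * star (g w t)) :
    born (tensor M N) σ = ∑ u : U × U', ∑ w, ‖∑ t, (f u.1 (fun i => t (.inl i)) *
      f' u.2 (fun i => t (.inr i))) * g w t‖ ^ 2 := by
  have h := born_eq_sum (ι := α ⊕ β) (U := U × U') (tensor M N) σ
    (fun u t => f u.1 (fun i => t (.inl i)) * f' u.2 (fun i => t (.inr i))) g ?_ hσ
  · refine h.trans (Finset.sum_congr rfl fun u _ => Finset.sum_congr rfl fun w _ => ?_)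
    congr 2
  intro s t
  rw [tensor_apply, hM, hN, Finset.sum_mul_sum, Fintype.sum_prod_type]
  refine Finset.sum_congr rfl fun u _ => Finset.sum_congr rfl fun u' _ => ?_
  rw [star_mul']
  ring

theorem born_honest {P Y R K A : Type} [Fintype P] [DecidableEq P] [Fintype Y] [DecidableEq Y]
    [Fintype R] [DecidableEq R] [Fintype K] [DecidableEq K] [Fintype A] [DecidableEq A]
    (O : QCircuit P (Y ⊕ R)) (S : QCircuit (P ⊕ (Y ⊕ (R ⊕ K))) A) (pk : Bits P) (y : Bits Y)
    (b : Bits K) (ans : Bits A) :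
    born (restrict (S.effect ans) (fun s => Sum.elim pk (Sum.elim y (Sum.elim s b))))
        (postMeasure (O.output pk) y) =
      ∑ u, ∑ w, ‖∑ s, S.kraus u ans (Sum.elim pk (Sum.elim y (Sum.elim s b))) *
        O.kraus w (Sum.elim y s) pk‖ ^ 2 :=
  born_eq_sum _ _ _ _ (fun _ _ => S.effect_apply _ _ _) (fun _ _ => O.output_apply _ _ _)

/-- All wires of a non-local player. -/
abbrev PlayWires (P Y B C K A wA wB wC : Type) : Type :=
  (P ⊕ ((Y ⊕ (B ⊕ C)) ⊕ wA)) ⊕ ((K ⊕ (A ⊕ wB)) ⊕ (K ⊕ (A ⊕ wC)))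

variable {P Y B C K A wA wB wC : Type}

/-- The wires of `ℬ`. -/
def bobWires : (B ⊕ K) ⊕ (A ⊕ wB) ↪ PlayWires P Y B C K A wA wB wC where
  toFun
    | .inl (.inl a) => .inl (.inr (.inl (.inr (.inl a))))
    | .inl (.inr a) => .inr (.inl (.inl a))
    | .inr a => .inr (.inl (.inr a))
  inj' := by rintro ((a | a) | a) ((b | b) | b) h <;> simp_all

/-- The wires of `𝒞`. -/
def charlieWires : (C ⊕ K) ⊕ (A ⊕ wC) ↪ PlayWires P Y B C K A wA wB wC where
  toFun
    | .inl (.inl a) => .inl (.inr (.inl (.inr (.inr a))))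
    | .inl (.inr a) => .inr (.inr (.inl a))
    | .inr a => .inr (.inr (.inr a))
  inj' := by rintro ((a | a) | a) ((b | b) | b) h <;> simp_all

theorem bobWires_ne_charlieWires (a : (B ⊕ K) ⊕ (A ⊕ wB)) (b : (C ⊕ K) ⊕ (A ⊕ wC)) :
    bobWires (P := P) (Y := Y) (C := C) (wA := wA) (wC := wC) a ≠ charlieWires b := by
  rcases a with (a | a) | a <;> rcases b with (b | b) | b <;> intro h <;> cases h

variable [Fintype P] [DecidableEq P] [Fintype Y] [DecidableEq Y]
  [Fintype B] [DecidableEq B] [Fintype C] [DecidableEq C] [Fintype K] [DecidableEq K]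
  [Fintype A] [DecidableEq A] [Fintype wA] [DecidableEq wA] [Fintype wB] [DecidableEq wB]
  [Fintype wC] [DecidableEq wC]

/-- All gates of a non-local player. -/
def playGates (gA : List (Gate (P ⊕ ((Y ⊕ (B ⊕ C)) ⊕ wA)))) (gB : List (Gate ((B ⊕ K) ⊕ (A ⊕ wB))))
    (gC : List (Gate ((C ⊕ K) ⊕ (A ⊕ wC)))) : List (Gate (PlayWires P Y B C K A wA wB wC)) :=
  gA.map (Gate.map Function.Embedding.inl) ++ gB.map (Gate.map bobWires) ++
    gC.map (Gate.map charlieWires)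

/-- The initial state of a non-local player: the public key and twice the challenge. -/
def playInit (pk : Bits P) (b : Bits K) : Bits (PlayWires P Y B C K A wA wB wC) :=
  Sum.elim (Sum.elim pk fun _ => false)
    (Sum.elim (Sum.elim b fun _ => false) (Sum.elim b fun _ => false))

theorem sum_bits_sum {α β : Type} [Fintype α] [DecidableEq α] [Fintype β] [DecidableEq β]
    {M : Type} [AddCommMonoid M] (F : Bits (α ⊕ β) → M) :
    ∑ s, F s = ∑ s, ∑ t, F (Sum.elim s t) := by
  rw [← Fintype.sum_prod_type']
  exact Fintype.sum_equiv (Equiv.sumArrowEquivProdArrow α β Bool) _ _ fun s => by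
    congr 1; funext w; cases w <;> rfl

omit [Fintype P] [DecidableEq P] [Fintype Y] [DecidableEq Y]
  [Fintype B] [DecidableEq B] [Fintype C] [DecidableEq C] [Fintype K] [DecidableEq K]
  [Fintype A] [DecidableEq A] [Fintype wA] [DecidableEq wA] [Fintype wB] [DecidableEq wB]
  [Fintype wC] [DecidableEq wC] in
theorem extend_bobWires (u : Bits ((B ⊕ K) ⊕ (A ⊕ wB)))
    (s : Bits (PlayWires P Y B C K A wA wB wC)) : Function.extend bobWires u s =
      Sum.elim (Sum.elim (fun i => s (.inl (.inl i))) (Sum.elim (Sum.elim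
        (fun i => s (.inl (.inr (.inl (.inl i)))))
        (Sum.elim (fun i => u (.inl (.inl i))) fun i => s (.inl (.inr (.inl (.inr (.inr i)))))))
        fun i => s (.inl (.inr (.inr i)))))
        (Sum.elim (Sum.elim (fun i => u (.inl (.inr i))) fun i => u (.inr i))
          fun i => s (.inr (.inr i))) := by
  have hn : ∀ w, (∀ x, bobWires x ≠ w) → Function.extend bobWires u s w = s w :=
    fun w hw => Function.extend_apply' _ _ _ (by rintro ⟨x, hx⟩; exact hw x hx)
  funext w
  rcases w with (a | (a | a | a) | a) | (a | a) | a
  · exact hn _ (by rintro ((x | x) | x) h <;> cases h)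
  · exact hn _ (by rintro ((x | x) | x) h <;> cases h)
  · exact bobWires.injective.extend_apply u s (.inl (.inl a))
  · exact hn _ (by rintro ((x | x) | x) h <;> cases h)
  · exact hn _ (by rintro ((x | x) | x) h <;> cases h)
  · exact bobWires.injective.extend_apply u s (.inl (.inr a))
  · exact bobWires.injective.extend_apply u s (.inr a)
  · exact hn _ (by rintro ((x | x) | x) h <;> cases h)

omit [Fintype P] [DecidableEq P] [Fintype Y] [DecidableEq Y]
  [Fintype B] [DecidableEq B] [Fintype C] [DecidableEq C] [Fintype K] [DecidableEq K]
  [Fintype A] [DecidableEq A] [Fintype wA] [DecidableEq wA] [Fintype wB] [DecidableEq wB]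
  [Fintype wC] [DecidableEq wC] in
theorem extend_charlieWires (u : Bits ((C ⊕ K) ⊕ (A ⊕ wC)))
    (s : Bits (PlayWires P Y B C K A wA wB wC)) : Function.extend charlieWires u s =
      Sum.elim (Sum.elim (fun i => s (.inl (.inl i))) (Sum.elim (Sum.elim
        (fun i => s (.inl (.inr (.inl (.inl i)))))
        (Sum.elim (fun i => s (.inl (.inr (.inl (.inr (.inl i)))))) fun i => u (.inl (.inl i))))
        fun i => s (.inl (.inr (.inr i)))))
        (Sum.elim (fun i => s (.inr (.inl i)))
          (Sum.elim (fun i => u (.inl (.inr i))) fun i => u (.inr i))) := by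
  have hn : ∀ w, (∀ x, charlieWires x ≠ w) → Function.extend charlieWires u s w = s w :=
    fun w hw => Function.extend_apply' _ _ _ (by rintro ⟨x, hx⟩; exact hw x hx)
  funext w
  rcases w with (a | (a | a | a) | a) | a | a | a
  · exact hn _ (by rintro ((x | x) | x) h <;> cases h)
  · exact hn _ (by rintro ((x | x) | x) h <;> cases h)
  · exact hn _ (by rintro ((x | x) | x) h <;> cases h)
  · exact charlieWires.injective.extend_apply u s (.inl (.inl a))
  · exact hn _ (by rintro ((x | x) | x) h <;> cases h)
  · exact hn _ (by rintro ((x | x) | x) h <;> cases h)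
  · exact charlieWires.injective.extend_apply u s (.inl (.inr a))
  · exact charlieWires.injective.extend_apply u s (.inr a)

/-- In a sum over intermediate contents of a party's wires, the challenge and the ancillas have
known values and only the received quantum register remains free. -/
theorem sum_initialized {α β γ : Type} [Fintype α] [DecidableEq α] [Fintype β] [DecidableEq β]
    [Fintype γ] [DecidableEq γ] {M : Type} [AddCommMonoid M] (b : Bits β) (c : Bits γ)
    (F : Bits ((α ⊕ β) ⊕ γ) → M)
    (hF : ∀ u, F u ≠ 0 → (∀ i, u (.inl (.inr i)) = b i) ∧ ∀ i, u (.inr i) = c i) :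
    ∑ u, F u = ∑ t : Bits α, F (Sum.elim (Sum.elim t b) c) := by
  refine (Fintype.sum_of_injective (fun t : Bits α => Sum.elim (Sum.elim t b) c) ?_ _ _ ?_
    fun _ => rfl).symm
  · intro t t' h
    funext i
    exact congrFun h (.inl (.inl i))
  · intro u hu
    by_contra h
    obtain ⟨h1, h2⟩ := hF u h
    refine hu ⟨fun i => u (.inl (.inl i)), ?_⟩
    funext w
    rcases w with (w | w) | w
    · rfl
    · exact (h1 w).symm
    · exact (h2 w).symm

/-- Only the registers `B` and `C` are written by `𝒜` and then used by the local parties, so the sum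
over paths reduces to their intermediate content `t`. All other wires of `𝒜` are final after its
gates, and the remaining inputs of `ℬ` and `𝒞` are initialized. -/
theorem playGates_apply (gA : List (Gate (P ⊕ ((Y ⊕ (B ⊕ C)) ⊕ wA))))
    (gB : List (Gate ((B ⊕ K) ⊕ (A ⊕ wB)))) (gC : List (Gate ((C ⊕ K) ⊕ (A ⊕ wC))))
    (pk : Bits P) (b : Bits K) (s : Bits (PlayWires P Y B C K A wA wB wC)) :
    (gateProd (playGates gA gB gC) *ᵥ Pi.single (playInit pk b) 1) s =
      ∑ t : Bits (B ⊕ C), gateProd gB (s ∘ bobWires)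
          (Sum.elim (Sum.elim (fun i => t (.inl i)) b) fun _ => false) *
        gateProd gC (s ∘ charlieWires)
          (Sum.elim (Sum.elim (fun i => t (.inr i)) b) fun _ => false) *
        gateProd gA (Sum.elim (fun i => s (.inl (.inl i)))
          (Sum.elim (Sum.elim (fun i => s (.inl (.inr (.inl (.inl i))))) t)
            (fun i => s (.inl (.inr (.inr i)))))) (Sum.elim pk fun _ => false) := by
  classical
  set e : Bits ((K ⊕ (A ⊕ wB)) ⊕ (K ⊕ (A ⊕ wC))) :=
    Sum.elim (Sum.elim b fun _ => false) (Sum.elim b fun _ => false) with he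
  have h0 : (Pi.single (playInit pk b) 1 : Bits (PlayWires P Y B C K A wA wB wC) → ℂ) =
      fun s => (Pi.single (Sum.elim pk fun _ => false) 1 :
        Bits (P ⊕ ((Y ⊕ (B ⊕ C)) ⊕ wA)) → ℂ) (s ∘ (Function.Embedding.inl : _ ↪ _ ⊕
          ((K ⊕ (A ⊕ wB)) ⊕ (K ⊕ (A ⊕ wC))))) * (if s ∘ Sum.inr = e then 1 else 0) := by
    funext s
    obtain ⟨⟨s1, s2⟩, rfl⟩ := (Equiv.sumArrowEquivProdArrow _ _ Bool).symm.surjective s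
    change (Pi.single (Sum.elim (Sum.elim pk fun _ => false) e) (1 : ℂ) : Bits _ → ℂ)
      (Sum.elim s1 s2) = (Pi.single (Sum.elim pk fun _ => false) 1 : Bits _ → ℂ) s1 *
        (if s2 = e then 1 else 0)
    rw [Pi.single_apply, Pi.single_apply]
    by_cases h1 : s1 = Sum.elim pk fun _ => false <;> by_cases h2 : s2 = e <;>
      simp [h1, h2, Sum.elim_eq_iff]
  have h1 : gateProd (gA.map (Gate.map Function.Embedding.inl)) *ᵥ
      (Pi.single (playInit pk b) 1 : Bits (PlayWires P Y B C K A wA wB wC) → ℂ) =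
      fun s => gateProd gA (s ∘ Sum.inl) (Sum.elim pk fun _ => false) *
        (if s ∘ Sum.inr = e then 1 else 0) := by
    rw [h0, map_mulVec_mul]
    · simp only [Matrix.mulVec_single_one, Matrix.col_apply]
      rfl
    · intro u s
      have : Function.extend (Function.Embedding.inl : _ ↪ _ ⊕
          ((K ⊕ (A ⊕ wB)) ⊕ (K ⊕ (A ⊕ wC)))) u s ∘ Sum.inr = s ∘ Sum.inr := by
        funext w
        exact Function.extend_apply' _ _ _ (by rintro ⟨a, ha⟩; cases ha)
      rw [this]
  have h2 : ∀ u, Function.extend charlieWires u s ∘ bobWires = s ∘ bobWires := by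
    intro u
    funext w
    refine Function.extend_apply' _ _ _ ?_
    rintro ⟨a, ha⟩
    exact bobWires_ne_charlieWires _ _ ha.symm
  set st : Bits (PlayWires P Y B C K A wA wB wC) → ℂ :=
    fun s => gateProd gA (s ∘ Sum.inl) (Sum.elim pk fun _ => false) *
        (if s ∘ Sum.inr = e then 1 else 0) with hst
  -- A nonzero amplitude before the local parties act forces challenge wires `b` and ancillas 0 for
  -- both of them.
  have hst0 : ∀ u u', st (Function.extend bobWires u (Function.extend charlieWires u' s)) ≠ 0 →
      ((∀ i, u (.inl (.inr i)) = b i) ∧ ∀ i, u (.inr i) = false) ∧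
      ((∀ i, u' (.inl (.inr i)) = b i) ∧ ∀ i, u' (.inr i) = false) := by
    intro u u' h
    have h3 : Function.extend bobWires u (Function.extend charlieWires u' s) ∘ Sum.inr = e := by
      by_contra h'
      apply h
      simp only [hst]
      rw [if_neg h', mul_zero]
    rw [extend_bobWires, extend_charlieWires] at h3
    exact ⟨⟨fun i => congrFun h3 (.inl (.inl i)), fun i => congrFun h3 (.inl (.inr i))⟩,
      ⟨fun i => congrFun h3 (.inr (.inl i)), fun i => congrFun h3 (.inr (.inr i))⟩⟩
  have hst1 : ∀ (t : Bits B) (t' : Bits C),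
      st (Function.extend bobWires (Sum.elim (Sum.elim t b) fun _ => false)
        (Function.extend charlieWires (Sum.elim (Sum.elim t' b) fun _ => false) s)) =
      gateProd gA (Sum.elim (fun i => s (.inl (.inl i)))
          (Sum.elim (Sum.elim (fun i => s (.inl (.inr (.inl (.inl i))))) (Sum.elim t t'))
            (fun i => s (.inl (.inr (.inr i)))))) (Sum.elim pk fun _ => false) := by
    intro t t'
    rw [extend_bobWires, extend_charlieWires]
    refine (congrArg₂ _ rfl (if_pos ?_)).trans (mul_one _)
    funext w
    rcases w with (w | w) | w | w <;> rfl
  have hlhs : (gateProd (playGates gA gB gC) *ᵥ Pi.single (playInit pk b) 1) s =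
      ∑ u', gateProd gC (s ∘ charlieWires) u' * ∑ u, gateProd gB (s ∘ bobWires) u *
        st (Function.extend bobWires u (Function.extend charlieWires u' s)) := by
    rw [playGates, gateProd_append, gateProd_append, ← Matrix.mulVec_mulVec,
      ← Matrix.mulVec_mulVec, h1, map_mulVec]
    refine Finset.sum_congr rfl fun u' _ => congrArg₂ _ rfl ?_
    refine (map_mulVec _ _ _ _).trans ?_
    rw [h2]
    rfl
  have hrhs := sum_bits_sum (fun t : Bits (B ⊕ C) => gateProd gB (s ∘ bobWires)
          (Sum.elim (Sum.elim (fun i => t (.inl i)) b) fun _ => false) *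
        gateProd gC (s ∘ charlieWires)
          (Sum.elim (Sum.elim (fun i => t (.inr i)) b) fun _ => false) *
        gateProd gA (Sum.elim (fun i => s (.inl (.inl i)))
          (Sum.elim (Sum.elim (fun i => s (.inl (.inr (.inl (.inl i))))) t)
            (fun i => s (.inl (.inr (.inr i)))))) (Sum.elim pk fun _ => false))
  rw [hlhs, hrhs, sum_initialized b (fun _ => false), Finset.sum_comm]
  · refine Finset.sum_congr rfl fun t' _ => ?_
    rw [sum_initialized b (fun _ => false), Finset.mul_sum]
    · refine Finset.sum_congr rfl fun t _ => ?_
      rw [hst1]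
      simp only [Sum.elim_inl, Sum.elim_inr]
      ring
    · intro u h
      exact (hst0 _ _ (right_ne_zero_of_mul h)).1
  · intro u' h
    obtain ⟨u, -, h'⟩ := Finset.exists_ne_zero_of_sum_ne_zero (right_ne_zero_of_mul h)
    exact (hst0 _ _ (right_ne_zero_of_mul h')).2

/-- Bit strings on all wires of a non-local player. -/
def playBitsEquiv : Bits (PlayWires P Y B C K A wA wB wC) ≃
    Bits Y × Bits A × Bits A × ((Bits (B ⊕ K) × Bits wB) × (Bits (C ⊕ K) × Bits wC)) ×
      (Bits P × Bits wA) where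
  toFun s := (fun i => s (.inl (.inr (.inl (.inl i)))), fun i => s (.inr (.inl (.inr (.inl i)))),
    fun i => s (.inr (.inr (.inr (.inl i)))),
    ((Sum.elim (fun i => s (.inl (.inr (.inl (.inr (.inl i)))))) (fun i => s (.inr (.inl (.inl i)))),
      fun i => s (.inr (.inl (.inr (.inr i))))),
     (Sum.elim (fun i => s (.inl (.inr (.inl (.inr (.inr i)))))) (fun i => s (.inr (.inr (.inl i)))),
      fun i => s (.inr (.inr (.inr (.inr i)))))),
    (fun i => s (.inl (.inl i)), fun i => s (.inl (.inr (.inr i)))))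
  invFun x := Sum.elim (Sum.elim x.2.2.2.2.1 (Sum.elim (Sum.elim x.1
      (Sum.elim (fun i => x.2.2.2.1.1.1 (.inl i)) fun i => x.2.2.2.1.2.1 (.inl i))) x.2.2.2.2.2))
    (Sum.elim (Sum.elim (fun i => x.2.2.2.1.1.1 (.inr i)) (Sum.elim x.2.1 x.2.2.2.1.1.2))
      (Sum.elim (fun i => x.2.2.2.1.2.1 (.inr i)) (Sum.elim x.2.2.1 x.2.2.2.1.2.2)))
  left_inv s := by
    funext w
    rcases w with (a | (a | a | a) | a) | (a | a | a) | (a | a | a) <;> rfl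
  right_inv x := by
    obtain ⟨y, aB, aC, ⟨⟨u1, u2⟩, u3, u4⟩, u5, u6⟩ := x
    refine Prod.ext rfl (Prod.ext rfl (Prod.ext rfl (Prod.ext (Prod.ext (Prod.ext ?_ rfl)
      (Prod.ext ?_ rfl)) rfl))) <;>
    · funext w
      rcases w with w | w <;> rfl

/-- The winning probability for one key pair and one challenge, as a sum over the final basis
states of the player. -/
theorem sum_born_play (CA : QCircuit P (Y ⊕ (B ⊕ C))) (CB : QCircuit (B ⊕ K) A)
    (CC : QCircuit (C ⊕ K) A) (pk : Bits P) (b : Bits K)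
    (acc : Bits Y → Bits A → Bits A → Prop) [∀ y a a', Decidable (acc y a a')] :
    ∑ y, ∑ aB, ∑ aC, (if acc y aB aC then
      born (tensor (restrict (CB.effect aB) (fun s => Sum.elim s b))
        (restrict (CC.effect aC) (fun s => Sum.elim s b))) (postMeasure (CA.output pk) y) else 0) =
    ∑ s : Bits (PlayWires P Y B C K A CA.work CB.work CC.work),
      if acc (fun i => s (.inl (.inr (.inl (.inl i))))) (fun i => s (.inr (.inl (.inr (.inl i)))))
          (fun i => s (.inr (.inr (.inr (.inl i))))) then
        ‖(gateProd (playGates CA.gates CB.gates CC.gates) *ᵥ Pi.single (playInit pk b) 1) s‖ ^ 2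
      else 0 := by
  have hb : ∀ y aB aC, born (tensor (restrict (CB.effect aB) (fun s => Sum.elim s b))
        (restrict (CC.effect aC) (fun s => Sum.elim s b))) (postMeasure (CA.output pk) y) =
      ∑ u : (Bits (B ⊕ K) × Bits CB.work) × (Bits (C ⊕ K) × Bits CC.work),
        ∑ w : Bits P × Bits CA.work, ‖∑ t : Bits (B ⊕ C),
          (CB.kraus u.1 aB (Sum.elim (fun i => t (.inl i)) b) *
            CC.kraus u.2 aC (Sum.elim (fun i => t (.inr i)) b)) *
          CA.kraus w (Sum.elim y t) pk‖ ^ 2 := by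
    intro y aB aC
    exact born_tensor_eq_sum _ _ _ (fun u t => CB.kraus u aB (Sum.elim t b))
      (fun u t => CC.kraus u aC (Sum.elim t b)) (fun w t => CA.kraus w (Sum.elim y t) pk)
      (fun _ _ => CB.effect_apply _ _ _) (fun _ _ => CC.effect_apply _ _ _)
      (fun _ _ => CA.output_apply _ _ _)
  have hs : ∀ x, (gateProd (playGates CA.gates CB.gates CC.gates) *ᵥ
      Pi.single (playInit pk b) 1) (playBitsEquiv.symm x) = ∑ t : Bits (B ⊕ C),
        (CB.kraus x.2.2.2.1.1 x.2.1 (Sum.elim (fun i => t (.inl i)) b) *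
          CC.kraus x.2.2.2.1.2 x.2.2.1 (Sum.elim (fun i => t (.inr i)) b)) *
          CA.kraus x.2.2.2.2 (Sum.elim x.1 t) pk := by
    intro x
    rw [playGates_apply]
    refine Finset.sum_congr rfl fun t _ => ?_
    refine congrArg₂ _ (congrArg₂ _ (congrArg₂ _ ?_ rfl) (congrArg₂ _ ?_ rfl)) rfl <;>
    · funext w
      rcases w with (w | w) | w | w <;> rfl
  -- Deferred measurement: the Kraus indices are the final contents of the discarded wires, and
  -- together with the obligation and the two answers they make up a final basis state of the whole
  -- play.
  rw [← playBitsEquiv.symm.sum_comp]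
  simp only [hs]
  rw [Fintype.sum_prod_type]
  refine Finset.sum_congr rfl fun y _ => ?_
  rw [Fintype.sum_prod_type]
  refine Finset.sum_congr rfl fun aB _ => ?_
  rw [Fintype.sum_prod_type]
  refine Finset.sum_congr rfl fun aC _ => ?_
  rw [hb]
  refine Eq.trans ?_ (Fintype.sum_prod_type _).symm
  by_cases h : acc y aB aC
  · rw [if_pos h]
    refine Finset.sum_congr rfl fun u _ => Finset.sum_congr rfl fun w _ => ?_
    exact (if_pos h).symm
  · rw [if_neg h]
    refine (Finset.sum_eq_zero fun u _ => Finset.sum_eq_zero fun w _ => ?_).symm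
    exact if_neg h

end Amplitudes

/-! ### Completeness of the parallel repetition -/

section Completeness

set_option linter.unusedSectionVars false
set_option synthInstance.maxSize 1000

/-- Distributivity; `E` splits a string of the repeated register into its blocks. It is applied to
one register after the other. -/
theorem sum_prod_equiv {X X' : Type} [Fintype X] [Fintype X'] {m : ℕ} {M : Type}
    [CommSemiring M] (E : X' ≃ (Fin m → X)) (F : Fin m → X → M) :
    ∑ x, ∏ i, F i (E x i) = ∏ i, ∑ x, F i x := by
  rw [E.sum_comp (fun x => ∏ i, F i (x i)), Finset.prod_univ_sum, Fintype.piFinset_univ]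

theorem expect_prod_equiv {X X' : Type} [Fintype X] [Fintype X'] {m : ℕ}
    (E : X' ≃ (Fin m → X)) (F : Fin m → X → ℝ) :
    𝔼 x, ∏ i, F i (E x i) = ∏ i, 𝔼 x, F i x := by
  simp only [Fintype.expect_eq_sum_div_card]
  rw [sum_prod_equiv E, Finset.prod_div_distrib, Fintype.card_congr E, Fintype.card_fun]
  simp

/-- Blocks of wires of the discarded registers of a repeated circuit. -/
def discardEquiv {ι ι' ω : Type} {m : ℕ} (e : Fin m × ι ≃ ι') :
    Bits ι' × Bits (Fin m × ω) ≃ (Fin m → Bits ι × Bits ω) where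
  toFun u i := (fun a => u.1 (e (i, a)), fun a => u.2 (i, a))
  invFun g := (fun x => (g (e.symm x).1).1 (e.symm x).2, fun x => (g x.1).2 x.2)
  left_inv u := by simp
  right_inv g := by simp

variable {ι ο ι' ο' : Type} [Fintype ι] [DecidableEq ι] [Fintype ο] [DecidableEq ο]
  [Fintype ι'] [DecidableEq ι'] [Fintype ο'] [DecidableEq ο']

/-- Independent copies have tensor products as Kraus operators; this is an instance of
`gateProd_flatMap`. -/
theorem QCircuit.kraus_replicate_relabel (m : ℕ) (C : QCircuit ι ο)
    (e : Fin m × ι ≃ ι') (f : Fin m × ο ≃ ο') (u) (o : Bits ο') (x : Bits ι') :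
    ((C.replicate m).relabel e f).kraus u o x =
      ∏ i : Fin m, C.kraus (fun a => u.1 (e (i, a)), fun a => u.2 (i, a))
        (fun a => o (f (i, a))) (fun a => x (e (i, a))) := by
  set E : Fin m → ι ⊕ (ο ⊕ C.work) ↪ ι' ⊕ (ο' ⊕ (Fin m × C.work)) := fun i =>
    ((Function.Embedding.sectR i ι).trans e.toEmbedding).sumMap
      (((Function.Embedding.sectR i ο).trans f.toEmbedding).sumMap
        (Function.Embedding.sectR i C.work)) with hE
  have hg : ((C.replicate m).relabel e f).gates =
      (List.finRange m).flatMap fun i => C.gates.map (Gate.map (E i)) := by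
    refine List.map_flatMap.trans (congrArg (fun F => List.flatMap F (List.finRange m))
      (funext fun i => (map_gate_map _ _ _).trans (congrArg (fun F => C.gates.map (Gate.map F)) ?_)))
    ext w
    rcases w with w | w | w <;> rfl
  have hE1 : ∀ i a, E i (.inl a) = .inl (e (i, a)) := fun _ _ => rfl
  have hE2 : ∀ i a, E i (.inr (.inl a)) = .inr (.inl (f (i, a))) := fun _ _ => rfl
  have hE3 : ∀ i a, E i (.inr (.inr a)) = .inr (.inr (i, a)) := fun _ _ => rfl
  have h := (gateProd_flatMap E (by
    rintro i j (a | a | a) (b | b | b) h <;> simp_all) (fun _ => C.gates)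
      (List.finRange m) (List.nodup_finRange m) (Sum.elim u.1 (Sum.elim o u.2))
      (Sum.elim x fun _ => false)).1 (by
        rintro w hw
        -- Every wire belongs to one of the copies, so the condition on the wires outside them is
        -- vacuous.
        exfalso
        rcases w with w | w | w
        · obtain ⟨⟨i, a⟩, rfl⟩ := e.surjective w
          exact hw i (by simp) ⟨.inl a, hE1 i a⟩
        · obtain ⟨⟨i, a⟩, rfl⟩ := f.surjective w
          exact hw i (by simp) ⟨.inr (.inl a), hE2 i a⟩
        · exact hw w.1 (by simp) ⟨.inr (.inr w.2), hE3 w.1 w.2⟩)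
  rw [← hg] at h
  refine (h.trans (Fin.prod_univ_def _).symm).trans (Finset.prod_congr rfl fun i _ => ?_)
  refine congrArg₂ (gateProd C.gates) ?_ ?_ <;>
  · funext w
    rcases w with w | w | w <;> rfl

namespace Puzzle

variable {k : ℕ → ℕ}

/-- The probability that the honest parties produce the obligation `y` and the answer `ans`, for
the coins `r` of the key generation. -/
def honestProb (Z : Puzzle k) (n : ℕ) (r : Bits (Z.Coins n)) (b : Bits (Fin (k n)))
    (y : Bits (Z.Y n)) (ans : Bits (Z.Ans n)) : ℝ :=
  born (restrict ((Z.solve n).effect ans)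
      (fun s => Sum.elim (Z.keyGen n r).1 (Sum.elim y (Sum.elim s b))))
    (postMeasure ((Z.obligate n).output (Z.keyGen n r).1) y)

theorem honestProb_eq (Z : Puzzle k) (n : ℕ) (r : Bits (Z.Coins n)) (b : Bits (Fin (k n)))
    (y : Bits (Z.Y n)) (ans : Bits (Z.Ans n)) : Z.honestProb n r b y ans =
      ∑ u, ∑ w, ‖∑ s, (Z.solve n).kraus u ans
        (Sum.elim (Z.keyGen n r).1 (Sum.elim y (Sum.elim s b))) *
        (Z.obligate n).kraus w (Sum.elim y s) (Z.keyGen n r).1‖ ^ 2 :=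
  born_honest _ _ _ _ _ _

theorem honestProb_nonneg (Z : Puzzle k) (n : ℕ) (r : Bits (Z.Coins n)) (b : Bits (Fin (k n)))
    (y : Bits (Z.Y n)) (ans : Bits (Z.Ans n)) : 0 ≤ Z.honestProb n r b y ans := by
  rw [honestProb_eq]; positivity

/-- The amplitude is a sum over the intermediate quantum register of a product over copies, hence a
product of amplitudes. Squared norms and the sums over discarded wires preserve the product form. -/
theorem honestProb_parallelRepetition (Z : Puzzle (fun _ => 1)) (k : ℕ → ℕ) (n : ℕ)
    (r : Bits ((Z.parallelRepetition k).Coins n)) (b : Bits (Fin (k n)))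
    (y : Bits ((Z.parallelRepetition k).Y n)) (ans : Bits ((Z.parallelRepetition k).Ans n)) :
    (Z.parallelRepetition k).honestProb n r b y ans =
      ∏ i, Z.honestProb n (block r i) (fun _ => b i) (block y i) (block ans i) := by
  set F : Fin (k n) → Bits (Z.PK n ⊕ (Z.Y n ⊕ (Z.R n ⊕ Fin 1))) × Bits (Z.solve n).work →
      Bits (Z.R n) → ℂ := fun i u s => (Z.solve n).kraus u (block ans i)
        (Sum.elim (Z.keyGen n (block r i)).1 (Sum.elim (block y i) (Sum.elim s fun _ => b i)))
    with hF
  set G : Fin (k n) → Bits (Z.PK n) × Bits (Z.obligate n).work → Bits (Z.R n) → ℂ :=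
    fun i w s => (Z.obligate n).kraus w (Sum.elim (block y i) s) (Z.keyGen n (block r i)).1 with hG
  have e1 : (Z.parallelRepetition k).honestProb n r b y ans =
      ∑ u : Bits ((Fin (k n) × Z.PK n) ⊕ ((Fin (k n) × Z.Y n) ⊕ ((Fin (k n) × Z.R n) ⊕
        Fin (k n)))) × Bits (Fin (k n) × (Z.solve n).work),
      ∑ w : Bits (Fin (k n) × Z.PK n) × Bits (Fin (k n) × (Z.obligate n).work),
      ‖∑ s : Bits (Fin (k n) × Z.R n),
        ∏ i, (F i (discardEquiv (solveWires (k n) _ _ _) u i) (Equiv.curry _ _ _ s i) *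
          G i (discardEquiv (Equiv.refl _) w i) (Equiv.curry _ _ _ s i))‖ ^ 2 := by
    rw [honestProb_eq]
    refine Finset.sum_congr rfl fun u _ => Finset.sum_congr rfl fun w _ => ?_
    refine congrArg (fun x : ℂ => ‖x‖ ^ 2) (Finset.sum_congr rfl fun s _ => ?_)
    rw [Finset.prod_mul_distrib]
    refine congrArg₂ _ ?_ ?_
    · refine (QCircuit.kraus_replicate_relabel _ _ _ _ _ _ _).trans
        (Finset.prod_congr rfl fun i _ => congrArg₂ _ rfl ?_)
      funext w
      rcases w with w | w | w | w <;> rfl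
    · refine (QCircuit.kraus_replicate_relabel _ _ _ _ _ _ _).trans
        (Finset.prod_congr rfl fun i _ => congrFun (congrArg _ ?_) _)
      funext w
      rcases w with w | w <;> rfl
  rw [e1]
  calc _ = ∑ u : Bits ((Fin (k n) × Z.PK n) ⊕ ((Fin (k n) × Z.Y n) ⊕ ((Fin (k n) × Z.R n) ⊕
        Fin (k n)))) × Bits (Fin (k n) × (Z.solve n).work),
      ∑ w : Bits (Fin (k n) × Z.PK n) × Bits (Fin (k n) × (Z.obligate n).work),
      ∏ i, ‖∑ s, F i (discardEquiv (solveWires (k n) _ _ _) u i) s *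
          G i (discardEquiv (Equiv.refl _) w i) s‖ ^ 2 := by
        refine Finset.sum_congr rfl fun u _ => Finset.sum_congr rfl fun w _ => ?_
        rw [Finset.prod_pow, ← norm_prod,
          ← sum_prod_equiv (Equiv.curry (Fin (k n)) (Z.R n) Bool)]
    _ = ∑ u : Bits ((Fin (k n) × Z.PK n) ⊕ ((Fin (k n) × Z.Y n) ⊕ ((Fin (k n) × Z.R n) ⊕
        Fin (k n)))) × Bits (Fin (k n) × (Z.solve n).work),
      ∏ i, ∑ w, ‖∑ s, F i (discardEquiv (solveWires (k n) _ _ _) u i) s * G i w s‖ ^ 2 := by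
        refine Finset.sum_congr rfl fun u _ => ?_
        rw [← sum_prod_equiv (discardEquiv (Equiv.refl (Fin (k n) × Z.PK n)))]
    _ = ∏ i, ∑ u, ∑ w, ‖∑ s, F i u s * G i w s‖ ^ 2 := by
        rw [← sum_prod_equiv (discardEquiv (solveWires (k n) _ _ _))]
    _ = _ := Finset.prod_congr rfl fun i _ => (honestProb_eq Z n _ _ _ _).symm

/-- Coins, challenges, obligations and answers all range over product spaces, and the indicator of
acceptance by all instances is a product as well. -/
theorem successProb_parallelRepetition (Z : Puzzle (fun _ => 1)) (k : ℕ → ℕ) (n : ℕ) :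
    (Z.parallelRepetition k).successProb n = Z.successProb n ^ k n := by
  have e1 : (Z.parallelRepetition k).successProb n =
      𝔼 r : Bits (Fin (k n) × Z.Coins n), 𝔼 b : Bits (Fin (k n)),
        ∑ y : Bits (Fin (k n) × Z.Y n), ∑ ans : Bits (Fin (k n) × Z.Ans n), ∏ i,
          if Z.ver n (Z.keyGen n (Equiv.curry _ _ _ r i)).2 (Equiv.curry _ _ _ y i) (fun _ => b i)
            (Equiv.curry _ _ _ ans i) = true then
          Z.honestProb n (Equiv.curry _ _ _ r i) (fun _ => b i) (Equiv.curry _ _ _ y i)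
            (Equiv.curry _ _ _ ans i) else 0 := by
    refine Finset.expect_congr rfl fun r _ => Finset.expect_congr rfl fun b _ =>
      Finset.sum_congr rfl fun y _ => Finset.sum_congr rfl fun ans _ => ?_
    by_cases h : ∀ i, Z.ver n (Z.keyGen n (Equiv.curry _ _ _ r i)).2 (Equiv.curry _ _ _ y i)
        (fun _ => b i) (Equiv.curry _ _ _ ans i) = true
    · refine (if_pos (decide_eq_true h)).trans
        ((honestProb_parallelRepetition Z k n r b y ans).trans ?_)
      exact Finset.prod_congr rfl fun i _ => (if_pos (h i)).symm
    · refine (if_neg (fun h' => h (of_decide_eq_true h'))).trans ?_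
      obtain ⟨i, hi⟩ := not_forall.1 h
      exact (Finset.prod_eq_zero (Finset.mem_univ i) (if_neg hi)).symm
  rw [e1]
  set T : Bits (Z.Coins n) → Bits (Fin 1) → Bits (Z.Y n) → Bits (Z.Ans n) → ℝ :=
    fun r b y ans => if Z.ver n (Z.keyGen n r).2 y b ans = true then Z.honestProb n r b y ans else 0
    with hT
  have e2 : Z.successProb n = 𝔼 r, 𝔼 b, ∑ y, ∑ ans, T r b y ans := rfl
  -- The challenge of the repetition is a tuple of bits, while a single instance expects a string of
  -- length one.
  let E : Bits (Fin (k n)) ≃ (Fin (k n) → Bits (Fin 1)) :=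
    ⟨fun b i _ => b i, fun g i => g i 0, fun _ => rfl, fun g => by
      funext i j; rw [Subsingleton.elim j 0]⟩
  calc _ = 𝔼 r : Bits (Fin (k n) × Z.Coins n), 𝔼 b : Bits (Fin (k n)),
        ∑ y : Bits (Fin (k n) × Z.Y n), ∑ ans : Bits (Fin (k n) × Z.Ans n), ∏ i,
          T (Equiv.curry _ _ _ r i) (E b i) (Equiv.curry _ _ _ y i) (Equiv.curry _ _ _ ans i) := rfl
    _ = 𝔼 r : Bits (Fin (k n) × Z.Coins n), 𝔼 b : Bits (Fin (k n)), ∏ i, ∑ y, ∑ ans,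
          T (Equiv.curry _ _ _ r i) (E b i) y ans := by
        refine Finset.expect_congr rfl fun r _ => Finset.expect_congr rfl fun b _ => ?_
        rw [← sum_prod_equiv (Equiv.curry (Fin (k n)) (Z.Y n) Bool)]
        refine Finset.sum_congr rfl fun y _ => ?_
        rw [← sum_prod_equiv (Equiv.curry (Fin (k n)) (Z.Ans n) Bool)]
    _ = 𝔼 r : Bits (Fin (k n) × Z.Coins n), ∏ i, 𝔼 b, ∑ y, ∑ ans,
          T (Equiv.curry _ _ _ r i) b y ans := by
        refine Finset.expect_congr rfl fun r _ => ?_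
        rw [← expect_prod_equiv E]
    _ = ∏ _i : Fin (k n), 𝔼 r, 𝔼 b, ∑ y, ∑ ans, T r b y ans := by
        rw [← expect_prod_equiv (Equiv.curry (Fin (k n)) (Z.Coins n) Bool)]
    _ = _ := by rw [e2]; simp

theorem successProb_nonneg (Z : Puzzle k) (n : ℕ) : 0 ≤ Z.successProb n := by
  refine Finset.expect_nonneg fun r _ => Finset.expect_nonneg fun b _ =>
    Finset.sum_nonneg fun y _ => Finset.sum_nonneg fun ans _ => ?_
  split_ifs
  · exact Z.honestProb_nonneg n r b y ans
  · exact le_rfl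

theorem completeness_parallelRepetition {Z : Puzzle (fun _ => 1)}
    (h : ∃ μ : ℕ → ℝ, Negligible μ ∧ Z.HasCompleteness (fun n => 1 - μ n))
    {k : ℕ → ℕ} (hk : PolyBounded k) : ∃ μ : ℕ → ℝ, Negligible μ ∧
      (Z.parallelRepetition k).HasCompleteness (fun n => 1 - μ n) := by
  obtain ⟨μ, hμ, hc⟩ := h
  refine ⟨_, hμ.mul_poly hk, fun n => ?_⟩
  rw [successProb_parallelRepetition]
  -- Bernoulli's inequality: a loss of `μ` in one copy becomes a loss of at most `k * μ`.
  have h1 := one_add_mul_le_pow (a := Z.successProb n - 1)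
    (by linarith [Z.successProb_nonneg n]) (k n)
  rw [add_sub_cancel] at h1
  refine le_trans ?_ h1
  have h2 := hc n
  nlinarith [(Nat.cast_nonneg (k n) : (0 : ℝ) ≤ k n)]

end Puzzle

end Completeness

/-! ### Public verification of the repeated puzzle with all but one secret key -/

section Verdict

set_option linter.unusedSectionVars false
set_option synthInstance.maxSize 1000

section Layers

variable {ι J : Type} [DecidableEq ι] [Fintype J]

theorem actList_layer_eq_extend (g : J → List (RevGate ι)) (tgt : J ↪ ι)
    (φ : J → Bits ι → Bool)
    (hact : ∀ j s, actList (g j) s = Function.update s (tgt j) (xor (s (tgt j)) (φ j s)))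
    (hφ : ∀ i j s x, φ i (Function.update s (tgt j) x) = φ i s) (s : Bits ι) :
    actList (layer g) s = Function.extend tgt (fun j => xor (s (tgt j)) (φ j s)) s := by
  obtain ⟨h1, h2⟩ := actList_layer g tgt tgt.injective φ hact hφ s
  funext w
  by_cases hw : ∃ j, tgt j = w
  · obtain ⟨j, rfl⟩ := hw
    rw [h1, tgt.injective.extend_apply]
  · rw [Function.extend_apply' _ _ _ hw]
    exact h2 w fun j hj => hw ⟨j, hj⟩

/-- Adds the bits on the wires `src` to the wires `tgt`. -/
def copyLayer (src : J → ι) (tgt : J ↪ ι) (h : ∀ i j, src i ≠ tgt j) : List (RevGate ι) :=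
  layer fun j => [.cx (src j) (tgt j) (h j j)]

theorem actList_copyLayer (src : J → ι) (tgt : J ↪ ι) (h : ∀ i j, src i ≠ tgt j) (s : Bits ι) :
    actList (copyLayer src tgt h) s =
      Function.extend tgt (fun j => xor (s (tgt j)) (s (src j))) s :=
  actList_layer_eq_extend _ tgt (fun j s => s (src j)) (fun _ _ => rfl)
    (fun i j _ _ => Function.update_of_ne (h i j) _ _) s

theorem length_copyLayer_le (src : J → ι) (tgt : J ↪ ι) (h : ∀ i j, src i ≠ tgt j) :
    (copyLayer src tgt h).length ≤ Fintype.card J :=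
  (length_layer_le _ 1 (fun _ => le_rfl)).trans (mul_one _).le

/-- Adds constant bits to the wires `tgt`. -/
def constLayer (tgt : J ↪ ι) (c : Bits J) : List (RevGate ι) :=
  layer fun j => if c j = true then [.x (tgt j)] else []

theorem actList_constLayer (tgt : J ↪ ι) (c : Bits J) (s : Bits ι) :
    actList (constLayer tgt c) s = Function.extend tgt (fun j => xor (s (tgt j)) (c j)) s :=
  actList_layer_eq_extend _ tgt (fun j _ => c j) (fun j s => by
    cases h : c j <;> simp [actList_cons, RevGate.act]) (fun _ _ _ _ => rfl) s

theorem length_constLayer_le (tgt : J ↪ ι) (c : Bits J) :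
    (constLayer tgt c).length ≤ Fintype.card J :=
  (length_layer_le _ 1 (fun _ => by split_ifs <;> simp)).trans (mul_one _).le

end Layers

/-- A nonzero amplitude needs at least one path of nonzero amplitudes. Facts that hold with
certainty can thus be followed along basis states through a circuit, its quantum parts included. -/
theorem exists_of_gateProd_append_ne_zero {ι : Type} [Fintype ι] [DecidableEq ι]
    {gs hs : List (Gate ι)} {s t : Bits ι} (h : gateProd (gs ++ hs) s t ≠ 0) :
    ∃ m, gateProd gs m t ≠ 0 ∧ gateProd hs s m ≠ 0 := by
  rw [gateProd_append, Matrix.mul_apply] at h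
  obtain ⟨m, -, hm⟩ := Finset.exists_ne_zero_of_sum_ne_zero h
  exact ⟨m, right_ne_zero_of_mul hm, left_ne_zero_of_mul hm⟩

theorem eq_actList_of_ne_zero {ι : Type} [Fintype ι] [DecidableEq ι] {gs : List (RevGate ι)}
    {s t : Bits ι} (h : gateProd (gs.map Gate.rev) s t ≠ 0) : s = actList gs t := by
  by_contra hne
  rw [gateProd_rev_apply, if_neg hne] at h
  exact h rfl

theorem gateProd_map_ne_zero {ι κ : Type} [Fintype ι] [DecidableEq ι] [Fintype κ] [DecidableEq κ]
    {f : ι ↪ κ} {gs : List (Gate ι)} {s t : Bits κ}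
    (h : gateProd (gs.map (Gate.map f)) s t ≠ 0) :
    (∀ w, w ∉ Set.range f → s w = t w) ∧ gateProd gs (s ∘ f) (t ∘ f) ≠ 0 := by
  have h1 : ∀ w, w ∉ Set.range f → s w = t w := by
    by_contra hne
    exact h (gateProd_map_apply_eq_zero _ _ _ _ hne)
  exact ⟨h1, by rwa [gateProd_map_apply _ _ _ _ h1] at h⟩

variable {P S Y A ωv ωc : Type} {m : ℕ}

/-- The wires of the verdict: public key, obligations and answers as inputs, one output, and as
work wires the secret keys and challenges, the verdicts of the copies with their work wires, the
work wires of the conjunction and those of the public verification. -/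
abbrev VerdictWires (P S Y A ωv ωc : Type) (m : ℕ) : Type :=
  (P ⊕ ((Fin m × Y) ⊕ (Fin m × A))) ⊕ (Unit ⊕ (((Fin m × S) ⊕ Fin m) ⊕
    ((Fin m × (Unit ⊕ ωc)) ⊕ (Fin (m + 1) ⊕ ωv))))

/-- The wires of the `j`-th verification with the secret key. -/
def secretVerFun (j : Fin m) :
    (S ⊕ (Y ⊕ (Fin 1 ⊕ A))) ⊕ (Unit ⊕ ωc) → VerdictWires P S Y A ωv ωc m
  | .inl (.inl a) => .inr (.inr (.inl (.inl (j, a))))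
  | .inl (.inr (.inl a)) => .inl (.inr (.inl (j, a)))
  | .inl (.inr (.inr (.inl _))) => .inr (.inr (.inl (.inr j)))
  | .inl (.inr (.inr (.inr a))) => .inl (.inr (.inr (j, a)))
  | .inr a => .inr (.inr (.inr (.inl (j, a))))

theorem secretVerFun_disjoint (i j : Fin m) (a b : (S ⊕ (Y ⊕ (Fin 1 ⊕ A))) ⊕ (Unit ⊕ ωc))
    (h : secretVerFun (P := P) (ωv := ωv) i a = secretVerFun j b) : i = j := by
  rcases a with (a | a | a | a) | a <;> rcases b with (b | b | b | b) | b <;>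
    simp_all [secretVerFun]

/-- `secretVerFun` as an embedding. -/
def secretVer (j : Fin m) :
    (S ⊕ (Y ⊕ (Fin 1 ⊕ A))) ⊕ (Unit ⊕ ωc) ↪ VerdictWires P S Y A ωv ωc m where
  toFun := secretVerFun j
  inj' := by
    rintro ((a | a | a | a) | a) ((b | b | b | b) | b) h <;> simp_all [secretVerFun]
    exact Subsingleton.elim _ _

/-- The wires of the public verification of the `i`-th copy. -/
def publicVerFun (i : Fin m) :
    (P ⊕ (Y ⊕ A)) ⊕ (Unit ⊕ ωv) → VerdictWires P S Y A ωv ωc m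
  | .inl (.inl a) => .inl (.inl a)
  | .inl (.inr (.inl a)) => .inl (.inr (.inl (i, a)))
  | .inl (.inr (.inr a)) => .inl (.inr (.inr (i, a)))
  | .inr (.inl a) => .inr (.inr (.inr (.inl (i, .inl a))))
  | .inr (.inr a) => .inr (.inr (.inr (.inr (.inr a))))

/-- `publicVerFun` as an embedding. -/
def publicVer (i : Fin m) :
    (P ⊕ (Y ⊕ A)) ⊕ (Unit ⊕ ωv) ↪ VerdictWires P S Y A ωv ωc m where
  toFun := publicVerFun i
  inj' := by rintro ((a | a | a) | a | a) ((b | b | b) | b | b) h <;> simp_all [publicVerFun]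

/-- The wires of the conjunction. -/
def conjVerFun : Fin m ⊕ Fin (m + 1) → VerdictWires P S Y A ωv ωc m
  | .inl j => .inr (.inr (.inr (.inl (j, .inl ()))))
  | .inr j => .inr (.inr (.inr (.inr (.inl j))))

/-- `conjVerFun` as an embedding. -/
def conjVer : Fin m ⊕ Fin (m + 1) ↪ VerdictWires P S Y A ωv ωc m where
  toFun := conjVerFun
  inj' := by rintro (a | a) (b | b) h <;> simp_all [conjVerFun]

theorem publicVer_apply (i : Fin m) (a) :
    publicVer (P := P) (S := S) (Y := Y) (A := A) (ωv := ωv) (ωc := ωc) i a = publicVerFun i a :=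
  rfl

theorem conjVer_apply (a) : conjVer (P := P) (S := S) (Y := Y) (A := A) (ωv := ωv) (ωc := ωc)
    (m := m) a = conjVerFun a := rfl

/-- The wires of the constants. -/
def hardwired : (Fin m × S) ⊕ Fin m ↪ VerdictWires P S Y A ωv ωc m where
  toFun a := .inr (.inr (.inl a))
  inj' := by intro a b h; simpa using h

variable [Fintype P] [DecidableEq P] [Fintype S] [DecidableEq S] [Fintype Y] [DecidableEq Y]
  [Fintype A] [DecidableEq A] [Fintype ωv] [DecidableEq ωv] [Fintype ωc] [DecidableEq ωc]

/-- Verify the `i`-th copy publicly and the other copies with hardwired secret keys and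
challenges, and take the conjunction of the verdicts. -/
def verdictGates (i : Fin m) (sk : Bits (Fin m × S)) (b : Bits (Fin m))
    (gv : List (Gate ((P ⊕ (Y ⊕ A)) ⊕ (Unit ⊕ ωv))))
    (gc : List (RevGate ((S ⊕ (Y ⊕ (Fin 1 ⊕ A))) ⊕ (Unit ⊕ ωc)))) :
    List (Gate (VerdictWires P S Y A ωv ωc m)) :=
  (constLayer hardwired (Sum.elim sk b)).map Gate.rev ++
    (((List.finRange m).filter (· ≠ i)).flatMap fun j => gc.map (RevGate.map (secretVer j))).map
      Gate.rev ++
    gv.map (Gate.map (publicVer i)) ++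
    ((andGates m).map (RevGate.map conjVer) ++ [RevGate.cx (ι := VerdictWires P S Y A ωv ωc m)
      (.inr (.inr (.inr (.inr (.inl (Fin.last m)))))) (.inr (.inl ())) (by simp)]).map Gate.rev

/-- Only the public verification of copy `i` is quantum, and by `hv` its output bit is constant on
the support of its final state. All other steps permute basis states, so the verdict is the same
along every path of nonzero amplitude. -/
theorem verdictGates_exact (i : Fin m) (sk : Bits (Fin m × S)) (b : Bits (Fin m))
    (gv : List (Gate ((P ⊕ (Y ⊕ A)) ⊕ (Unit ⊕ ωv))))
    (gc : List (RevGate ((S ⊕ (Y ⊕ (Fin 1 ⊕ A))) ⊕ (Unit ⊕ ωc))))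
    (pk : Bits P) (y : Bits (Fin m × Y)) (a : Bits (Fin m × A)) (val : Bits (Fin m))
    (hv : ∀ s, gateProd gv s (Sum.elim (Sum.elim pk (Sum.elim (block y i) (block a i)))
      fun _ => false) ≠ 0 → s (.inr (.inl ())) = val i)
    (hc : ∀ j, j ≠ i → actList gc (Sum.elim (Sum.elim (block sk j) (Sum.elim (block y j)
      (Sum.elim (fun _ => b j) (block a j)))) fun _ => false) (.inr (.inl ())) = val j)
    (s : Bits (VerdictWires P S Y A ωv ωc m))
    (hs : gateProd (verdictGates i sk b gv gc) s
      (Sum.elim (Sum.elim pk (Sum.elim y a)) fun _ => false) ≠ 0) :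
    s (.inr (.inl ())) = decide (∀ j, val j = true) := by
  obtain ⟨m3, hs, h4⟩ := exists_of_gateProd_append_ne_zero hs
  obtain ⟨m2, hs, h3⟩ := exists_of_gateProd_append_ne_zero hs
  obtain ⟨m1, h1, h2⟩ := exists_of_gateProd_append_ne_zero hs
  replace h1 := eq_actList_of_ne_zero h1
  replace h2 := eq_actList_of_ne_zero h2
  replace h4 := eq_actList_of_ne_zero h4
  rw [actList_constLayer] at h1
  have hm1 : m1 = Sum.elim (Sum.elim pk (Sum.elim y a)) (Sum.elim (fun _ => false)
      (Sum.elim (Sum.elim sk b) fun _ => false)) := by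
    rw [h1]
    funext w
    rcases w with w | w | w | w
    · exact Function.extend_apply' _ _ _ (by rintro ⟨x, hx⟩; cases hx)
    · exact Function.extend_apply' _ _ _ (by rintro ⟨x, hx⟩; cases hx)
    · refine (hardwired.injective.extend_apply _ _ w).trans ?_
      exact Bool.false_xor _
    · exact Function.extend_apply' _ _ _ (by rintro ⟨x, hx⟩; cases hx)
  obtain ⟨hA, hB⟩ := actList_flatMap (secretVer (P := P) (S := S) (Y := Y) (A := A) (ωv := ωv)
    (ωc := ωc) (m := m)) secretVerFun_disjoint (fun _ => gc) ((List.finRange m).filter (· ≠ i))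
    ((List.nodup_finRange m).filter _) m1
  rw [← h2] at hA hB
  have hout : ∀ w, (∀ j, j ≠ i → ∀ x, secretVerFun j x ≠ w) → m2 w = m1 w := by
    intro w hw
    refine hB w ?_
    rintro j hj ⟨x, hx⟩
    exact hw j (by simpa using hj) x hx
  obtain ⟨h5, h6⟩ := gateProd_map_ne_zero h3
  -- The verifications of the copies `j ≠ i` use no wire of the public verification, which therefore
  -- finds its inputs and zeroed ancillas.
  have hm2 : m2 ∘ publicVer i = Sum.elim (Sum.elim pk (Sum.elim (block y i) (block a i)))
      fun _ => false := by
    funext w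
    refine (hout (publicVer i w) ?_).trans ?_
    · intro j hj x hx
      rcases w with (w | w | w) | w | w <;> rcases x with (x | x | x | x) | x <;>
        simp [publicVer_apply, publicVerFun, secretVerFun] at hx
      all_goals exact hj hx.1
    · rw [hm1]
      rcases w with (w | w | w) | w | w <;> rfl
  rw [hm2] at h6
  have h7 : m3 (.inr (.inr (.inr (.inl (i, .inl ()))))) = val i := hv _ h6
  have h8 : ∀ j, m3 (.inr (.inr (.inr (.inl (j, .inl ()))))) = val j := by
    intro j
    by_cases hj : j = i
    · rw [hj, h7]
    · rw [h5 _ (by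
        rintro ⟨x, hx⟩
        rcases x with (x | x | x) | x | x <;> simp [publicVer_apply, publicVerFun] at hx
        exact hj hx.symm), ← hc j hj]
      have := congrFun (hA j (by simp [hj])) (.inr (.inl ()))
      refine this.trans (congrArg (fun z => actList gc z (.inr (.inl ()))) ?_)
      rw [hm1]
      funext w
      rcases w with (w | w | w | w) | w <;> rfl
  -- Wires of no verification are unchanged; this supplies the zeroed work wires of the conjunction
  -- and the zeroed output.
  have h9 : ∀ w, (∀ j x, secretVerFun j x ≠ w) → (∀ x, publicVer i x ≠ w) → m3 w = m1 w := by
    intro w hw hw'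
    rw [h5 w (by rintro ⟨x, hx⟩; exact hw' x hx)]
    exact hout w fun j _ => hw j
  have h10 := (actList_andGates m (m3 ∘ conjVer) (fun j => by
    refine (h9 _ ?_ ?_).trans (by rw [hm1]; rfl)
    · intro j x hx
      rcases x with (x | x | x | x) | x <;> simp [secretVerFun, conjVer_apply, conjVerFun] at hx
    · intro x hx
      rcases x with (x | x | x) | x | x <;> simp [publicVer_apply, publicVerFun, conjVer_apply, conjVerFun] at hx)).2
  rw [h4, actList_append, actList_map, actList_cons, actList_nil, RevGate.act,
    Function.update_self, Function.extend_apply', h9]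
  · have := conjVer.injective.extend_apply (actList (andGates m) (m3 ∘ conjVer)) m3
      (.inr (Fin.last m))
    refine (congrArg₂ xor (congrFun hm1 _) (this.trans h10)).trans ?_
    rw [Sum.elim_inr, Sum.elim_inl, Bool.false_xor]
    congr 1
    exact forall_congr fun j => by rw [← h8 j]; rfl
  · intro j x hx
    rcases x with (x | x | x | x) | x <;> simp [secretVerFun] at hx
  · intro x hx
    rcases x with (x | x | x) | x | x <;> simp [publicVer_apply, publicVerFun] at hx
  · rintro ⟨x | x, hx⟩ <;> simp [conjVer_apply, conjVerFun] at hx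

theorem length_verdictGates_le (i : Fin m) (sk : Bits (Fin m × S)) (b : Bits (Fin m))
    (gv : List (Gate ((P ⊕ (Y ⊕ A)) ⊕ (Unit ⊕ ωv))))
    (gc : List (RevGate ((S ⊕ (Y ⊕ (Fin 1 ⊕ A))) ⊕ (Unit ⊕ ωc)))) :
    (verdictGates i sk b gv gc).length ≤
      m * Fintype.card S + m + m * gc.length + gv.length + (m + 2) := by
  have h1 := length_constLayer_le (hardwired (P := P) (S := S) (Y := Y) (A := A) (ωv := ωv)
    (ωc := ωc) (m := m)) (Sum.elim sk b)
  have h2 : (((List.finRange m).filter (· ≠ i)).flatMap fun j =>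
      gc.map (RevGate.map (secretVer (P := P) (ωv := ωv) j))).length ≤ m * gc.length := by
    rw [List.length_flatMap]
    simp only [List.length_map, List.map_const', List.sum_replicate, smul_eq_mul]
    refine Nat.mul_le_mul_right _ ((List.length_filter_le _ _).trans ?_)
    simp
  simp only [Fintype.card_sum, Fintype.card_prod, Fintype.card_fin] at h1
  simp only [verdictGates, List.length_append, List.length_map, length_andGates,
    List.length_singleton]
  omega

end Verdict

/-! ### The honest parties as one circuit -/

section Honest

set_option linter.unusedSectionVars false
set_option synthInstance.maxSize 1000

variable {P Y R K A wO wS : Type}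

/-- The wires of the honest parties: public key, the outputs obligation and answer, the wires of
`Obligate` and the remaining wires of `Solve`. -/
abbrev HonestWires (P Y R K A wO wS : Type) : Type :=
  P ⊕ ((Y ⊕ A) ⊕ (((Y ⊕ R) ⊕ wO) ⊕ (P ⊕ (K ⊕ wS))))

/-- The wires of `Obligate`. -/
def obligateWires : P ⊕ ((Y ⊕ R) ⊕ wO) ↪ HonestWires P Y R K A wO wS where
  toFun
    | .inl a => .inl a
    | .inr a => .inr (.inr (.inl a))
  inj' := by rintro (a | a) (b | b) h <;> simp_all

/-- The wires of `Solve`. -/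
def solverWires : (P ⊕ (Y ⊕ (R ⊕ K))) ⊕ (A ⊕ wS) ↪ HonestWires P Y R K A wO wS where
  toFun
    | .inl (.inl a) => .inr (.inr (.inr (.inl a)))
    | .inl (.inr (.inl a)) => .inr (.inr (.inl (.inl (.inl a))))
    | .inl (.inr (.inr (.inl a))) => .inr (.inr (.inl (.inl (.inr a))))
    | .inl (.inr (.inr (.inr a))) => .inr (.inr (.inr (.inr (.inl a))))
    | .inr (.inl a) => .inr (.inl (.inr a))
    | .inr (.inr a) => .inr (.inr (.inr (.inr (.inr a))))
  inj' := by rintro ((a | a | a | a) | a | a) ((b | b | b | b) | b | b) h <;> simp_all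

/-- The public key of `Solve`. -/
def solverKeyWires : P ↪ HonestWires P Y R K A wO wS where
  toFun a := .inr (.inr (.inr (.inl a)))
  inj' := by intro a b h; simpa using h

/-- The challenge of `Solve`. -/
def solverChallengeWires : K ↪ HonestWires P Y R K A wO wS where
  toFun a := .inr (.inr (.inr (.inr (.inl a))))
  inj' := by intro a b h; simpa using h

/-- The obligation as an output. -/
def obligationWires : Y ↪ HonestWires P Y R K A wO wS where
  toFun a := .inr (.inl (.inl a))
  inj' := by intro a b h; simpa using h

variable [Fintype P] [DecidableEq P] [Fintype Y] [DecidableEq Y] [Fintype R] [DecidableEq R]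
  [Fintype K] [DecidableEq K] [Fintype A] [DecidableEq A] [Fintype wO] [DecidableEq wO]
  [Fintype wS] [DecidableEq wS]

/-- Run `Obligate`, copy the obligation, and run `Solve` on the challenge `c`. -/
def honestGates (gO : List (Gate (P ⊕ ((Y ⊕ R) ⊕ wO))))
    (gS : List (Gate ((P ⊕ (Y ⊕ (R ⊕ K))) ⊕ (A ⊕ wS)))) (c : Bits K) :
    List (Gate (HonestWires P Y R K A wO wS)) :=
  (copyLayer Sum.inl solverKeyWires (fun _ _ h => by cases h) ++
      constLayer solverChallengeWires c).map Gate.rev ++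
    gO.map (Gate.map obligateWires) ++
    (copyLayer (fun y => .inr (.inr (.inl (.inl (.inl y))))) obligationWires
      (fun _ _ h => by cases h)).map Gate.rev ++
    gS.map (Gate.map solverWires)

theorem extend_obligateWires_rest (u : Bits (P ⊕ ((Y ⊕ R) ⊕ wO)))
    (s : Bits (HonestWires P Y R K A wO wS)) :
    (∀ i, Function.extend obligateWires u s (.inr (.inl i)) = s (.inr (.inl i))) ∧
    (∀ i, Function.extend obligateWires u s (.inr (.inr (.inr i))) = s (.inr (.inr (.inr i)))) := by
  constructor <;> intro i <;> refine Function.extend_apply' _ _ _ ?_ <;> rintro ⟨a | a, ha⟩ <;>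
    cases ha

theorem extend_solverWires (u : Bits ((P ⊕ (Y ⊕ (R ⊕ K))) ⊕ (A ⊕ wS)))
    (s : Bits (HonestWires P Y R K A wO wS)) : Function.extend solverWires u s =
      Sum.elim (fun i => s (.inl i)) (Sum.elim
        (Sum.elim (fun i => s (.inr (.inl (.inl i)))) fun i => u (.inr (.inl i)))
        (Sum.elim (Sum.elim (Sum.elim (fun i => u (.inl (.inr (.inl i))))
            fun i => u (.inl (.inr (.inr (.inl i))))) fun i => s (.inr (.inr (.inl (.inr i)))))
          (Sum.elim (fun i => u (.inl (.inl i))) (Sum.elim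
            (fun i => u (.inl (.inr (.inr (.inr i))))) fun i => u (.inr (.inr i)))))) := by
  have hn : ∀ w, (∀ x, solverWires x ≠ w) → Function.extend solverWires u s w = s w :=
    fun w hw => Function.extend_apply' _ _ _ (by rintro ⟨x, hx⟩; exact hw x hx)
  funext w
  rcases w with w | (w | w) | ((w | w) | w) | w | w | w
  · exact hn _ (by rintro ((a | a | a | a) | a | a) h <;> cases h)
  · exact hn _ (by rintro ((a | a | a | a) | a | a) h <;> cases h)
  · exact solverWires.injective.extend_apply u s (.inr (.inl w))
  · exact solverWires.injective.extend_apply u s (.inl (.inr (.inl w)))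
  · exact solverWires.injective.extend_apply u s (.inl (.inr (.inr (.inl w))))
  · exact hn _ (by rintro ((a | a | a | a) | a | a) h <;> cases h)
  · exact solverWires.injective.extend_apply u s (.inl (.inl w))
  · exact solverWires.injective.extend_apply u s (.inl (.inr (.inr (.inr w))))
  · exact solverWires.injective.extend_apply u s (.inr (.inr w))

theorem extend_obligationWires (u : Bits Y)
    (s : Bits (HonestWires P Y R K A wO wS)) : Function.extend obligationWires u s =
      Sum.elim (fun i => s (.inl i)) (Sum.elim
        (Sum.elim u fun i => s (.inr (.inl (.inr i)))) fun i => s (.inr (.inr i))) := by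
  have hn : ∀ w, (∀ x, obligationWires x ≠ w) → Function.extend obligationWires u s w = s w :=
    fun w hw => Function.extend_apply' _ _ _ (by rintro ⟨x, hx⟩; exact hw x hx)
  funext w
  rcases w with w | (w | w) | w
  · exact hn _ (by rintro a h; cases h)
  · exact obligationWires.injective.extend_apply u s w
  · exact hn _ (by rintro a h; cases h)
  · exact hn _ (by rintro a h; cases h)

/-- The copy of the obligation plays the role of its measurement: `Solve` may change its own input
wires, but the output wire keeps `y`. Interference remains only over the content `r` of the quantum
register. -/
theorem honestGates_apply (gO : List (Gate (P ⊕ ((Y ⊕ R) ⊕ wO))))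
    (gS : List (Gate ((P ⊕ (Y ⊕ (R ⊕ K))) ⊕ (A ⊕ wS)))) (c : Bits K) (pk : Bits P)
    (s : Bits (HonestWires P Y R K A wO wS)) :
    gateProd (honestGates gO gS c) s (Sum.elim pk fun _ => false) =
      ∑ r, gateProd gS (s ∘ solverWires) (Sum.elim (Sum.elim pk
        (Sum.elim (fun i => s (.inr (.inl (.inl i)))) (Sum.elim r c))) fun _ => false) *
      gateProd gO (Sum.elim (fun i => s (.inl i)) (Sum.elim (Sum.elim
        (fun i => s (.inr (.inl (.inl i)))) r) fun i => s (.inr (.inr (.inl (.inr i))))))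
        (Sum.elim pk fun _ => false) := by
  classical
  -- `q` describes the wires that `Obligate` does not touch: outputs still 0, and the input of
  -- `Solve` already loaded with key and challenge.
  set q : Bits (HonestWires P Y R K A wO wS) → Prop := fun s =>
    (∀ i, s (.inr (.inl i)) = false) ∧
    ∀ i, s (.inr (.inr (.inr i))) = (Sum.elim pk (Sum.elim c fun _ => false) : Bits _) i with hq
  have h0 : gateProd ((copyLayer Sum.inl solverKeyWires (fun _ _ h => by cases h) ++
      constLayer solverChallengeWires c).map Gate.rev) *ᵥ (Pi.single (Sum.elim pk fun _ => false) 1 :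
      Bits (HonestWires P Y R K A wO wS) → ℂ) = fun s =>
      (Pi.single (Sum.elim pk fun _ => false) 1 : Bits (P ⊕ ((Y ⊕ R) ⊕ wO)) → ℂ)
        (s ∘ obligateWires) * (if q s then 1 else 0) := by
    have ha : actList (copyLayer Sum.inl solverKeyWires (fun _ _ h => by cases h) ++
        constLayer solverChallengeWires c) (Sum.elim pk fun _ => false) =
        (Sum.elim pk (Sum.elim (fun _ => false) (Sum.elim (fun _ => false)
          (Sum.elim pk (Sum.elim c fun _ => false)))) : Bits (HonestWires P Y R K A wO wS)) := by
      rw [actList_append, actList_copyLayer, actList_constLayer]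
      have hk : ∀ (u : Bits P) (t : Bits (HonestWires P Y R K A wO wS)) w,
          (∀ x, solverKeyWires x ≠ w) → Function.extend solverKeyWires u t w = t w :=
        fun u t w hw => Function.extend_apply' _ _ _ (by rintro ⟨x, hx⟩; exact hw x hx)
      have hc : ∀ (u : Bits K) (t : Bits (HonestWires P Y R K A wO wS)) w,
          (∀ x, solverChallengeWires x ≠ w) → Function.extend solverChallengeWires u t w = t w :=
        fun u t w hw => Function.extend_apply' _ _ _ (by rintro ⟨x, hx⟩; exact hw x hx)
      funext w
      rcases w with w | w | w | w | w | w
      · exact (hc _ _ _ (fun x h => by cases h)).trans (hk _ _ _ (fun x h => by cases h))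
      · exact (hc _ _ _ (fun x h => by cases h)).trans (hk _ _ _ (fun x h => by cases h))
      · exact (hc _ _ _ (fun x h => by cases h)).trans (hk _ _ _ (fun x h => by cases h))
      · exact (hc _ _ _ (fun x h => by cases h)).trans
          ((solverKeyWires.injective.extend_apply _ _ w).trans (Bool.false_xor _))
      · refine (solverChallengeWires.injective.extend_apply _ _ w).trans ?_
        rw [hk _ _ _ (fun x h => by cases h)]
        exact Bool.false_xor _
      · exact (hc _ _ _ (fun x h => by cases h)).trans (hk _ _ _ (fun x h => by cases h))
    rw [gateProd_rev_single, ha]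
    funext s
    rw [Pi.single_apply, Pi.single_apply]
    have hiff : s = (Sum.elim pk (Sum.elim (fun _ => false) (Sum.elim (fun _ => false)
          (Sum.elim pk (Sum.elim c fun _ => false)))) : Bits (HonestWires P Y R K A wO wS)) ↔
        (s ∘ obligateWires = Sum.elim pk fun _ => false) ∧ q s := by
      constructor
      · rintro rfl
        refine ⟨?_, fun i => rfl, fun i => rfl⟩
        funext w
        rcases w with w | w <;> rfl
      · rintro ⟨e1, e2, e3⟩
        funext w
        rcases w with w | w | w | w
        · exact congrFun e1 (.inl w)
        · exact e2 w
        · exact congrFun e1 (.inr w)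
        · exact e3 w
    by_cases e1 : s ∘ obligateWires = Sum.elim pk fun _ => false <;> by_cases e2 : q s <;>
      simp [hiff, e1, e2]
  have h1 : gateProd (gO.map (Gate.map obligateWires)) *ᵥ (fun s =>
      (Pi.single (Sum.elim pk fun _ => false) 1 : Bits (P ⊕ ((Y ⊕ R) ⊕ wO)) → ℂ)
        (s ∘ obligateWires) * (if q s then 1 else 0)) =
      fun s : Bits (HonestWires P Y R K A wO wS) =>
        gateProd gO (s ∘ obligateWires) (Sum.elim pk fun _ => false) *
        (if q s then 1 else 0) := by
    rw [map_mulVec_mul]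
    · simp only [Matrix.mulVec_single_one, Matrix.col_apply]
    · intro u s
      obtain ⟨e1, e2⟩ := extend_obligateWires_rest u s
      simp only [hq, e1, e2]
  set st : Bits (HonestWires P Y R K A wO wS) → ℂ := fun s =>
    gateProd gO (s ∘ obligateWires) (Sum.elim pk fun _ => false) * (if q s then 1 else 0) with hst
  have hstq : ∀ t, st t ≠ 0 → q t := by
    intro t ht
    by_contra h'
    exact ht ((congrArg₂ _ rfl (if_neg h')).trans (mul_zero _))
  -- The amplitude at `s` is the one at the preimage of `s`, where the output wires carry the sum
  -- modulo 2 of the two obligations. Since they start as 0, only strings with two equal obligations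
  -- survive.
  have h2 : ∀ s, (gateProd ((copyLayer (fun y => .inr (.inr (.inl (.inl (.inl y))))) obligationWires
      (fun _ _ h => by cases h)).map Gate.rev) *ᵥ st) s =
      st (Sum.elim (fun i => s (.inl i)) (Sum.elim
        (Sum.elim (fun i => xor (s (.inr (.inl (.inl i)))) (s (.inr (.inr (.inl (.inl (.inl i)))))))
          fun i => s (.inr (.inl (.inr i)))) fun i => s (.inr (.inr i)))) := by
    intro s
    rw [← gateProd_rev_mulVec (copyLayer (fun y => .inr (.inr (.inl (.inl (.inl y)))))
      obligationWires (fun _ _ h => by cases h)) st]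
    congr 1
    rw [actList_copyLayer, extend_obligationWires]
    funext w
    rcases w with w | (w | w) | w
    · rfl
    · have hx : ∀ a b : Bool, a = xor (xor a b) b := by decide
      exact hx _ _
    · rfl
    · rfl
  have h3 : gateProd (honestGates gO gS c) s (Sum.elim pk fun _ => false) =
      (gateProd (gS.map (Gate.map solverWires)) *ᵥ (gateProd ((copyLayer
        (fun y => .inr (.inr (.inl (.inl (.inl y))))) obligationWires
        (fun _ _ h => by cases h)).map Gate.rev) *ᵥ st)) s := by
    rw [← h1, ← h0, Matrix.mulVec_mulVec, Matrix.mulVec_mulVec, Matrix.mulVec_mulVec,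
      ← gateProd_append, ← gateProd_append, ← gateProd_append, Matrix.mulVec_single_one,
      Matrix.col_apply, ← List.append_assoc, ← List.append_assoc]
    rfl
  rw [h3, map_mulVec]
  refine (Fintype.sum_of_injective (fun r : Bits R => Sum.elim (Sum.elim pk
        (Sum.elim (fun i => s (.inr (.inl (.inl i)))) (Sum.elim r c))) fun _ => false)
        ?_ _ _ ?_ ?_).symm
  · intro t t' h
    funext i
    exact congrFun h (.inl (.inr (.inr (.inl i))))
  · intro u hu
    by_contra h
    have h4 := right_ne_zero_of_mul h
    beta_reduce at h4
    rw [h2, extend_solverWires] at h4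
    obtain ⟨h6, h7⟩ := hstq _ h4
    refine hu ⟨fun i => u (.inl (.inr (.inr (.inl i)))), ?_⟩
    funext w
    rcases w with (w | w | w | w) | w | w
    · exact (h7 (.inl w)).symm
    · have := h6 (.inl w)
      simpa using this
    · rfl
    · exact (h7 (.inr (.inl w))).symm
    · exact (h6 (.inr w)).symm
    · exact (h7 (.inr (.inr w))).symm
  · intro r
    refine congrArg₂ _ rfl ?_
    beta_reduce
    rw [h2, extend_solverWires]
    refine Eq.symm ((congrArg₂ _ ?_ (if_pos ?_)).trans (mul_one _))
    · refine congrFun (congrArg _ ?_) _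
      funext w
      rcases w with w | (w | w) | w <;> rfl
    · constructor
      · rintro (i | i)
        · simp
        · rfl
      · rintro (i | i | i) <;> rfl

/-- Bit strings on all wires of the honest parties. -/
def honestBitsEquiv : Bits (HonestWires P Y R K A wO wS) ≃
    Bits Y × Bits A × (Bits (P ⊕ (Y ⊕ (R ⊕ K))) × Bits wS) × (Bits P × Bits wO) where
  toFun s := (fun i => s (.inr (.inl (.inl i))), fun i => s (.inr (.inl (.inr i))),
    (Sum.elim (fun i => s (.inr (.inr (.inr (.inl i)))))
      (Sum.elim (fun i => s (.inr (.inr (.inl (.inl (.inl i))))))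
        (Sum.elim (fun i => s (.inr (.inr (.inl (.inl (.inr i))))))
          fun i => s (.inr (.inr (.inr (.inr (.inl i))))))),
      fun i => s (.inr (.inr (.inr (.inr (.inr i)))))),
    (fun i => s (.inl i), fun i => s (.inr (.inr (.inl (.inr i))))))
  invFun x := Sum.elim x.2.2.2.1 (Sum.elim (Sum.elim x.1 x.2.1) (Sum.elim
    (Sum.elim (Sum.elim (fun i => x.2.2.1.1 (.inr (.inl i)))
      fun i => x.2.2.1.1 (.inr (.inr (.inl i)))) x.2.2.2.2)
    (Sum.elim (fun i => x.2.2.1.1 (.inl i)) (Sum.elim (fun i => x.2.2.1.1 (.inr (.inr (.inr i))))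
      x.2.2.1.2))))
  left_inv s := by
    funext w
    rcases w with a | (a | a) | ((a | a) | a) | a | a | a <;> rfl
  right_inv x := by
    obtain ⟨y, a, ⟨u1, u2⟩, u3, u4⟩ := x
    refine Prod.ext rfl (Prod.ext rfl (Prod.ext (Prod.ext ?_ rfl) rfl))
    funext w
    rcases w with w | w | w | w <;> rfl

/-- The probability that the answer of the honest parties is accepted, as a sum over the final
basis states. -/
theorem sum_honest (O : QCircuit P (Y ⊕ R)) (S : QCircuit (P ⊕ (Y ⊕ (R ⊕ K))) A) (pk : Bits P)
    (c : Bits K) (acc : Bits Y → Bits A → Prop) [∀ y a, Decidable (acc y a)] :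
    ∑ y, ∑ a, (if acc y a then
      ∑ u, ∑ w, ‖∑ s, S.kraus u a (Sum.elim pk (Sum.elim y (Sum.elim s c))) *
        O.kraus w (Sum.elim y s) pk‖ ^ 2 else 0) =
    ∑ s : Bits (HonestWires P Y R K A O.work S.work),
      if acc (fun i => s (.inr (.inl (.inl i)))) (fun i => s (.inr (.inl (.inr i)))) then
        ‖gateProd (honestGates O.gates S.gates c) s (Sum.elim pk fun _ => false)‖ ^ 2
      else 0 := by
  have hs : ∀ x, gateProd (honestGates O.gates S.gates c) (honestBitsEquiv.symm x)
      (Sum.elim pk fun _ => false) = ∑ s : Bits R,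
        S.kraus x.2.2.1 x.2.1 (Sum.elim pk (Sum.elim x.1 (Sum.elim s c))) *
        O.kraus x.2.2.2 (Sum.elim x.1 s) pk := by
    intro x
    rw [honestGates_apply]
    refine Finset.sum_congr rfl fun t _ => ?_
    refine congrArg₂ _ (congrFun (congrArg _ ?_) _) rfl
    funext w
    rcases w with (w | w | w | w) | w | w <;> rfl
  rw [← honestBitsEquiv.symm.sum_comp]
  simp only [hs]
  rw [Fintype.sum_prod_type]
  refine Finset.sum_congr rfl fun y _ => ?_
  rw [Fintype.sum_prod_type]
  refine Finset.sum_congr rfl fun a _ => ?_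
  refine Eq.trans ?_ (Fintype.sum_prod_type _).symm
  by_cases h : acc y a
  · rw [if_pos h]
    refine Finset.sum_congr rfl fun u _ => Finset.sum_congr rfl fun w _ => ?_
    exact (if_pos h).symm
  · rw [if_neg h]
    refine (Finset.sum_eq_zero fun u _ => Finset.sum_eq_zero fun w _ => ?_).symm
    exact if_neg h

theorem length_honestGates_le (gO : List (Gate (P ⊕ ((Y ⊕ R) ⊕ wO))))
    (gS : List (Gate ((P ⊕ (Y ⊕ (R ⊕ K))) ⊕ (A ⊕ wS)))) (c : Bits K) :
    (honestGates gO gS c).length ≤ Fintype.card P + Fintype.card K + gO.length +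
      Fintype.card Y + gS.length := by
  have h1 := length_copyLayer_le (Sum.inl : P → HonestWires P Y R K A wO wS) solverKeyWires
    (fun _ _ h => by cases h)
  have h2 := length_constLayer_le (solverChallengeWires (P := P) (Y := Y) (R := R) (A := A)
    (wO := wO) (wS := wS)) c
  have h3 := length_copyLayer_le (fun y : Y => (.inr (.inr (.inl (.inl (.inl y)))) :
    HonestWires P Y R K A wO wS)) obligationWires (fun _ _ h => by cases h)
  simp only [honestGates, List.length_append, List.length_map]
  omega

end Honest

/-! ### Vectors that do not depend on some of the wires -/

section Independence

set_option linter.unusedSectionVars false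

variable {ι κ μ : Type} [Fintype ι] [DecidableEq ι] [Fintype κ] [DecidableEq κ]
  [Fintype μ] [DecidableEq μ]

/-- `v` does not depend on the wires in the range of `f`. -/
def IndepOf {M : Type} (f : ι ↪ κ) (v : Bits κ → M) : Prop :=
  ∀ s t : Bits κ, (∀ w, w ∉ Set.range f → s w = t w) → v s = v t

theorem IndepOf.extend {M : Type} {f : ι ↪ κ} {v : Bits κ → M} (h : IndepOf f v) (u : Bits ι)
    (s : Bits κ) : v (Function.extend f u s) = v s :=
  h _ _ fun _ hw => Function.extend_apply' _ _ _ hw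

theorem IndepOf.mul {f : ι ↪ κ} {v w : Bits κ → ℂ} (hv : IndepOf f v) (hw : IndepOf f w) :
    IndepOf f (fun s => v s * w s) := fun s t h => by
  change v s * w s = v t * w t
  rw [hv s t h, hw s t h]

/-- On each slice that the gates act on, `χ` is a constant and can be pulled out. -/
theorem gateProd_map_mul (f : ι ↪ κ) (gs : List (Gate ι)) (v χ : Bits κ → ℂ)
    (hχ : IndepOf f χ) :
    gateProd (gs.map (Gate.map f)) *ᵥ (fun s => v s * χ s) =
      fun s => (gateProd (gs.map (Gate.map f)) *ᵥ v) s * χ s := by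
  funext s
  rw [map_mulVec, map_mulVec]
  simp only [hχ.extend, Matrix.mulVec, dotProduct, Finset.sum_mul, mul_assoc]

/-- Gates elsewhere mix only slices on which `v` is already independent of the wires `g`. -/
theorem IndepOf.gateProd_map {f : ι ↪ κ} {g : μ ↪ κ} (hd : ∀ i j, f i ≠ g j)
    (gs : List (Gate ι)) {v : Bits κ → ℂ} (hv : IndepOf g v) :
    IndepOf g (gateProd (gs.map (Gate.map f)) *ᵥ v) := by
  intro s t h
  rw [map_mulVec, map_mulVec]
  have h1 : s ∘ f = t ∘ f := funext fun i => h _ (by rintro ⟨j, hj⟩; exact hd i j hj.symm)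
  have h2 : ∀ u, v (Function.extend f u s) = v (Function.extend f u t) := by
    intro u
    refine hv _ _ fun w hw => ?_
    by_cases hf : w ∈ Set.range f
    · obtain ⟨i, rfl⟩ := hf
      rw [f.injective.extend_apply, f.injective.extend_apply]
    · rw [Function.extend_apply' _ _ _ hf, Function.extend_apply' _ _ _ hf]
      exact h w hw
  rw [h1]
  simp only [h2]

theorem map_trans_mulVec_comp (e : ι ↪ κ) (f : κ ↪ μ) (gs : List (Gate ι)) (Φ : Bits κ → ℂ)
    (s : Bits μ) :
    (gateProd (gs.map (Gate.map (e.trans f))) *ᵥ fun s => Φ (s ∘ f)) s =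
      (gateProd (gs.map (Gate.map e)) *ᵥ Φ) (s ∘ f) := by
  rw [← map_gate_map, map_mulVec]
  simp only [extend_comp_embedding]

/-- Writing functions of the other wires on fresh wires. -/
theorem gateProd_layer_fresh {J : Type} [Fintype J] [DecidableEq J] (g : J → List (RevGate κ))
    (tgt : J ↪ κ) (φ : J → Bits κ → Bool)
    (hact : ∀ j s, actList (g j) s = Function.update s (tgt j) (xor (s (tgt j)) (φ j s)))
    (hφ : ∀ j, IndepOf tgt (φ j)) (v : Bits κ → ℂ) (hv : IndepOf tgt v) :
    gateProd ((layer g).map Gate.rev) *ᵥ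
        (fun s => v s * if s ∘ tgt = (fun _ => false) then 1 else 0) =
      fun s => v s * if s ∘ tgt = (fun j => φ j s) then 1 else 0 := by
  have hφ' : ∀ i j s x, φ i (Function.update s (tgt j) x) = φ i s := fun i j s x =>
    hφ i _ _ fun w hw => Function.update_of_ne (fun e => hw ⟨j, e.symm⟩) _ _
  funext s
  obtain ⟨t, rfl⟩ := (actEquiv (layer g)).surjective s
  change (gateProd ((layer g).map Gate.rev) *ᵥ
        (fun s => v s * if s ∘ tgt = (fun _ => false) then 1 else 0)) (actList (layer g) t) =
    v (actList (layer g) t) * if actList (layer g) t ∘ tgt =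
      (fun j => φ j (actList (layer g) t)) then 1 else 0
  rw [gateProd_rev_mulVec, actList_layer_eq_extend g tgt φ hact hφ', hv.extend,
    extend_comp_embedding]
  have h1 : ∀ j u, φ j (Function.extend tgt u t) = φ j t := fun j u => (hφ j).extend u t
  simp only [h1]
  congr 2
  rw [eq_iff_iff, funext_iff, funext_iff]
  refine forall_congr' fun j => ?_
  cases φ j t <;> simp

end Independence

/-! ### Recording whether both answers are accepted -/

section Flag

set_option linter.unusedSectionVars false
set_option synthInstance.maxSize 100000
set_option synthInstance.maxHeartbeats 200000

variable {α P Y A w : Type}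

/-- The wires of a verification. -/
abbrev VerifyWires (P Y A w : Type) : Type := (P ⊕ (Y ⊕ A)) ⊕ (Unit ⊕ w)

/-- Some wires `α`, a public key, two verifications, and the conjunction of their verdicts. -/
abbrev ConjunctionWires (α P Y A w : Type) : Type :=
  α ⊕ (P ⊕ ((VerifyWires P Y A w ⊕ VerifyWires P Y A w) ⊕ Unit))

/-- The input wires of both verifications. -/
def verifyInputs : (P ⊕ (Y ⊕ A)) ⊕ (P ⊕ (Y ⊕ A)) ↪ ConjunctionWires α P Y A w where
  toFun
    | .inl a => .inr (.inr (.inl (.inl (.inl a))))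
    | .inr a => .inr (.inr (.inl (.inr (.inl a))))
  inj' := by rintro (a | a) (b | b) h <;> simp_all

/-- The wires that are copied to the inputs of the verifications. -/
def verifySource (y : Y → α) (aB aC : A → α) :
    (P ⊕ (Y ⊕ A)) ⊕ (P ⊕ (Y ⊕ A)) → ConjunctionWires α P Y A w
  | .inl (.inl a) => .inr (.inl a)
  | .inl (.inr (.inl a)) => .inl (y a)
  | .inl (.inr (.inr a)) => .inl (aB a)
  | .inr (.inl a) => .inr (.inl a)
  | .inr (.inr (.inl a)) => .inl (y a)
  | .inr (.inr (.inr a)) => .inl (aC a)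

theorem verifySource_ne (y : Y → α) (aB aC : A → α) (i j) :
    verifySource (P := P) (w := w) y aB aC i ≠ verifyInputs j := by
  rcases i with (i | i | i) | (i | i | i) <;> rcases j with j | j <;> intro h <;> cases h

/-- The first verification. -/
def firstVerify : VerifyWires P Y A w ↪ ConjunctionWires α P Y A w where
  toFun a := .inr (.inr (.inl (.inl a)))
  inj' := by intro a b h; simpa using h

/-- The second verification. -/
def secondVerify : VerifyWires P Y A w ↪ ConjunctionWires α P Y A w where
  toFun a := .inr (.inr (.inl (.inr a)))
  inj' := by intro a b h; simpa using h

variable [Fintype α] [DecidableEq α] [Fintype P] [DecidableEq P] [Fintype Y] [DecidableEq Y]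
  [Fintype A] [DecidableEq A] [Fintype w] [DecidableEq w]

/-- Compute the conjunction of the verdicts on the two answers. -/
def conjunctionGates (y : Y → α) (aB aC : A → α) (D : List (Gate (VerifyWires P Y A w))) :
    List (Gate (ConjunctionWires α P Y A w)) :=
  (copyLayer (verifySource y aB aC) verifyInputs (verifySource_ne y aB aC)).map Gate.rev ++
    D.map (Gate.map firstVerify) ++ D.map (Gate.map secondVerify) ++
    [RevGate.ccx (firstVerify (.inr (.inl ()))) (secondVerify (.inr (.inl ())))
      (.inr (.inr (.inr ()))) (fun h => by cases h) fun h => by cases h].map Gate.rev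

/-- Write the conjunction of the verdicts on the two answers into the flag `()`. -/
def flagGates (y : Y → α) (aB aC : A → α) (D : List (Gate (VerifyWires P Y A w))) :
    List (Gate (ConjunctionWires α P Y A w ⊕ Unit)) :=
  (conjunctionGates y aB aC D).map (Gate.map Function.Embedding.inl) ++
    [Gate.rev (.cx (.inl (.inr (.inr (.inr ())))) (.inr ()) (fun h => by cases h))] ++
    invGates ((conjunctionGates y aB aC D).map (Gate.map Function.Embedding.inl))

/-- The verification is run on two separate copies of its inputs; each verdict is certain, and hence
so is their conjunction. -/
theorem conjunctionGates_exact (y : Y → α) (aB aC : A → α)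
    (D : List (Gate (VerifyWires P Y A w))) (pk : Bits P) (acc : Bits Y → Bits A → Bool)
    (hD : ∀ y a s, gateProd D s (Sum.elim (Sum.elim pk (Sum.elim y a)) fun _ => false) ≠ 0 →
      s (.inr (.inl ())) = acc y a) (t : Bits α)
    (s : Bits (ConjunctionWires α P Y A w)) (hs : gateProd (conjunctionGates y aB aC D) s
      (Sum.elim t (Sum.elim pk fun _ => false)) ≠ 0) :
    s (.inr (.inr (.inr ()))) = (acc (t ∘ y) (t ∘ aB) && acc (t ∘ y) (t ∘ aC)) := by
  obtain ⟨m3, hs, h4⟩ := exists_of_gateProd_append_ne_zero hs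
  obtain ⟨m2, hs, h3⟩ := exists_of_gateProd_append_ne_zero hs
  obtain ⟨m1, h1, h2⟩ := exists_of_gateProd_append_ne_zero hs
  replace h1 := eq_actList_of_ne_zero h1
  replace h4 := eq_actList_of_ne_zero h4
  obtain ⟨h5, h6⟩ := gateProd_map_ne_zero h2
  obtain ⟨h7, h8⟩ := gateProd_map_ne_zero h3
  rw [actList_copyLayer] at h1
  have e1 : m1 ∘ firstVerify =
      Sum.elim (Sum.elim pk (Sum.elim (t ∘ y) (t ∘ aB))) fun _ => false := by
    funext x
    rw [Function.comp_apply, h1]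
    rcases x with x | x
    · refine (verifyInputs.injective.extend_apply _ _ (.inl x)).trans ?_
      rcases x with x | x | x <;> exact Bool.false_xor _
    · exact Function.extend_apply' _ _ _ (by rintro ⟨x | x, hx⟩ <;> cases hx)
  have e2 : m2 ∘ secondVerify =
      Sum.elim (Sum.elim pk (Sum.elim (t ∘ y) (t ∘ aC))) fun _ => false := by
    funext x
    rw [Function.comp_apply, h5 _ (by rintro ⟨x, hx⟩; cases hx), h1]
    rcases x with x | x
    · refine (verifyInputs.injective.extend_apply _ _ (.inr x)).trans ?_
      rcases x with x | x | x <;> exact Bool.false_xor _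
    · exact Function.extend_apply' _ _ _ (by rintro ⟨x | x, hx⟩ <;> cases hx)
  rw [e1] at h6
  rw [e2] at h8
  have e3 := hD _ _ _ h6
  have e4 := hD _ _ _ h8
  have e5 : m3 (firstVerify (.inr (.inl ()))) = acc (t ∘ y) (t ∘ aB) :=
    (h7 _ (by rintro ⟨x, hx⟩; cases hx)).trans e3
  have e6 : m3 (.inr (.inr (.inr ()))) = false := by
    rw [h7 _ (by rintro ⟨x, hx⟩; cases hx), h5 _ (by rintro ⟨x, hx⟩; cases hx), h1]
    exact Function.extend_apply' _ _ _ (by rintro ⟨x | x, hx⟩ <;> cases hx)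
  rw [h4, actList_cons, actList_nil, RevGate.act, Function.update_self, e6, e5, Bool.false_xor]
  exact congrArg _ e4

/-- Compute–uncompute with the certain verdict: all verification wires return to their initial state
and only the flag remembers anything. Without this clean-up the later undoing of the round would
fail. -/
theorem flagGates_single (y : Y → α) (aB aC : A → α)
    (D : List (Gate (VerifyWires P Y A w))) (pk : Bits P) (acc : Bits Y → Bits A → Bool)
    (hD : ∀ y a s, gateProd D s (Sum.elim (Sum.elim pk (Sum.elim y a)) fun _ => false) ≠ 0 →
      s (.inr (.inl ())) = acc y a) (t : Bits α) :
    gateProd (flagGates y aB aC D) *ᵥ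
      Pi.single (Sum.elim (Sum.elim t (Sum.elim pk fun _ => false)) fun _ => false) 1 =
      Pi.single (Sum.elim (Sum.elim t (Sum.elim pk fun _ => false))
        fun _ => acc (t ∘ y) (t ∘ aB) && acc (t ∘ y) (t ∘ aC)) 1 := by
  refine (gateProd_compute_uncompute _ _ _ _ ?_ _ _ fun s hs =>
    conjunctionGates_exact y aB aC D pk acc hD t (s ∘ Function.Embedding.inl)
      (gateProd_map_ne_zero hs).2).trans ?_
  · have := gateProd_map_commute (Function.Embedding.inr :
      Unit ↪ ConjunctionWires α P Y A w ⊕ Unit) Function.Embedding.inl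
      (fun i j h => by cases h) [Gate.rev (.x ())] (conjunctionGates y aB aC D)
    rw [List.map_singleton, gateProd_singleton] at this
    exact this
  · congr 1
    funext x
    rcases x with x | x
    · exact Function.update_of_ne (fun h => by cases h) _ _
    · exact (Function.update_self _ _ _).trans (Bool.false_xor _)

/-- Linear extension from basis states: the state splits into its accepted part with flag 1 and its
rejected part with flag 0, and is not disturbed otherwise. -/
theorem flagGates_mulVec (y : Y → α) (aB aC : A → α)
    (D : List (Gate (VerifyWires P Y A w))) (pk : Bits P) (acc : Bits Y → Bits A → Bool)
    (hD : ∀ y a s, gateProd D s (Sum.elim (Sum.elim pk (Sum.elim y a)) fun _ => false) ≠ 0 →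
      s (.inr (.inl ())) = acc y a) (φ : Bits α → ℂ) :
    gateProd (flagGates y aB aC D) *ᵥ (fun s => φ (fun i => s (.inl (.inl i))) *
      if (fun i => s (.inl (.inr i))) = (Sum.elim pk fun _ => false : Bits _) ∧ s (.inr ()) = false
      then 1 else 0) = fun s => (if s (.inr ()) = (acc (fun i => s (.inl (.inl (y i))))
        (fun i => s (.inl (.inl (aB i)))) && acc (fun i => s (.inl (.inl (y i))))
        (fun i => s (.inl (.inl (aC i))))) then φ (fun i => s (.inl (.inl i))) else 0) *
      if (fun i => s (.inl (.inr i))) = (Sum.elim pk fun _ => false : Bits _) then 1 else 0 := by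
  -- The same expansion in basis states describes the vector before the gates, with `F` constantly
  -- `false`, and after them, with `F` the joint verdict.
  have key : ∀ (F : Bits α → Bool), (∑ t, φ t • (Pi.single (Sum.elim (Sum.elim t
      (Sum.elim pk fun _ => false)) fun _ => F t) 1 :
        Bits (ConjunctionWires α P Y A w ⊕ Unit) → ℂ)) = fun s =>
      φ (fun i => s (.inl (.inl i))) *
      if (fun i => s (.inl (.inr i))) = (Sum.elim pk fun _ => false : Bits _) ∧
        s (.inr ()) = F (fun i => s (.inl (.inl i))) then 1 else 0 := by
    intro F
    funext s
    rw [Finset.sum_apply, Finset.sum_eq_single (fun i => s (.inl (.inl i)))]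
    · rw [Pi.smul_apply, smul_eq_mul, Pi.single_apply]
      congr 2
      rw [eq_iff_iff]
      constructor
      · intro h
        exact ⟨funext fun i => congrFun h (.inl (.inr i)), congrFun h (.inr ())⟩
      · rintro ⟨h1, h2⟩
        funext x
        rcases x with (x | x) | x
        · rfl
        · exact congrFun h1 x
        · exact h2
    · intro t _ ht
      rw [Pi.smul_apply, smul_eq_mul, Pi.single_apply, if_neg, mul_zero]
      intro h
      exact ht (funext fun i => (congrFun h (.inl (.inl i))).symm)
    · simp
  rw [← key fun _ => false, Matrix.mulVec_sum]
  simp only [Matrix.mulVec_smul, flagGates_single y aB aC D pk acc hD]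
  refine (key _).trans (funext fun s => ?_)
  by_cases h1 : (fun i => s (.inl (.inr i))) = (Sum.elim pk fun _ => false : Bits _)
  · by_cases h2 : s (.inr ()) = (acc (fun i => s (.inl (.inl (y i))))
        (fun i => s (.inl (.inl (aB i)))) && acc (fun i => s (.inl (.inl (y i))))
        (fun i => s (.inl (.inl (aC i)))))
    · rw [if_pos h2, if_pos h1]
      exact congrArg₂ _ rfl (if_pos ⟨h1, h2⟩)
    · rw [if_neg h2, zero_mul]
      exact (congrArg₂ _ rfl (if_neg fun h => h2 h.2)).trans (mul_zero _)
  · rw [if_neg h1, mul_zero]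
    exact (congrArg₂ _ rfl (if_neg fun h => h1 h.1)).trans (mul_zero _)

theorem length_flagGates_le (y : Y → α) (aB aC : A → α) (D : List (Gate (VerifyWires P Y A w))) :
    (flagGates y aB aC D).length ≤ 8 * (2 * (Fintype.card P + (Fintype.card Y + Fintype.card A)) +
      2 * D.length + 1) + 1 := by
  have h1 := length_copyLayer_le (verifySource (P := P) (w := w) y aB aC) verifyInputs
    (verifySource_ne y aB aC)
  simp only [Fintype.card_sum] at h1
  have h2 := length_invGates_le ((conjunctionGates y aB aC D).map
    (Gate.map (Function.Embedding.inl : _ ↪ _ ⊕ Unit)))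
  have h3 : (conjunctionGates y aB aC D).length ≤
      2 * (Fintype.card P + (Fintype.card Y + Fintype.card A)) + 2 * D.length + 1 := by
    simp only [conjunctionGates, List.length_append, List.length_map, List.length_singleton]
    omega
  simp only [List.length_map] at h2
  simp only [flagGates, List.length_append, List.length_map, List.length_singleton]
  omega

end Flag

/-! ### Selecting between two answers -/

section Mux

set_option linter.unusedSectionVars false

variable {ι κ J : Type} [Fintype J] [DecidableEq J]

theorem layer_map (f : ι ↪ κ) (g : J → List (RevGate ι)) :
    (layer g).map (RevGate.map f) = layer fun j => (g j).map (RevGate.map f) := by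
  rw [layer, layer, List.map_flatMap]

theorem constLayer_map (f : ι ↪ κ) (tgt : J ↪ ι) (c : Bits J) :
    (constLayer tgt c).map (RevGate.map f) = constLayer (tgt.trans f) c := by
  rw [constLayer, constLayer, layer_map]
  congr 1
  funext j
  split_ifs <;> rfl

/-- Adds to `tgt` the bits `a` if the bit `f` is set, and the bits `b` otherwise. -/
def muxLayer (f : ι) (a b : J → ι) (tgt : J ↪ ι) (hf : ∀ j, f ≠ tgt j)
    (ha : ∀ i j, a i ≠ tgt j) (hb : ∀ i j, b i ≠ tgt j) : List (RevGate ι) :=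
  layer fun j => [.ccx f (a j) (tgt j) (hf j) (ha j j), .cx (b j) (tgt j) (hb j j),
    .ccx f (b j) (tgt j) (hf j) (hb j j)]

theorem muxLayer_map (e : ι ↪ κ) (f : ι) (a b : J → ι) (tgt : J ↪ ι) (hf : ∀ j, f ≠ tgt j)
    (ha : ∀ i j, a i ≠ tgt j) (hb : ∀ i j, b i ≠ tgt j) :
    (muxLayer f a b tgt hf ha hb).map (RevGate.map e) =
      muxLayer (e f) (e ∘ a) (e ∘ b) (tgt.trans e) (fun j h => hf j (e.injective h))
        (fun i j h => ha i j (e.injective h)) fun i j h => hb i j (e.injective h) := by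
  rw [muxLayer, layer_map]
  rfl

theorem length_muxLayer_le (f : ι) (a b : J → ι) (tgt : J ↪ ι) (hf : ∀ j, f ≠ tgt j)
    (ha : ∀ i j, a i ≠ tgt j) (hb : ∀ i j, b i ≠ tgt j) :
    (muxLayer f a b tgt hf ha hb).length ≤ Fintype.card J * 3 :=
  length_layer_le _ 3 fun _ => le_rfl

variable [Fintype ι] [DecidableEq ι]

theorem IndepOf.apply {f : J ↪ ι} {w : ι} (h : ∀ j, w ≠ f j) : IndepOf f fun s : Bits ι => s w :=
  fun s t hst => hst w (by rintro ⟨j, hj⟩; exact h j hj.symm)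

/-- Modulo 2 the three gates add f·a + b + f·b to the target, which is a if f = 1 and b if f = 0. -/
theorem gateProd_muxLayer (f : ι) (a b : J → ι) (tgt : J ↪ ι) (hf : ∀ j, f ≠ tgt j)
    (ha : ∀ i j, a i ≠ tgt j) (hb : ∀ i j, b i ≠ tgt j) (v : Bits ι → ℂ) (hv : IndepOf tgt v) :
    gateProd ((muxLayer f a b tgt hf ha hb).map Gate.rev) *ᵥ
        (fun s => v s * if s ∘ tgt = (fun _ => false) then 1 else 0) =
      fun s => v s * if s ∘ tgt = (fun j => if s f then s (a j) else s (b j)) then 1 else 0 := by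
  refine gateProd_layer_fresh _ tgt (fun j s => if s f then s (a j) else s (b j)) ?_ ?_ v hv
  · intro j s
    simp only [actList_cons, actList_nil, RevGate.act, Function.update_idem,
      Function.update_self, Function.update_of_ne (hf j),
      Function.update_of_ne (hb j j)]
    congr 1
    cases s (tgt j) <;> cases s f <;> cases s (a j) <;> cases s (b j) <;> rfl
  · intro j s t h
    have e1 := IndepOf.apply hf s t h
    have e2 := IndepOf.apply (ha j) s t h
    have e3 := IndepOf.apply (hb j) s t h
    beta_reduce at e1 e2 e3 ⊢
    rw [e1, e2, e3]

theorem gateProd_copyLayer (src : J → ι) (tgt : J ↪ ι) (h : ∀ i j, src i ≠ tgt j)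
    (v : Bits ι → ℂ) (hv : IndepOf tgt v) :
    gateProd ((copyLayer src tgt h).map Gate.rev) *ᵥ
        (fun s => v s * if s ∘ tgt = (fun _ => false) then 1 else 0) =
      fun s => v s * if s ∘ tgt = (fun j => s (src j)) then 1 else 0 :=
  gateProd_layer_fresh _ tgt (fun j s => s (src j)) (fun _ _ => rfl)
    (fun j => IndepOf.apply (h j)) v hv

end Mux

/-! ### One local party of the reduction -/

section LocalParty

set_option linter.unusedSectionVars false
set_option synthInstance.maxSize 100000
set_option synthInstance.maxHeartbeats 200000

variable {m : ℕ} {B A wB κ : Type}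

/-- The wires of a local party of a player against the repeated puzzle. -/
abbrev PartyWires (m : ℕ) (B A wB : Type) : Type := (B ⊕ Fin m) ⊕ ((Fin m × A) ⊕ wB)

/-- The wires of a local party of the reduction: a flag, the wires of the local party of the
player, the answer of the honest solver, the challenge, and the answer. -/
abbrev LocalWires (m : ℕ) (B A wB : Type) : Type :=
  ((Unit ⊕ (PartyWires m B A wB ⊕ A)) ⊕ Fin 1) ⊕ (A ⊕ Empty)

/-- The challenge wires of the player. -/
def partyChallenge : Fin m ↪ PartyWires m B A wB where
  toFun j := .inl (.inr j)
  inj' := by intro a b h; simpa using h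

/-- The wires of the player. -/
def localParty : PartyWires m B A wB ↪ LocalWires m B A wB where
  toFun a := .inl (.inl (.inr (.inl a)))
  inj' := by intro a b h; simpa using h

/-- The answer wires. -/
def localAnswer : A ↪ LocalWires m B A wB where
  toFun a := .inr (.inl a)
  inj' := by intro a b h; simpa using h

variable [Fintype B] [DecidableEq B] [Fintype A] [DecidableEq A] [Fintype wB] [DecidableEq wB]
  [Fintype κ] [DecidableEq κ]

/-- Set the challenge to `b` and run the local party of the player. -/
def partyGates (b : Bits (Fin m)) (gB : List (Gate (PartyWires m B A wB))) :
    List (Gate (PartyWires m B A wB)) :=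
  (constLayer partyChallenge b).map Gate.rev ++ gB

/-- Set the challenge of the player to `b₀` or `b₁`, depending on the challenge. -/
def selectChallenge (b₀ b₁ : Bits (Fin m)) : List (RevGate (LocalWires m B A wB)) :=
  layer fun j => (if b₀ j = true then [.x (localParty (partyChallenge j))] else []) ++
    if b₀ j = b₁ j then [] else
      [.cx (.inl (.inr 0)) (localParty (partyChallenge j)) (fun h => by cases h)]

/-- A local party of the reduction: run the player on `b₀` or `b₁`, then answer the `i`-th
answer of the player if the flag is set, and the answer of the honest solver otherwise. -/
def localGates (i : Fin m) (b₀ b₁ : Bits (Fin m)) (gB : List (Gate (PartyWires m B A wB))) :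
    List (Gate (LocalWires m B A wB)) :=
  (selectChallenge b₀ b₁).map Gate.rev ++ gB.map (Gate.map localParty) ++
    (muxLayer (.inl (.inl (.inl ()))) (fun j => localParty (.inr (.inl (i, j))))
      (fun j => .inl (.inl (.inr (.inr j)))) localAnswer (fun _ h => by cases h)
      (fun _ _ h => by cases h) (fun _ _ h => by cases h)).map Gate.rev

/-- Bit `j` of the selected challenge is b₀ + c·(b₀ + b₁) modulo 2 in the challenge bit c, so a
controlled gate is needed only where the two strings differ. -/
theorem actList_selectChallenge (b₀ b₁ : Bits (Fin m)) (s : Bits (LocalWires m B A wB)) :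
    actList (selectChallenge b₀ b₁) s =
      actList (constLayer (partyChallenge.trans localParty)
        (if s (.inl (.inr 0)) then b₁ else b₀)) s := by
  rw [actList_constLayer]
  refine (actList_layer_eq_extend _ (partyChallenge.trans localParty)
    (fun j s => xor (b₀ j) (xor (b₀ j) (b₁ j) && s (.inl (.inr 0)))) ?_ ?_ s).trans ?_
  · intro j s
    have hne : (.inl (.inr 0) : LocalWires m B A wB) ≠ (partyChallenge.trans localParty) j :=
      fun h => by cases h
    change actList _ s = Function.update s ((partyChallenge.trans localParty) j) _
    change actList ((if b₀ j = true then [RevGate.x ((partyChallenge.trans localParty) j)] else []) ++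
      if b₀ j = b₁ j then [] else
        [RevGate.cx (.inl (.inr 0)) ((partyChallenge.trans localParty) j) hne]) s = _
    generalize (partyChallenge.trans (localParty (m := m) (B := B) (A := A) (wB := wB))) j = x
      at hne ⊢
    cases h0 : b₀ j <;> cases h1 : b₁ j <;>
      simp [actList_cons, RevGate.act, Function.update_of_ne hne]
  · intro i j s x
    rw [Function.update_of_ne]
    intro h
    cases h
  · congr 1
    funext j
    congr 1
    cases s (.inl (.inr 0)) <;> simp

/-- The challenge wire equals the classical bit `c` on the whole support, so selecting a challenge
amounts to hardwiring it. The answer wires are fresh and are only written, as a function of the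
other wires. -/
theorem gateProd_localGates (i : Fin m) (b₀ b₁ : Bits (Fin m))
    (gB : List (Gate (PartyWires m B A wB))) (f : LocalWires m B A wB ↪ κ) (v : Bits κ → ℂ)
    (hv : IndepOf (localAnswer.trans f) v) (c : Bool) :
    gateProd ((localGates i b₀ b₁ gB).map (Gate.map f)) *ᵥ
      (fun s => (v s * if s (f (.inl (.inr 0))) = c then 1 else 0) *
        if s ∘ localAnswer.trans f = (fun _ => false) then 1 else 0) =
    fun s => ((gateProd ((partyGates (if c then b₁ else b₀) gB).map
        (Gate.map (localParty.trans f))) *ᵥ v) s * if s (f (.inl (.inr 0))) = c then 1 else 0) *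
      if s ∘ localAnswer.trans f = (fun j => if s (f (.inl (.inl (.inl ()))))
        then s (f (localParty (.inr (.inl (i, j))))) else s (f (.inl (.inl (.inr (.inr j))))))
      then 1 else 0 := by
  set χ : Bits κ → ℂ := fun s => if s (f (.inl (.inr 0))) = c then 1 else 0 with hχ
  set ω : Bits κ → ℂ := fun s => if s ∘ localAnswer.trans f = (fun _ => false) then 1 else 0
    with hω
  have hχp : IndepOf (localParty.trans f) χ := by
    intro s t h
    simp only [hχ]
    rw [h _ (by rintro ⟨x, hx⟩; cases f.injective hx)]
  have hχa : IndepOf (localAnswer.trans f) χ := by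
    intro s t h
    simp only [hχ]
    rw [h _ (by rintro ⟨x, hx⟩; cases f.injective hx)]
  have hωp : IndepOf (localParty.trans f) ω := by
    intro s t h
    have : s ∘ localAnswer.trans f = t ∘ localAnswer.trans f :=
      funext fun j => h _ (by rintro ⟨x, hx⟩; cases f.injective hx)
    simp only [hω, this]
  have h1 : gateProd (((selectChallenge b₀ b₁).map Gate.rev).map (Gate.map f)) *ᵥ
      (fun s => (v s * χ s) * ω s) =
      gateProd (((constLayer partyChallenge (if c then b₁ else b₀)).map Gate.rev).map
        (Gate.map (localParty.trans f))) *ᵥ (fun s => (v s * χ s) * ω s) := by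
    rw [map_rev_map, map_rev_map]
    -- The two lists of gates differ in general, but agree on strings whose challenge wire is `c`.
    refine gateProd_rev_congr _ _ _ fun t ht => ?_
    have hc : t (f (.inl (.inr 0))) = c := by
      by_contra h
      apply ht
      simp only [hχ]
      rw [if_neg h, mul_zero, zero_mul]
    have e : (constLayer partyChallenge (if c then b₁ else b₀)).map
        (RevGate.map (localParty.trans f)) = ((constLayer (partyChallenge.trans
          (localParty (A := A) (B := B) (wB := wB))) (if c then b₁ else b₀))).map
            (RevGate.map f) := by
      rw [constLayer_map, constLayer_map]
      rfl
    rw [e, actList_map, actList_map, actList_selectChallenge]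
    simp only [Function.comp_apply, hc]
  have h2 : gateProd ((localGates i b₀ b₁ gB).map (Gate.map f)) *ᵥ
      (fun s => (v s * χ s) * ω s) =
      gateProd ((muxLayer (f (.inl (.inl (.inl ()))))
        (f ∘ fun j => localParty (.inr (.inl (i, j))))
        (f ∘ fun j => .inl (.inl (.inr (.inr j)))) (localAnswer.trans f)
        (fun _ h => by cases f.injective h) (fun _ _ h => by cases f.injective h)
        (fun _ _ h => by cases f.injective h)).map Gate.rev) *ᵥ
      (gateProd ((partyGates (if c then b₁ else b₀) gB).map (Gate.map (localParty.trans f))) *ᵥ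
        fun s => (v s * χ s) * ω s) := by
    rw [localGates, List.map_append, List.map_append, gateProd_append, gateProd_append,
      ← Matrix.mulVec_mulVec, ← Matrix.mulVec_mulVec, h1, map_rev_map, muxLayer_map, partyGates,
      List.map_append, gateProd_append, ← Matrix.mulVec_mulVec, map_gate_map]
  rw [h2, gateProd_map_mul _ _ _ _ hωp, gateProd_map_mul _ _ _ _ hχp]
  refine gateProd_muxLayer _ _ _ _ _ _ _ _ ?_
  exact (hv.gateProd_map (fun i j h => by cases f.injective h) _).mul hχa

theorem length_localGates_le (i : Fin m) (b₀ b₁ : Bits (Fin m))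
    (gB : List (Gate (PartyWires m B A wB))) :
    (localGates i b₀ b₁ gB).length ≤ m * 2 + gB.length + Fintype.card A * 3 := by
  have h1 : (selectChallenge (B := B) (A := A) (wB := wB) b₀ b₁).length ≤
      Fintype.card (Fin m) * 2 := by
    refine length_layer_le _ 2 fun j => ?_
    split_ifs <;> simp
  have h2 := length_muxLayer_le (J := A) (Sum.inl (Sum.inl (Sum.inl ())) : LocalWires m B A wB)
    (fun j => localParty (.inr (.inl (i, j)))) (fun j => .inl (.inl (.inr (.inr j)))) localAnswer
    (fun _ h => by cases h) (fun _ _ h => by cases h) (fun _ _ h => by cases h)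
  rw [Fintype.card_fin] at h1
  simp only [localGates, List.length_append, List.length_map]
  omega

end LocalParty

/-! ### The reduction to the 1-of-2 puzzle -/

section Reduction

set_option linter.unusedSectionVars false
set_option synthInstance.maxSize 100000
set_option synthInstance.maxHeartbeats 200000

variable {m : ℕ} {P Y B C A wA wB wC w wH : Type}

/-- The wires of a player against the repeated puzzle. -/
abbrev AdversaryWires (m : ℕ) (P Y B C A wA wB wC : Type) : Type :=
  PlayWires (Fin m × P) (Fin m × Y) B C (Fin m) (Fin m × A) wA wB wC

/-- The wires of the player, the verifications and the flag. -/
abbrev FlaggedWires (m : ℕ) (P Y B C A wA wB wC w : Type) : Type :=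
  ConjunctionWires (AdversaryWires m P Y B C A wA wB wC) P (Fin m × Y) (Fin m × A) w ⊕ Unit

/-- The wires of the first stage of the reduction: the player with its verification, the honest
parties, and the outputs: obligation, flag and honest answer. -/
abbrev LeaderWires (m : ℕ) (P Y B C A wA wB wC w wH : Type) : Type :=
  FlaggedWires m P Y B C A wA wB wC w ⊕ ((P ⊕ ((Y ⊕ A) ⊕ wH)) ⊕ (Y ⊕ (Unit ⊕ A)))

/-- All wires of the reduction. -/
abbrev ReductionWires (m : ℕ) (P Y B C A wA wB wC w wH : Type) : Type :=
  LeaderWires m P Y B C A wA wB wC w wH ⊕ ((Fin 1 ⊕ (A ⊕ Empty)) ⊕ (Fin 1 ⊕ (A ⊕ Empty)))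

/-- The wires of the player. -/
def adversary : AdversaryWires m P Y B C A wA wB wC ↪ FlaggedWires m P Y B C A wA wB wC w :=
  Function.Embedding.inl.trans Function.Embedding.inl

/-- The public keys of the player. -/
def adversaryKeys : Fin m × P ↪ LeaderWires m P Y B C A wA wB wC w wH where
  toFun p := .inl (.inl (.inl (.inl (.inl p))))
  inj' := by intro a b h; simpa using h

/-- The wires that receive the public key. -/
def keyTargets (i : Fin m) : P ⊕ P ↪ LeaderWires m P Y B C A wA wB wC w wH where
  toFun
    | .inl p => .inl (.inl (.inl (.inl (.inl (i, p)))))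
    | .inr p => .inr (.inl (.inl p))
  inj' := by rintro (a | a) (b | b) h <;> simp_all

/-- The outputs flag and honest answer. -/
def flagOutputs : Unit ⊕ A ↪ LeaderWires m P Y B C A wA wB wC w wH where
  toFun a := .inr (.inr (.inr a))
  inj' := by intro a b h; simpa using h

/-- The output obligation. -/
def obligationOutput : Y ↪ LeaderWires m P Y B C A wA wB wC w wH where
  toFun a := .inr (.inr (.inl a))
  inj' := by intro a b h; simpa using h

/-- The source of the outputs flag and honest answer. -/
def flagSource : Unit ⊕ A → LeaderWires m P Y B C A wA wB wC w wH
  | .inl u => .inl (.inr u)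
  | .inr a => .inr (.inl (.inr (.inl (.inr a))))

/-- The wires of the first local party. -/
def firstParty : LocalWires m B A wB ↪ ReductionWires m P Y B C A wA wB wC w wH where
  toFun
    | .inl (.inl (.inl a)) => .inl (.inl (.inr a))
    | .inl (.inl (.inr (.inl a))) => .inl (.inl (.inl (.inl (bobWires a))))
    | .inl (.inl (.inr (.inr a))) => .inl (.inr (.inl (.inr (.inl (.inr a)))))
    | .inl (.inr a) => .inr (.inl (.inl a))
    | .inr a => .inr (.inl (.inr a))
  inj' := by
    rintro (((a | a | a) | a) | a) (((b | b | b) | b) | b) h <;> simp_all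

/-- The wires of the second local party. -/
def secondParty : LocalWires m C A wC ↪ ReductionWires m P Y B C A wA wB wC w wH where
  toFun
    | .inl (.inl (.inl a)) => .inl (.inr (.inr (.inr (.inl a))))
    | .inl (.inl (.inr (.inl a))) => .inl (.inl (.inl (.inl (charlieWires a))))
    | .inl (.inl (.inr (.inr a))) => .inl (.inr (.inr (.inr (.inr a))))
    | .inl (.inr a) => .inr (.inr (.inl a))
    | .inr a => .inr (.inr (.inr a))
  inj' := by
    rintro (((a | a | a) | a) | a) (((b | b | b) | b) | b) h <;> simp_all

variable [Fintype P] [DecidableEq P] [Fintype Y] [DecidableEq Y] [Fintype B] [DecidableEq B]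
  [Fintype C] [DecidableEq C] [Fintype A] [DecidableEq A] [Fintype wA] [DecidableEq wA]
  [Fintype wB] [DecidableEq wB] [Fintype wC] [DecidableEq wC] [Fintype w] [DecidableEq w]
  [Fintype wH] [DecidableEq wH]

/-- Both local parties of the player on the challenge `b`. -/
def roundGates (b : Bits (Fin m)) (gB : List (Gate (PartyWires m B A wB)))
    (gC : List (Gate (PartyWires m C A wC))) : List (Gate (AdversaryWires m P Y B C A wA wB wC)) :=
  (partyGates b gB).map (Gate.map bobWires) ++ (partyGates b gC).map (Gate.map charlieWires)

/-- Run the player on the challenge `b`, record in the flag whether both answers are accepted,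
and undo the local parties. -/
def recordGates (gA : List (Gate ((Fin m × P) ⊕ (((Fin m × Y) ⊕ (B ⊕ C)) ⊕ wA))))
    (b : Bits (Fin m)) (gB : List (Gate (PartyWires m B A wB)))
    (gC : List (Gate (PartyWires m C A wC)))
    (D : List (Gate (VerifyWires P (Fin m × Y) (Fin m × A) w))) :
    List (Gate (FlaggedWires m P Y B C A wA wB wC w)) :=
  (gA.map (Gate.map Function.Embedding.inl) ++ roundGates b gB gC).map (Gate.map adversary) ++
    flagGates (fun y => .inl (.inr (.inl (.inl y)))) (fun a => .inr (.inl (.inr (.inl a))))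
      (fun a => .inr (.inr (.inr (.inl a)))) D ++
    (invGates (roundGates b gB gC)).map (Gate.map adversary)

/-- For gates on the player's wires the flag is a label: the vectors `Θ false` and `Θ true` evolve
separately, and the verification wires are a spectator factor. -/
theorem adversary_mulVec (gs : List (Gate (AdversaryWires m P Y B C A wA wB wC)))
    (Θ : Bool → Bits (AdversaryWires m P Y B C A wA wB wC) → ℂ)
    (p : Bits (P ⊕ ((VerifyWires P (Fin m × Y) (Fin m × A) w ⊕
      VerifyWires P (Fin m × Y) (Fin m × A) w) ⊕ Unit)) → ℂ) :
    gateProd (gs.map (Gate.map adversary)) *ᵥ (fun s : Bits (FlaggedWires m P Y B C A wA wB wC w) =>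
      Θ (s (.inr ())) (fun i => s (.inl (.inl i))) * p (fun i => s (.inl (.inr i)))) =
    fun s => (gateProd gs *ᵥ Θ (s (.inr ()))) (fun i => s (.inl (.inl i))) *
      p (fun i => s (.inl (.inr i))) := by
  funext s
  rw [map_mulVec]
  have h1 : ∀ u, Function.extend (adversary (w := w)) u s (.inr ()) = s (.inr ()) :=
    fun u => Function.extend_apply' _ _ _ (by rintro ⟨x, hx⟩; cases hx)
  have h2 : ∀ u, (fun i => Function.extend (adversary (w := w)) u s (.inl (.inr i))) =
      fun i => s (.inl (.inr i)) :=
    fun u => funext fun i => Function.extend_apply' _ _ _ (by rintro ⟨x, hx⟩; cases hx)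
  have h3 : ∀ u, (fun i => Function.extend (adversary (w := w)) u s (.inl (.inl i))) = u :=
    fun u => funext fun i => adversary.injective.extend_apply u s i
  simp only [h1, h2, h3, Matrix.mulVec, dotProduct, Finset.sum_mul, mul_assoc]
  rfl

/-- Whether both answers are accepted in a final state of the player. -/
def bothAccept (acc : Bits (Fin m × Y) → Bits (Fin m × A) → Bool)
    (s : Bits (AdversaryWires m P Y B C A wA wB wC)) : Bool :=
  acc (fun y => s (.inl (.inr (.inl (.inl y))))) (fun a => s (.inr (.inl (.inr (.inl a))))) &&
    acc (fun y => s (.inl (.inr (.inl (.inl y))))) (fun a => s (.inr (.inr (.inr (.inl a)))))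

/-- In the notation Π = U†PU, the state becomes Πψ with flag 1 plus (1 - Π)ψ with flag 0: a coherent
measurement of joint acceptance after which the round is undone. The gates of `𝒜` are not undone. -/
theorem recordGates_mulVec (gA : List (Gate ((Fin m × P) ⊕ (((Fin m × Y) ⊕ (B ⊕ C)) ⊕ wA))))
    (b : Bits (Fin m)) (gB : List (Gate (PartyWires m B A wB)))
    (gC : List (Gate (PartyWires m C A wC)))
    (D : List (Gate (VerifyWires P (Fin m × Y) (Fin m × A) w)))
    (pk : Bits P) (acc : Bits (Fin m × Y) → Bits (Fin m × A) → Bool)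
    (hD : ∀ y a s, gateProd D s (Sum.elim (Sum.elim pk (Sum.elim y a)) fun _ => false) ≠ 0 →
      s (.inr (.inl ())) = acc y a) (t : Bits (AdversaryWires m P Y B C A wA wB wC)) :
    gateProd (recordGates gA b gB gC D) *ᵥ
      Pi.single (Sum.elim (Sum.elim t (Sum.elim pk fun _ => false)) fun _ => false) 1 =
    fun s => (gateProd (invGates (roundGates b gB gC)) *ᵥ fun u =>
        if s (.inr ()) = bothAccept acc u then (gateProd (gA.map (Gate.map Function.Embedding.inl) ++
          roundGates b gB gC) *ᵥ Pi.single t 1) u else 0) (fun i => s (.inl (.inl i))) *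
      if (fun i => s (.inl (.inr i))) = (Sum.elim pk fun _ => false : Bits _) then 1 else 0 := by
  have h0 : (Pi.single (Sum.elim (Sum.elim t (Sum.elim pk fun _ => false)) fun _ => false) 1 :
      Bits (FlaggedWires m P Y B C A wA wB wC w) → ℂ) = fun s =>
      (fun f u => if f = false then (Pi.single t 1 : Bits _ → ℂ) u else 0) (s (.inr ()))
        (fun i => s (.inl (.inl i))) * (fun q => if q = (Sum.elim pk fun _ => false : Bits _)
          then (1 : ℂ) else 0) (fun i => s (.inl (.inr i))) := by
    funext s
    rw [Pi.single_apply]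
    have : s = Sum.elim (Sum.elim t (Sum.elim pk fun _ => false)) (fun _ => false) ↔
        (s (.inr ()) = false ∧ (fun i => s (.inl (.inl i))) = t) ∧
          (fun i => s (.inl (.inr i))) = (Sum.elim pk fun _ => false : Bits _) := by
      constructor
      · rintro rfl
        exact ⟨⟨rfl, rfl⟩, rfl⟩
      · rintro ⟨⟨h1, h2⟩, h3⟩
        funext x
        rcases x with (x | x) | x
        · exact congrFun h2 x
        · exact congrFun h3 x
        · exact h1
    by_cases h1 : s (.inr ()) = false <;> by_cases h2 : (fun i => s (.inl (.inl i))) = t <;>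
      by_cases h3 : (fun i => s (.inl (.inr i))) = (Sum.elim pk fun _ => false : Bits _) <;>
      simp [this, h1, h2, h3]
  rw [recordGates, gateProd_append, gateProd_append, ← Matrix.mulVec_mulVec,
    ← Matrix.mulVec_mulVec, h0, adversary_mulVec _
      (fun f u => if f = false then (Pi.single t 1 : Bits _ → ℂ) u else 0)
      (fun q => if q = (Sum.elim pk fun _ => false : Bits _) then (1 : ℂ) else 0)]
  set φ := gateProd (gA.map (Gate.map Function.Embedding.inl) ++ roundGates b gB gC) *ᵥ
    (Pi.single t 1 : Bits _ → ℂ) with hφ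
  have h1 : (fun s : Bits (FlaggedWires m P Y B C A wA wB wC w) =>
      (gateProd (gA.map (Gate.map Function.Embedding.inl) ++ roundGates b gB gC) *ᵥ
        (fun f u => if f = false then (Pi.single t 1 : Bits _ → ℂ) u else 0) (s (.inr ())))
        (fun i => s (.inl (.inl i))) * (fun q => if q = (Sum.elim pk fun _ => false : Bits _)
          then (1 : ℂ) else 0) (fun i => s (.inl (.inr i)))) =
      fun s => φ (fun i => s (.inl (.inl i))) *
      if (fun i => s (.inl (.inr i))) = (Sum.elim pk fun _ => false : Bits _) ∧ s (.inr ()) = false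
      then 1 else 0 := by
    funext s
    by_cases hs : s (.inr ()) = false
    · simp only [hs, if_true, and_true]
      rfl
    · simp only [hs, Bool.true_eq_false, if_false, and_false]
      have : (fun u : Bits (AdversaryWires m P Y B C A wA wB wC) => (0 : ℂ)) = 0 := rfl
      rw [this, Matrix.mulVec_zero, Pi.zero_apply, zero_mul, mul_zero]
  rw [h1, flagGates_mulVec _ _ _ D pk acc hD]
  exact adversary_mulVec _ (fun f u => if f = bothAccept acc u then φ u else 0)
    (fun q => if q = (Sum.elim pk fun _ => false : Bits _) then (1 : ℂ) else 0)

/-- Distribute the public key: the player gets it as its `i`-th key, the other keys are `q`. -/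
def distributeKeys (i : Fin m) (q : Bits (Fin m × P)) :
    List (RevGate (LeaderWires m P Y B C A wA wB wC w wH)) :=
  constLayer adversaryKeys (fun p => if p.1 = i then false else q p) ++
    copyLayer (fun p => .inl (.inl (.inr (.inl (p.elim id id))))) (keyTargets i) (by
      rintro (a | a) (b | b) h <;> cases h)

/-- The hardwired keys leave block `i` at 0, so adding the given key there copies it. A second copy
goes to the honest parties, and the original serves the verifications. -/
theorem actList_distributeKeys (i : Fin m) (q : Bits (Fin m × P)) (pk : Bits P) :
    actList (distributeKeys i q) (Sum.elim (Sum.elim (Sum.elim (fun _ => false) (Sum.elim pk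
      fun _ => false)) fun _ => false) fun _ => false :
        Bits (LeaderWires m P Y B C A wA wB wC w wH)) =
    Sum.elim (Sum.elim (Sum.elim (Sum.elim (Sum.elim (fun p => if p.1 = i then pk p.2 else q p)
      fun _ => false) fun _ => false) (Sum.elim pk fun _ => false)) fun _ => false)
      (Sum.elim (Sum.elim pk fun _ => false) fun _ => false) := by
  rw [distributeKeys, actList_append, actList_constLayer, actList_copyLayer]
  have hk : ∀ (u : Bits (Fin m × P)) (t : Bits (LeaderWires m P Y B C A wA wB wC w wH)) x,
      (∀ y, adversaryKeys y ≠ x) → Function.extend adversaryKeys u t x = t x :=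
    fun u t x hx => Function.extend_apply' _ _ _ (by rintro ⟨y, hy⟩; exact hx y hy)
  have hc : ∀ (u : Bits (P ⊕ P)) (t : Bits (LeaderWires m P Y B C A wA wB wC w wH)) x,
      (∀ y, keyTargets i y ≠ x) → Function.extend (keyTargets i) u t x = t x :=
    fun u t x hx => Function.extend_apply' _ _ _ (by rintro ⟨y, hy⟩; exact hx y hy)
  funext x
  rcases x with (((((⟨j, x⟩ | x) | x) | (x | x)) | x)) | (x | x) | x
  · by_cases hj : j = i
    · subst hj
      refine ((keyTargets j).injective.extend_apply _ _ (.inl x)).trans ?_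
      refine (congrArg₂ xor (adversaryKeys.injective.extend_apply _ _ (j, x))
        (hk _ _ _ (fun y h => by cases h))).trans ?_
      simp only [if_true, Bool.xor_false]
      exact (Bool.false_xor _).trans (if_pos rfl).symm
    · refine (hc _ _ _ ?_).trans ?_
      · rintro (y | y) h
        · cases h
          exact hj rfl
        · cases h
      · refine (adversaryKeys.injective.extend_apply _ _ (j, x)).trans ?_
        simp only [hj, if_false]
        exact (Bool.false_xor _).trans (if_neg hj).symm
  · exact (hc _ _ _ (by rintro (y | y) h <;> cases h)).trans (hk _ _ _ (fun y h => by cases h))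
  · exact (hc _ _ _ (by rintro (y | y) h <;> cases h)).trans (hk _ _ _ (fun y h => by cases h))
  · exact (hc _ _ _ (by rintro (y | y) h <;> cases h)).trans (hk _ _ _ (fun y h => by cases h))
  · exact (hc _ _ _ (by rintro (y | y) h <;> cases h)).trans (hk _ _ _ (fun y h => by cases h))
  · exact (hc _ _ _ (by rintro (y | y) h <;> cases h)).trans (hk _ _ _ (fun y h => by cases h))
  · refine ((keyTargets i).injective.extend_apply _ _ (.inr x)).trans ?_
    refine (congrArg₂ xor (hk _ _ _ (fun y h => by cases h))
      (hk _ _ _ (fun y h => by cases h))).trans ?_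
    exact Bool.false_xor _
  · exact (hc _ _ _ (by rintro (y | y) h <;> cases h)).trans (hk _ _ _ (fun y h => by cases h))
  · exact (hc _ _ _ (by rintro (y | y) h <;> cases h)).trans (hk _ _ _ (fun y h => by cases h))

end Reduction

/-! ### The first stage of the reduction -/

section Reduction

set_option linter.unusedSectionVars false
set_option synthInstance.maxSize 100000
set_option synthInstance.maxHeartbeats 200000

variable {m : ℕ} {P Y B C A wA wB wC w wH : Type}

/-- The wires of the honest parties. -/
def honestParties : P ⊕ ((Y ⊕ A) ⊕ wH) ↪ LeaderWires m P Y B C A wA wB wC w wH :=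
  Function.Embedding.inl.trans Function.Embedding.inr

theorem flagSource_ne (a b) : flagSource (m := m) (P := P) (Y := Y) (B := B) (C := C) (A := A)
    (wA := wA) (wB := wB) (wC := wC) (w := w) (wH := wH) a ≠ flagOutputs b := by
  rcases a with a | a <;> intro h <;> cases h

variable [Fintype P] [DecidableEq P] [Fintype Y] [DecidableEq Y] [Fintype B] [DecidableEq B]
  [Fintype C] [DecidableEq C] [Fintype A] [DecidableEq A] [Fintype wA] [DecidableEq wA]
  [Fintype wB] [DecidableEq wB] [Fintype wC] [DecidableEq wC] [Fintype w] [DecidableEq w]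
  [Fintype wH] [DecidableEq wH]

/-- The first stage of the reduction. -/
def leaderGates (i : Fin m) (q : Bits (Fin m × P))
    (gM : List (Gate (FlaggedWires m P Y B C A wA wB wC w)))
    (gH : List (Gate (P ⊕ ((Y ⊕ A) ⊕ wH)))) :
    List (Gate (LeaderWires m P Y B C A wA wB wC w wH)) :=
  (distributeKeys i q).map Gate.rev ++ gM.map (Gate.map Function.Embedding.inl) ++
    gH.map (Gate.map honestParties) ++
    (copyLayer flagSource flagOutputs flagSource_ne).map Gate.rev ++
    (muxLayer (.inl (.inr ())) (fun y => .inl (.inl (.inl (.inl (.inr (.inl (.inl (i, y))))))))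
      (fun y => .inr (.inl (.inr (.inl (.inl y))))) obligationOutput (fun _ h => by cases h)
      (fun _ _ h => by cases h) (fun _ _ h => by cases h)).map Gate.rev

/-- The part of the state after the first stage that the player does not change. -/
def leaderRest (i : Fin m) (η : Bits (P ⊕ ((Y ⊕ A) ⊕ wH)) → ℂ)
    (s : Bits (LeaderWires m P Y B C A wA wB wC w wH)) : ℂ :=
  η (s ∘ honestParties) *
    (if s ∘ flagOutputs = (fun j => s (flagSource j)) then 1 else 0) *
    if s ∘ obligationOutput = (fun y => if s (.inl (.inr ())) then
      s (.inl (.inl (.inl (.inl (.inr (.inl (.inl (i, y)))))))) else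
      s (.inr (.inl (.inr (.inl (.inl y)))))) then 1 else 0

/-- Of the player's part, only the flag and the obligation of copy `i` are read. The local parties
write on none of the wires listed here, which makes `leaderRest` a spectator factor. -/
theorem leaderRest_congr (i : Fin m) (η : Bits (P ⊕ ((Y ⊕ A) ⊕ wH)) → ℂ)
    (s t : Bits (LeaderWires m P Y B C A wA wB wC w wH)) (h1 : s (.inl (.inr ())) = t (.inl (.inr ())))
    (h2 : ∀ y, s (.inl (.inl (.inl (.inl (.inr (.inl (.inl (i, y)))))))) =
      t (.inl (.inl (.inl (.inl (.inr (.inl (.inl (i, y)))))))))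
    (h3 : ∀ x, s (.inr x) = t (.inr x)) : leaderRest i η s = leaderRest i η t := by
  have e1 : s ∘ honestParties = t ∘ honestParties := funext fun x => h3 (.inl x)
  have e2 : s ∘ flagOutputs = t ∘ flagOutputs := funext fun x => h3 (.inr (.inr x))
  have e3 : s ∘ obligationOutput = t ∘ obligationOutput := funext fun x => h3 (.inr (.inl x))
  have e4 : ∀ j, s (flagSource j) = t (flagSource j) := by
    rintro (j | j)
    · exact h1
    · exact h3 _
  unfold leaderRest
  simp only [e1, e2, e3, e4, h1, h2, h3]

/-- The player and the honest parties use disjoint wires, so their state is a product; copying and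
selecting the outputs turns the indicators of zeroed output wires into the indicators in
`leaderRest`. -/
theorem leaderGates_mulVec (i : Fin m) (q : Bits (Fin m × P))
    (gM : List (Gate (FlaggedWires m P Y B C A wA wB wC w)))
    (gH : List (Gate (P ⊕ ((Y ⊕ A) ⊕ wH)))) (pk : Bits P) :
    gateProd (leaderGates i q gM gH) *ᵥ Pi.single (Sum.elim (Sum.elim (Sum.elim (fun _ => false)
      (Sum.elim pk fun _ => false)) fun _ => false) fun _ => false) 1 =
    fun s => (gateProd gM *ᵥ Pi.single (Sum.elim (Sum.elim (Sum.elim (Sum.elim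
      (fun p => if p.1 = i then pk p.2 else q p) fun _ => false) fun _ => false)
        (Sum.elim pk fun _ => false)) fun _ => false) 1) (s ∘ Function.Embedding.inl) *
      leaderRest i (gateProd gH *ᵥ Pi.single (Sum.elim pk fun _ => false) 1) s := by
  set M₁ : Bits (FlaggedWires m P Y B C A wA wB wC w) := Sum.elim (Sum.elim (Sum.elim (Sum.elim
      (fun p => if p.1 = i then pk p.2 else q p) fun _ => false) fun _ => false)
        (Sum.elim pk fun _ => false)) fun _ => false with hM₁
  set H₁ : Bits (P ⊕ ((Y ⊕ A) ⊕ wH)) := Sum.elim pk fun _ => false with hH₁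
  set ω : Bits (LeaderWires m P Y B C A wA wB wC w wH) → ℂ :=
    fun s => if s ∘ flagOutputs = (fun _ => false) then 1 else 0 with hω
  set ω' : Bits (LeaderWires m P Y B C A wA wB wC w wH) → ℂ :=
    fun s => if s ∘ obligationOutput = (fun _ => false) then 1 else 0 with hω'
  have h1 : (Pi.single (Sum.elim M₁ (Sum.elim H₁ fun _ => false)) 1 :
      Bits (LeaderWires m P Y B C A wA wB wC w wH) → ℂ) = fun s =>
      (Pi.single M₁ 1 : Bits _ → ℂ) (s ∘ Function.Embedding.inl) *
        ((Pi.single H₁ 1 : Bits _ → ℂ) (s ∘ honestParties) * (ω s * ω' s)) := by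
    funext s
    rw [Pi.single_apply, Pi.single_apply, Pi.single_apply]
    have : s = Sum.elim M₁ (Sum.elim H₁ fun _ => false) ↔ s ∘ Function.Embedding.inl = M₁ ∧
        s ∘ honestParties = H₁ ∧ s ∘ flagOutputs = (fun _ => false) ∧
        s ∘ obligationOutput = (fun _ => false) := by
      constructor
      · rintro rfl
        exact ⟨rfl, rfl, rfl, rfl⟩
      · rintro ⟨e1, e2, e3, e4⟩
        funext x
        rcases x with x | x | x | x
        · exact congrFun e1 x
        · exact congrFun e2 x
        · exact congrFun e4 x
        · exact congrFun e3 x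
    simp only [hω, hω', this]
    by_cases e1 : s ∘ Function.Embedding.inl = M₁ <;> by_cases e2 : s ∘ honestParties = H₁ <;>
      by_cases e3 : s ∘ flagOutputs = (fun _ => false) <;>
      by_cases e4 : s ∘ obligationOutput = (fun _ => false) <;> simp [e1, e2, e3, e4]
  have h2 : gateProd (gM.map (Gate.map Function.Embedding.inl)) *ᵥ
      (fun s : Bits (LeaderWires m P Y B C A wA wB wC w wH) =>
        (Pi.single M₁ 1 : Bits _ → ℂ) (s ∘ Function.Embedding.inl) *
        ((Pi.single H₁ 1 : Bits _ → ℂ) (s ∘ honestParties) * (ω s * ω' s))) =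
      fun s => (gateProd gM *ᵥ Pi.single M₁ 1) (s ∘ Function.Embedding.inl) *
        ((Pi.single H₁ 1 : Bits _ → ℂ) (s ∘ honestParties) * (ω s * ω' s)) := by
    refine map_mulVec_mul _ _ _ _ fun u s => ?_
    have e : ∀ x, Function.extend Function.Embedding.inl u s (.inr x) = s (.inr x) := fun x =>
      Function.extend_apply' _ _ _ (by rintro ⟨y, hy⟩; cases hy)
    have e1 : Function.extend Function.Embedding.inl u s ∘ honestParties = s ∘ honestParties :=
      funext fun x => e (.inl x)
    have e2 : Function.extend Function.Embedding.inl u s ∘ flagOutputs = s ∘ flagOutputs :=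
      funext fun x => e (.inr (.inr x))
    have e3 : Function.extend Function.Embedding.inl u s ∘ obligationOutput =
      s ∘ obligationOutput := funext fun x => e (.inr (.inl x))
    simp only [hω, hω', e1, e2, e3]
  set Φ := gateProd gM *ᵥ (Pi.single M₁ 1 : Bits _ → ℂ) with hΦ
  have h3 : gateProd (gH.map (Gate.map honestParties)) *ᵥ
      (fun s : Bits (LeaderWires m P Y B C A wA wB wC w wH) =>
        Φ (s ∘ Function.Embedding.inl) *
        ((Pi.single H₁ 1 : Bits _ → ℂ) (s ∘ honestParties) * (ω s * ω' s))) =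
      fun s => ((Φ (s ∘ Function.Embedding.inl) *
        (gateProd gH *ᵥ Pi.single H₁ 1) (s ∘ honestParties)) * ω' s) * ω s := by
    have e0 : (fun s : Bits (LeaderWires m P Y B C A wA wB wC w wH) =>
        Φ (s ∘ Function.Embedding.inl) *
        ((Pi.single H₁ 1 : Bits _ → ℂ) (s ∘ honestParties) * (ω s * ω' s))) = fun s =>
        (Pi.single H₁ 1 : Bits _ → ℂ) (s ∘ honestParties) *
          (Φ (s ∘ Function.Embedding.inl) * (ω s * ω' s)) := by
      funext s
      ring
    rw [e0, map_mulVec_mul]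
    · funext s
      ring
    · intro u s
      have e : ∀ x, (∀ y, honestParties y ≠ x) →
          Function.extend honestParties u s x = s x := fun x hx =>
        Function.extend_apply' _ _ _ (by rintro ⟨y, hy⟩; exact hx y hy)
      have e1 : Function.extend honestParties u s ∘ Function.Embedding.inl =
        s ∘ Function.Embedding.inl := funext fun x => e _ (fun y h => by cases h)
      have e2 : Function.extend honestParties u s ∘ flagOutputs = s ∘ flagOutputs :=
        funext fun x => e _ (fun y h => by cases h)
      have e3 : Function.extend honestParties u s ∘ obligationOutput =
        s ∘ obligationOutput := funext fun x => e _ (fun y h => by cases h)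
      simp only [hω, hω', e1, e2, e3]
  set η := gateProd gH *ᵥ (Pi.single H₁ 1 : Bits _ → ℂ) with hη
  -- The factors not yet written do not depend on the output wires, so those wires are fresh for the
  -- copy and for the selection.
  have i1 : ∀ {J : Type} (f : J ↪ LeaderWires m P Y B C A wA wB wC w wH)
      [Fintype J] [DecidableEq J], (∀ a b, f a ≠ .inl b) → (∀ a b, f a ≠ .inr (.inl b)) →
      IndepOf f fun s => Φ (s ∘ Function.Embedding.inl) * η (s ∘ honestParties) := by
    intro J f _ _ hf hf' s t h
    have e1 : s ∘ Function.Embedding.inl = t ∘ Function.Embedding.inl :=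
      funext fun x => h _ (by rintro ⟨y, hy⟩; exact hf _ _ hy)
    have e2 : s ∘ honestParties = t ∘ honestParties :=
      funext fun x => h _ (by rintro ⟨y, hy⟩; exact hf' _ _ hy)
    simp only [e1, e2]
  have i2 : IndepOf flagOutputs ω' := by
    intro s t h
    have e1 : s ∘ obligationOutput = t ∘ obligationOutput :=
      funext fun x => h _ (by rintro ⟨y, hy⟩; cases hy)
    simp only [hω', e1]
  have i3 : IndepOf obligationOutput fun s : Bits (LeaderWires m P Y B C A wA wB wC w wH) =>
      if s ∘ flagOutputs = (fun j => s (flagSource j)) then (1 : ℂ) else 0 := by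
    intro s t h
    have e1 : s ∘ flagOutputs = t ∘ flagOutputs :=
      funext fun x => h _ (by rintro ⟨y, hy⟩; cases hy)
    have e2 : ∀ j, s (flagSource j) = t (flagSource j) := by
      rintro (j | j) <;> exact h _ (by rintro ⟨y, hy⟩; cases hy)
    simp only [e1, e2]
  rw [leaderGates, gateProd_append, gateProd_append, gateProd_append, gateProd_append,
    ← Matrix.mulVec_mulVec, ← Matrix.mulVec_mulVec, ← Matrix.mulVec_mulVec,
    ← Matrix.mulVec_mulVec, gateProd_rev_single, actList_distributeKeys, h1, h2, h3,
    gateProd_copyLayer _ _ _ _ ((i1 _ (fun _ _ h => by cases h) (fun _ _ h => by cases h)).mul i2)]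
  -- The indicator of the register that is written next is moved to the last place.
  have e0 : (fun s : Bits (LeaderWires m P Y B C A wA wB wC w wH) =>
      ((Φ (s ∘ Function.Embedding.inl) * η (s ∘ honestParties)) * ω' s) *
        if s ∘ flagOutputs = (fun j => s (flagSource j)) then 1 else 0) = fun s =>
      ((Φ (s ∘ Function.Embedding.inl) * η (s ∘ honestParties)) *
        if s ∘ flagOutputs = (fun j => s (flagSource j)) then 1 else 0) * ω' s := by
    funext s
    ring
  rw [e0, gateProd_muxLayer _ _ _ _ _ _ _ _
    ((i1 _ (fun _ _ h => by cases h) (fun _ _ h => by cases h)).mul i3)]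
  funext s
  rw [leaderRest, mul_assoc, mul_assoc, mul_assoc]

theorem length_leaderGates_le (i : Fin m) (q : Bits (Fin m × P))
    (gM : List (Gate (FlaggedWires m P Y B C A wA wB wC w)))
    (gH : List (Gate (P ⊕ ((Y ⊕ A) ⊕ wH)))) :
    (leaderGates i q gM gH).length ≤ m * Fintype.card P + 2 * Fintype.card P + gM.length +
      gH.length + (1 + Fintype.card A) + Fintype.card Y * 3 := by
  have h1 := length_constLayer_le (adversaryKeys (m := m) (P := P) (Y := Y) (B := B) (C := C)
    (A := A) (wA := wA) (wB := wB) (wC := wC) (w := w) (wH := wH))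
    (fun p => if p.1 = i then false else q p)
  have h2 := length_copyLayer_le (fun p : P ⊕ P => (.inl (.inl (.inr (.inl (p.elim id id)))) :
    LeaderWires m P Y B C A wA wB wC w wH)) (keyTargets i) (by
      rintro (a | a) (b | b) h <;> cases h)
  have h3 := length_copyLayer_le (flagSource (m := m) (P := P) (Y := Y) (B := B) (C := C)
    (A := A) (wA := wA) (wB := wB) (wC := wC) (w := w) (wH := wH)) flagOutputs flagSource_ne
  have h4 := length_muxLayer_le (.inl (.inr ()) : LeaderWires m P Y B C A wA wB wC w wH)
    (fun y => .inl (.inl (.inl (.inl (.inr (.inl (.inl (i, y))))))))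
      (fun y => .inr (.inl (.inr (.inl (.inl y))))) obligationOutput (fun _ h => by cases h)
      (fun _ _ h => by cases h) (fun _ _ h => by cases h)
  simp only [Fintype.card_sum, Fintype.card_prod, Fintype.card_fin, Fintype.card_unit]
    at h1 h2 h3
  simp only [leaderGates, distributeKeys, List.length_append, List.length_map]
  omega

end Reduction

/-! ### The final state of the reduction -/

section Reduction

set_option linter.unusedSectionVars false
set_option synthInstance.maxSize 100000
set_option synthInstance.maxHeartbeats 200000

variable {m : ℕ} {P Y B C A wA wB wC w wH : Type}
  [Fintype P] [DecidableEq P] [Fintype Y] [DecidableEq Y] [Fintype B] [DecidableEq B]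
  [Fintype C] [DecidableEq C] [Fintype A] [DecidableEq A] [Fintype wA] [DecidableEq wA]
  [Fintype wB] [DecidableEq wB] [Fintype wC] [DecidableEq wC] [Fintype w] [DecidableEq w]
  [Fintype wH] [DecidableEq wH]

/-- All gates of the reduction. -/
def reductionGates (i : Fin m) (q : Bits (Fin m × P))
    (gM : List (Gate (FlaggedWires m P Y B C A wA wB wC w)))
    (gH : List (Gate (P ⊕ ((Y ⊕ A) ⊕ wH)))) (b₀ b₁ : Bits (Fin m))
    (gB : List (Gate (PartyWires m B A wB))) (gC : List (Gate (PartyWires m C A wC))) :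
    List (Gate (ReductionWires m P Y B C A wA wB wC w wH)) :=
  (leaderGates i q gM gH).map (Gate.map Function.Embedding.inl) ++
    (localGates i b₀ b₁ gB).map (Gate.map firstParty) ++
    (localGates i b₀ b₁ gC).map (Gate.map secondParty)

/-- The answer of the first local party. -/
def firstAnswer (i : Fin m) (s : Bits (ReductionWires m P Y B C A wA wB wC w wH)) : Bits A :=
  fun j => if s (firstParty (.inl (.inl (.inl ()))))
    then s (firstParty (localParty (.inr (.inl (i, j)))))
    else s (firstParty (.inl (.inl (.inr (.inr j)))))

/-- The answer of the second local party. -/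
def secondAnswer (i : Fin m) (s : Bits (ReductionWires m P Y B C A wA wB wC w wH)) : Bits A :=
  fun j => if s (secondParty (.inl (.inl (.inl ()))))
    then s (secondParty (localParty (.inr (.inl (i, j)))))
    else s (secondParty (.inl (.inl (.inr (.inr j)))))

theorem firstParty_ne_secondParty (a b) : firstParty (m := m) (P := P) (Y := Y) (B := B) (C := C)
    (A := A) (wA := wA) (wB := wB) (wC := wC) (w := w) (wH := wH) (localParty a) ≠
      secondParty (localParty b) := by
  rcases a with (a | a) | a <;> rcases b with (b | b) | b <;> intro h <;> cases h

theorem leaderRest_firstParty (i : Fin m) (η : Bits (P ⊕ ((Y ⊕ A) ⊕ wH)) → ℂ) :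
    IndepOf (localParty.trans firstParty)
      fun s : Bits (ReductionWires m P Y B C A wA wB wC w wH) => leaderRest i η (s ∘ Sum.inl) := by
  intro s t h
  refine leaderRest_congr i η _ _ (h _ ?_) (fun y => h _ ?_) fun x => h _ ?_
  · rintro ⟨((y | y) | y), hy⟩ <;> cases hy
  · rintro ⟨((y | y) | y), hy⟩ <;> cases hy
  · rintro ⟨((y | y) | y), hy⟩ <;> cases hy

theorem leaderRest_secondParty (i : Fin m) (η : Bits (P ⊕ ((Y ⊕ A) ⊕ wH)) → ℂ) :
    IndepOf (localParty.trans secondParty)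
      fun s : Bits (ReductionWires m P Y B C A wA wB wC w wH) => leaderRest i η (s ∘ Sum.inl) := by
  intro s t h
  refine leaderRest_congr i η _ _ (h _ ?_) (fun y => h _ ?_) fun x => h _ ?_
  · rintro ⟨((y | y) | y), hy⟩ <;> cases hy
  · rintro ⟨((y | y) | y), hy⟩ <;> cases hy
  · rintro ⟨((y | y) | y), hy⟩ <;> cases hy

/-- The initial state of the reduction. -/
def reductionInit (pk : Bits P) (c : Bool) : Bits (ReductionWires m P Y B C A wA wB wC w wH) :=
  Sum.elim (Sum.elim (Sum.elim (Sum.elim (fun _ => false) (Sum.elim pk fun _ => false))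
    fun _ => false) fun _ => false)
    (Sum.elim (Sum.elim (fun _ => c) fun _ => false) (Sum.elim (fun _ => c) fun _ => false))

/-- The quantum content is one further round of the player, on b₀ or b₁ according to `c`, applied to
the recorded state. Everything else is a spectator factor or an indicator that fixes a classical
wire. -/
theorem reductionGates_mulVec (i : Fin m) (q : Bits (Fin m × P))
    (gM : List (Gate (FlaggedWires m P Y B C A wA wB wC w)))
    (gH : List (Gate (P ⊕ ((Y ⊕ A) ⊕ wH)))) (b₀ b₁ : Bits (Fin m))
    (gB : List (Gate (PartyWires m B A wB))) (gC : List (Gate (PartyWires m C A wC)))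
    (pk : Bits P) (c : Bool) :
    gateProd (reductionGates i q gM gH b₀ b₁ gB gC) *ᵥ Pi.single (reductionInit pk c) 1 =
    fun s => (gateProd ((roundGates (if c then b₁ else b₀) gB gC).map (Gate.map adversary)) *ᵥ
      (gateProd gM *ᵥ Pi.single (Sum.elim (Sum.elim (Sum.elim (Sum.elim
      (fun p => if p.1 = i then pk p.2 else q p) fun _ => false) fun _ => false)
        (Sum.elim pk fun _ => false)) fun _ => false) 1)) (fun x => s (.inl (.inl x))) *
      leaderRest i (gateProd gH *ᵥ Pi.single (Sum.elim pk fun _ => false) 1) (s ∘ Sum.inl) *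
      ((if s (.inr (.inl (.inl 0))) = c then 1 else 0) *
        if s ∘ localAnswer.trans firstParty = firstAnswer i s then 1 else 0) *
      ((if s (.inr (.inr (.inl 0))) = c then 1 else 0) *
        if s ∘ localAnswer.trans secondParty = secondAnswer i s then 1 else 0) := by
  set η := gateProd gH *ᵥ (Pi.single (Sum.elim pk fun _ => false) 1 :
    Bits (P ⊕ ((Y ⊕ A) ⊕ wH)) → ℂ) with hη
  set Φ := gateProd gM *ᵥ (Pi.single (Sum.elim (Sum.elim (Sum.elim (Sum.elim
      (fun p => if p.1 = i then pk p.2 else q p) fun _ => false) fun _ => false)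
        (Sum.elim pk fun _ => false)) fun _ => false) 1 :
          Bits (FlaggedWires m P Y B C A wA wB wC w) → ℂ) with hΦ
  set T := Bits (ReductionWires m P Y B C A wA wB wC w wH) with hT
  set fM : FlaggedWires m P Y B C A wA wB wC w ↪ ReductionWires m P Y B C A wA wB wC w wH :=
    Function.Embedding.inl.trans Function.Embedding.inl with hfM
  set cB : T → ℂ := fun s => if s (firstParty (.inl (.inr 0))) = c then 1 else 0 with hcB
  set cC : T → ℂ := fun s => if s (secondParty (.inl (.inr 0))) = c then 1 else 0 with hcC
  set oB : T → ℂ := fun s => if s ∘ localAnswer.trans firstParty = (fun _ => false) then 1 else 0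
    with hoB
  set oC : T → ℂ := fun s => if s ∘ localAnswer.trans secondParty = (fun _ => false) then 1 else 0
    with hoC
  set R : T → ℂ := fun s => leaderRest i η (s ∘ Sum.inl) with hR
  have h0 : gateProd ((leaderGates i q gM gH).map (Gate.map Function.Embedding.inl)) *ᵥ
      (Pi.single (reductionInit pk c) 1 : T → ℂ) =
      fun s => ((Φ (s ∘ fM) * (R s * (cC s * oC s))) * cB s) * oB s := by
    set ρ : Bits ((Fin 1 ⊕ (A ⊕ Empty)) ⊕ (Fin 1 ⊕ (A ⊕ Empty))) :=
      Sum.elim (Sum.elim (fun _ => c) fun _ => false) (Sum.elim (fun _ => c) fun _ => false)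
      with hρ
    have e0 : (Pi.single (reductionInit pk c) 1 : T → ℂ) = fun s =>
        (Pi.single (Sum.elim (Sum.elim (Sum.elim (fun _ => false) (Sum.elim pk fun _ => false))
          fun _ => false) fun _ => false) 1 : Bits _ → ℂ) (s ∘ Function.Embedding.inl) *
        if s ∘ Sum.inr = ρ then 1 else 0 := by
      funext s
      obtain ⟨⟨s1, s2⟩, rfl⟩ := (Equiv.sumArrowEquivProdArrow _ _ Bool).symm.surjective s
      set t₀ : Bits (LeaderWires m P Y B C A wA wB wC w wH) :=
        Sum.elim (Sum.elim (Sum.elim (fun _ => false) (Sum.elim pk fun _ => false))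
          fun _ => false) fun _ => false with ht₀
      change (Pi.single (Sum.elim t₀ ρ) (1 : ℂ) : Bits _ → ℂ) (Sum.elim s1 s2) =
        (Pi.single t₀ 1 : Bits _ → ℂ) s1 * (if s2 = ρ then 1 else 0)
      rw [Pi.single_apply, Pi.single_apply]
      by_cases h1 : s1 = t₀ <;> by_cases h2 : s2 = ρ <;> simp [h1, h2, Sum.elim_eq_iff]
    rw [e0, map_mulVec_mul]
    · rw [leaderGates_mulVec]
      -- The indicator of the initial challenge and answer wires is split between the two parties,
      -- because each party's gates replace only their own part.
      funext s
      have : s ∘ Sum.inr = ρ ↔ (s (secondParty (.inl (.inr 0))) = c ∧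
          s ∘ localAnswer.trans secondParty = fun _ => false) ∧
          s (firstParty (.inl (.inr 0))) = c ∧
          s ∘ localAnswer.trans firstParty = fun _ => false := by
        constructor
        · intro h
          exact ⟨⟨congrFun h (.inr (.inl 0)), funext fun j => congrFun h (.inr (.inr (.inl j)))⟩,
            congrFun h (.inl (.inl 0)), funext fun j => congrFun h (.inl (.inr (.inl j)))⟩
        · rintro ⟨⟨h1, h2⟩, h3, h4⟩
          funext x
          rcases x with (x | x | x) | (x | x | x)
          · rw [Subsingleton.elim x 0]; exact h3
          · exact congrFun h4 x
          · exact x.elim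
          · rw [Subsingleton.elim x 0]; exact h1
          · exact congrFun h2 x
          · exact x.elim
      have e1 : (if s ∘ Sum.inr = ρ then (1 : ℂ) else 0) = cC s * oC s * (cB s * oB s) := by
        simp only [this, hcC, hoC, hcB, hoB]
        by_cases h1 : s (secondParty (.inl (.inr 0))) = c <;>
          by_cases h2 : s ∘ localAnswer.trans secondParty = (fun _ => false) <;>
          by_cases h3 : s (firstParty (.inl (.inr 0))) = c <;>
          by_cases h4 : s ∘ localAnswer.trans firstParty = (fun _ => false) <;>
          simp [h1, h2, h3, h4]
      rw [e1]
      have e2 : ∀ a b x y z w : ℂ, a * b * (x * y * (z * w)) = a * (b * (x * y)) * z * w := by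
        intros; ring
      exact e2 _ _ _ _ _ _
    · intro u s
      have : Function.extend (Function.Embedding.inl : _ ↪ _ ⊕
          ((Fin 1 ⊕ (A ⊕ Empty)) ⊕ (Fin 1 ⊕ (A ⊕ Empty)))) u s ∘ Sum.inr = s ∘ Sum.inr := by
        funext x
        exact Function.extend_apply' _ _ _ (by rintro ⟨a, ha⟩; cases ha)
      rw [this]
  have iM : ∀ {J : Type} (f : J ↪ ReductionWires m P Y B C A wA wB wC w wH) (Ψ : Bits _ → ℂ)
      [Fintype J] [DecidableEq J], (∀ a b, f a ≠ .inl b) →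
      IndepOf f fun s => Ψ (s ∘ fM) * R s := by
    intro J f Ψ _ _ hf s t h
    have e1 : ∀ x, s (.inl x) = t (.inl x) :=
      fun x => h _ (by rintro ⟨y, hy⟩; exact hf _ _ hy)
    have e2 : s ∘ fM = t ∘ fM := funext fun x => e1 _
    have e3 : s ∘ Sum.inl = t ∘ Sum.inl := funext fun x => e1 _
    simp only [hR, e2, e3]
  set oB' : T → ℂ := fun s => if s ∘ localAnswer.trans firstParty = firstAnswer i s then 1 else 0
    with hoB'
  set oC' : T → ℂ := fun s => if s ∘ localAnswer.trans secondParty = secondAnswer i s then 1 else 0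
    with hoC'
  have ic : ∀ {J : Type} (f : J ↪ ReductionWires m P Y B C A wA wB wC w wH)
      [Fintype J] [DecidableEq J], (∀ a, f a ≠ .inr (.inl (.inl 0))) → IndepOf f cB := by
    intro J f _ _ hf s t h
    have e1 := h (firstParty (.inl (.inr 0))) (by rintro ⟨y, hy⟩; exact hf _ hy)
    simp only [hcB, e1]
  have ic' : ∀ {J : Type} (f : J ↪ ReductionWires m P Y B C A wA wB wC w wH)
      [Fintype J] [DecidableEq J], (∀ a, f a ≠ .inr (.inr (.inl 0))) → IndepOf f cC := by
    intro J f _ _ hf s t h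
    have e1 := h (secondParty (.inl (.inr 0))) (by rintro ⟨y, hy⟩; exact hf _ hy)
    simp only [hcC, e1]
  have io : ∀ {J : Type} (f : J ↪ ReductionWires m P Y B C A wA wB wC w wH)
      [Fintype J] [DecidableEq J], (∀ a b, f a ≠ secondParty (localAnswer b)) → IndepOf f oC := by
    intro J f _ _ hf s t h
    have e1 : s ∘ localAnswer.trans secondParty = t ∘ localAnswer.trans secondParty :=
      funext fun x => h _ (by rintro ⟨y, hy⟩; exact hf _ _ hy)
    simp only [hoC, e1]
  have iB : ∀ {J : Type} (f : J ↪ ReductionWires m P Y B C A wA wB wC w wH)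
      [Fintype J] [DecidableEq J], (∀ a b, f a ≠ firstParty b) → IndepOf f oB' := by
    intro J f _ _ hf s t h
    have e0 : ∀ x, s (firstParty x) = t (firstParty x) :=
      fun x => h _ (by rintro ⟨y, hy⟩; exact hf _ _ hy)
    have e1 : s ∘ localAnswer.trans firstParty = t ∘ localAnswer.trans firstParty :=
      funext fun x => e0 (localAnswer x)
    have e2 : firstAnswer i s = firstAnswer i t := by
      unfold firstAnswer
      simp only [e0]
    simp only [hoB', e1, e2]
  -- `firstAnswer` reads wires of the player's first party, so this independence uses that the two
  -- parties of the player share no wire.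
  have iBp : IndepOf (localParty.trans secondParty) oB' := by
    intro s t h
    have e0 : ∀ a, s (firstParty (localParty a)) = t (firstParty (localParty a)) :=
      fun a => h _ (by rintro ⟨y, hy⟩; exact firstParty_ne_secondParty _ _ hy.symm)
    have e1 : s ∘ localAnswer.trans firstParty = t ∘ localAnswer.trans firstParty :=
      funext fun x => h _ (by rintro ⟨y, hy⟩; cases hy)
    have e2 : s (firstParty (.inl (.inl (.inl ())))) = t (firstParty (.inl (.inl (.inl ())))) :=
      h _ (by rintro ⟨y, hy⟩; cases hy)
    have e3 : ∀ j, s (firstParty (.inl (.inl (.inr (.inr j))))) =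
        t (firstParty (.inl (.inl (.inr (.inr j))))) :=
      fun j => h _ (by rintro ⟨y, hy⟩; cases hy)
    have e4 : firstAnswer i s = firstAnswer i t := by
      unfold firstAnswer
      simp only [e0, e2, e3]
    simp only [hoB', e1, e4]
  have h1 : gateProd ((localGates i b₀ b₁ gB).map (Gate.map firstParty)) *ᵥ
      (fun s => ((Φ (s ∘ fM) * (R s * (cC s * oC s))) * cB s) * oB s) = fun s =>
      (((gateProd (((partyGates (if c then b₁ else b₀) gB).map (Gate.map bobWires)).map
        (Gate.map adversary)) *ᵥ Φ) (s ∘ fM) * (R s * (cC s * oC s))) * cB s) * oB' s := by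
    have hv : IndepOf (localAnswer.trans firstParty)
        (fun s => Φ (s ∘ fM) * (R s * (cC s * oC s))) := by
      have := (iM (localAnswer.trans firstParty) Φ (fun _ _ h => by cases h)).mul
        ((ic' (localAnswer.trans firstParty) (fun _ h => by cases h)).mul
          (io (localAnswer.trans firstParty) (fun _ _ h => by cases h)))
      intro s t h
      have := this s t h
      simp only [mul_assoc] at this
      exact this
    refine (gateProd_localGates i b₀ b₁ gB firstParty _ hv c).trans ?_
    have e1 : gateProd ((partyGates (if c then b₁ else b₀) gB).map
        (Gate.map (localParty.trans firstParty))) *ᵥ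
        (fun s => Φ (s ∘ fM) * (R s * (cC s * oC s))) = fun s =>
        (gateProd (((partyGates (if c then b₁ else b₀) gB).map (Gate.map bobWires)).map
        (Gate.map adversary)) *ᵥ Φ) (s ∘ fM) * (R s * (cC s * oC s)) := by
      rw [gateProd_map_mul _ _ _ _ ((leaderRest_firstParty i η).mul ((ic' _ ?_).mul (io _ ?_)))]
      · funext s
        rw [map_gate_map]
        exact congrArg₂ _ (map_trans_mulVec_comp (bobWires.trans adversary) fM _ _ s) rfl
      · intro a h; cases h
      · intro a b h; cases h
    rw [e1]
    rfl
  have h2 : gateProd ((localGates i b₀ b₁ gC).map (Gate.map secondParty)) *ᵥ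
      (fun s => (((gateProd (((partyGates (if c then b₁ else b₀) gB).map (Gate.map bobWires)).map
        (Gate.map adversary)) *ᵥ Φ) (s ∘ fM) * (R s * (cC s * oC s))) * cB s) * oB' s) = fun s =>
      (((gateProd (((partyGates (if c then b₁ else b₀) gC).map (Gate.map charlieWires)).map
        (Gate.map adversary)) *ᵥ (gateProd (((partyGates (if c then b₁ else b₀) gB).map
        (Gate.map bobWires)).map (Gate.map adversary)) *ᵥ Φ)) (s ∘ fM) *
          (R s * (cB s * oB' s))) * cC s) * oC' s := by
    set Φ' := gateProd (((partyGates (if c then b₁ else b₀) gB).map (Gate.map bobWires)).map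
        (Gate.map adversary)) *ᵥ Φ with hΦ'
    -- With the first party finished, its indicators become spectators and those of the second party
    -- are exposed.
    have e0 : (fun s => ((Φ' (s ∘ fM) * (R s * (cC s * oC s))) * cB s) * oB' s) =
        fun s => ((Φ' (s ∘ fM) * (R s * (cB s * oB' s))) * cC s) * oC s := by
      funext s
      ring
    rw [e0]
    have hv : IndepOf (localAnswer.trans secondParty)
        (fun s => Φ' (s ∘ fM) * (R s * (cB s * oB' s))) := by
      have := (iM (localAnswer.trans secondParty) Φ' (fun _ _ h => by cases h)).mul
        ((ic (localAnswer.trans secondParty) (fun _ h => by cases h)).mul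
          (iB (localAnswer.trans secondParty) (by
            rintro a (((b | b | b) | b) | b) h <;> cases h)))
      intro s t h
      have := this s t h
      simp only [mul_assoc] at this
      exact this
    refine (gateProd_localGates i b₀ b₁ gC secondParty _ hv c).trans ?_
    have e1 : gateProd ((partyGates (if c then b₁ else b₀) gC).map
        (Gate.map (localParty.trans secondParty))) *ᵥ
        (fun s => Φ' (s ∘ fM) * (R s * (cB s * oB' s))) = fun s =>
        (gateProd (((partyGates (if c then b₁ else b₀) gC).map (Gate.map charlieWires)).map
        (Gate.map adversary)) *ᵥ Φ') (s ∘ fM) * (R s * (cB s * oB' s)) := by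
      rw [gateProd_map_mul _ _ _ _ ((leaderRest_secondParty i η).mul ((ic _ ?_).mul iBp))]
      · funext s
        rw [map_gate_map]
        exact congrArg₂ _ (map_trans_mulVec_comp (charlieWires.trans adversary) fM _ _ s) rfl
      · intro a h; cases h
    rw [e1]
    rfl
  rw [reductionGates, gateProd_append, gateProd_append, ← Matrix.mulVec_mulVec,
    ← Matrix.mulVec_mulVec, h0, h1, h2, roundGates, List.map_append, gateProd_append,
    ← Matrix.mulVec_mulVec]
  funext s
  have e2 : ∀ a b x y z w : ℂ, a * (b * (x * y)) * z * w = a * b * (x * y) * (z * w) := by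
    intros; ring
  exact e2 _ _ _ _ _ _

end Reduction

/-! ### Summation over the classical wires of the final state -/

section Reduction

set_option linter.unusedSectionVars false
set_option synthInstance.maxSize 100000
set_option synthInstance.maxHeartbeats 200000

variable {m : ℕ} {P Y B C A wA wB wC w wH : Type}
  [Fintype P] [DecidableEq P] [Fintype Y] [DecidableEq Y] [Fintype B] [DecidableEq B]
  [Fintype C] [DecidableEq C] [Fintype A] [DecidableEq A] [Fintype wA] [DecidableEq wA]
  [Fintype wB] [DecidableEq wB] [Fintype wC] [DecidableEq wC] [Fintype w] [DecidableEq w]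
  [Fintype wH] [DecidableEq wH]

/-- The final state of the reduction with given contents of the quantum wires. -/
def reductionFinal (i : Fin m) (c : Bool) (u : Bits (FlaggedWires m P Y B C A wA wB wC w))
    (h : Bits (P ⊕ ((Y ⊕ A) ⊕ wH))) : Bits (ReductionWires m P Y B C A wA wB wC w wH) :=
  Sum.elim (Sum.elim u (Sum.elim h (Sum.elim
    (fun y => if u (.inr ()) then u (.inl (.inl (.inl (.inr (.inl (.inl (i, y)))))))
      else h (.inr (.inl (.inl y))))
    (Sum.elim (fun _ => u (.inr ())) fun a => h (.inr (.inl (.inr a)))))))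
    (Sum.elim (Sum.elim (fun _ => c) (Sum.elim (fun j => if u (.inr ())
        then u (.inl (.inl (.inr (.inl (.inr (.inl (i, j))))))) else h (.inr (.inl (.inr j))))
        fun _ => false))
      (Sum.elim (fun _ => c) (Sum.elim (fun j => if u (.inr ())
        then u (.inl (.inl (.inr (.inr (.inr (.inl (i, j))))))) else h (.inr (.inl (.inr j))))
        fun _ => false)))

/-- The indicators determine all classical wires from the contents `u` of the player's wires and `h`
of the honest wires, so only the strings `reductionFinal` contribute, each with the product of two
weights. -/
theorem sum_reduction (i : Fin m) (c : Bool) (Ψ : Bits (FlaggedWires m P Y B C A wA wB wC w) → ℂ)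
    (η : Bits (P ⊕ ((Y ⊕ A) ⊕ wH)) → ℂ) (acc : Bits Y → Bits A → Bits A → Prop)
    [∀ y a a', Decidable (acc y a a')] :
    (∑ s : Bits (ReductionWires m P Y B C A wA wB wC w wH),
      if acc (fun y => s (.inl (.inr (.inr (.inl y))))) (fun j => s (.inr (.inl (.inr (.inl j)))))
        (fun j => s (.inr (.inr (.inr (.inl j))))) then
      ‖Ψ (fun x => s (.inl (.inl x))) * leaderRest i η (s ∘ Sum.inl) *
      ((if s (.inr (.inl (.inl 0))) = c then 1 else 0) *
        if s ∘ localAnswer.trans firstParty = firstAnswer i s then 1 else 0) *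
      ((if s (.inr (.inr (.inl 0))) = c then 1 else 0) *
        if s ∘ localAnswer.trans secondParty = secondAnswer i s then 1 else 0)‖ ^ 2 else 0) =
    ∑ u, ∑ h, if acc
        (fun y => if u (.inr ()) then u (.inl (.inl (.inl (.inr (.inl (.inl (i, y)))))))
          else h (.inr (.inl (.inl y))))
        (fun j => if u (.inr ())
          then u (.inl (.inl (.inr (.inl (.inr (.inl (i, j))))))) else h (.inr (.inl (.inr j))))
        (fun j => if u (.inr ())
          then u (.inl (.inl (.inr (.inr (.inr (.inl (i, j))))))) else h (.inr (.inl (.inr j))))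
      then ‖Ψ u‖ ^ 2 * ‖η h‖ ^ 2 else 0 := by
  rw [← Fintype.sum_prod_type']
  refine (Fintype.sum_of_injective (fun x : Bits (FlaggedWires m P Y B C A wA wB wC w) ×
    Bits (P ⊕ ((Y ⊕ A) ⊕ wH)) => reductionFinal i c x.1 x.2) ?_ _ _ ?_ ?_).symm
  · rintro ⟨u, h⟩ ⟨u', h'⟩ e
    exact Prod.ext (funext fun x => congrFun e (.inl (.inl x)))
      (funext fun x => congrFun e (.inl (.inr (.inl x))))
  · intro s hs
    by_contra hne
    have hite : ∀ {p : Prop} [Decidable p] {x : ℝ}, (if p then x else 0) ≠ 0 → x ≠ 0 := by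
      intro p _ x h hx
      exact h (by rw [hx, ite_self])
    have hone : ∀ {p : Prop} [Decidable p], (if p then (1 : ℂ) else 0) ≠ 0 → p := by
      intro p _ h
      by_contra hp
      exact h (if_neg hp)
    have h0 := norm_ne_zero_iff.1 (ne_zero_pow two_ne_zero (hite hne))
    have h1 := left_ne_zero_of_mul h0
    have h2 := right_ne_zero_of_mul h0
    have h3 := right_ne_zero_of_mul h1
    have h4 := right_ne_zero_of_mul (left_ne_zero_of_mul h1)
    have k1 := hone (left_ne_zero_of_mul h2)
    have k2 := hone (right_ne_zero_of_mul h2)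
    have k3 := hone (left_ne_zero_of_mul h3)
    have k4 := hone (right_ne_zero_of_mul h3)
    have k5 := hone (right_ne_zero_of_mul h4)
    have k6 := hone (right_ne_zero_of_mul (left_ne_zero_of_mul h4))
    -- The second party reads copies of the flag and of the honest answer, which agree with the
    -- originals.
    have k7 : s (.inl (.inr (.inr (.inr (.inl ()))))) = s (.inl (.inl (.inr ()))) :=
      congrFun k6 (.inl ())
    have k8 : ∀ a, s (.inl (.inr (.inr (.inr (.inr a))))) =
      s (.inl (.inr (.inl (.inr (.inl (.inr a)))))) := fun a => congrFun k6 (.inr a)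
    refine hs ⟨⟨fun x => s (.inl (.inl x)), fun x => s (.inl (.inr (.inl x)))⟩, funext fun x => ?_⟩
    rcases x with (x | x | x | x | x) | (x | x | x) | (x | x | x)
    · rfl
    · rfl
    · exact (congrFun k5 x).symm
    · exact k7.symm
    · exact (k8 x).symm
    · rw [Subsingleton.elim x 0]; exact k3.symm
    · exact (congrFun k4 x).symm
    · exact x.elim
    · rw [Subsingleton.elim x 0]; exact k1.symm
    · refine Eq.trans ?_ (congrFun k2 x).symm
      change _ = if s (.inl (.inr (.inr (.inr (.inl ()))))) then _ else
        s (.inl (.inr (.inr (.inr (.inr x)))))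
      rw [k7, k8]
      rfl
    · exact x.elim
  · rintro ⟨u, h⟩
    have e1 : ∀ {p q : Prop} [Decidable p] [Decidable q] {x y : ℝ}, (p ↔ q) → x = y →
        (if p then x else 0) = if q then y else 0 := by
      intro p q _ _ x y h1 h2
      simp only [h1, h2]
    refine e1 Iff.rfl ?_
    have e2 : leaderRest i η (reductionFinal (C := C) (wC := wC) i c u h ∘ Sum.inl) = η h := by
      refine (congrArg₂ _ ((congrArg₂ _ rfl (if_pos ?_)).trans (mul_one _))
        (if_pos ?_)).trans (mul_one _)
      · funext x
        rcases x with x | x <;> rfl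
      · rfl
    have e3 : ∀ {p : Prop} [Decidable p] {z : ℂ}, p → z = 1 → (z * if p then 1 else 0) = 1 := by
      intro p _ z hp hz
      rw [if_pos hp, mul_one, hz]
    rw [← mul_pow, ← norm_mul]
    congr 2
    refine Eq.symm ((congrArg₂ _ ((congrArg₂ _ (congrArg₂ _ rfl e2) (e3 rfl (if_pos rfl))).trans
      (mul_one _)) (e3 rfl (if_pos rfl))).trans (mul_one _))

end Reduction

/-! ### The reduction as a player against the 1-of-2 puzzle -/

section Reduction

set_option linter.unusedSectionVars false
set_option synthInstance.maxSize 100000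
set_option synthInstance.maxHeartbeats 200000

variable {m : ℕ} {P Y B C A wA wB wC w wH : Type}

/-- The register that a local party of the reduction receives. -/
abbrev FollowerInput (m : ℕ) (B A wB : Type) : Type := Unit ⊕ (PartyWires m B A wB ⊕ A)

/-- The discarded wires of the first stage. -/
abbrev LeaderWork (m : ℕ) (P Y A wA w wH : Type) : Type :=
  ((Fin m × P) ⊕ ((Fin m × Y) ⊕ wA)) ⊕ (((VerifyWires P (Fin m × Y) (Fin m × A) w ⊕
    VerifyWires P (Fin m × Y) (Fin m × A) w) ⊕ Unit) ⊕ (P ⊕ (Y ⊕ wH)))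

/-- The wires of the first stage as input, output and work wires. -/
def leaderEquiv : LeaderWires m P Y B C A wA wB wC w wH ≃
    P ⊕ ((Y ⊕ (FollowerInput m B A wB ⊕ FollowerInput m C A wC)) ⊕
      LeaderWork m P Y A wA w wH) where
  toFun
    | .inl (.inl (.inl (.inl (.inl x)))) => .inr (.inr (.inl (.inl x)))
    | .inl (.inl (.inl (.inl (.inr (.inl (.inl x)))))) => .inr (.inr (.inl (.inr (.inl x))))
    | .inl (.inl (.inl (.inl (.inr (.inl (.inr (.inl x))))))) =>
        .inr (.inl (.inr (.inl (.inr (.inl (.inl (.inl x)))))))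
    | .inl (.inl (.inl (.inl (.inr (.inl (.inr (.inr x))))))) =>
        .inr (.inl (.inr (.inr (.inr (.inl (.inl (.inl x)))))))
    | .inl (.inl (.inl (.inl (.inr (.inr x))))) => .inr (.inr (.inl (.inr (.inr x))))
    | .inl (.inl (.inl (.inr (.inl (.inl x))))) =>
        .inr (.inl (.inr (.inl (.inr (.inl (.inl (.inr x)))))))
    | .inl (.inl (.inl (.inr (.inl (.inr x))))) =>
        .inr (.inl (.inr (.inl (.inr (.inl (.inr x))))))
    | .inl (.inl (.inl (.inr (.inr (.inl x))))) =>
        .inr (.inl (.inr (.inr (.inr (.inl (.inl (.inr x)))))))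
    | .inl (.inl (.inl (.inr (.inr (.inr x))))) =>
        .inr (.inl (.inr (.inr (.inr (.inl (.inr x))))))
    | .inl (.inl (.inr (.inl x))) => .inl x
    | .inl (.inl (.inr (.inr x))) => .inr (.inr (.inr (.inl x)))
    | .inl (.inr x) => .inr (.inl (.inr (.inl (.inl x))))
    | .inr (.inl (.inl x)) => .inr (.inr (.inr (.inr (.inl x))))
    | .inr (.inl (.inr (.inl (.inl x)))) => .inr (.inr (.inr (.inr (.inr (.inl x)))))
    | .inr (.inl (.inr (.inl (.inr x)))) => .inr (.inl (.inr (.inl (.inr (.inr x)))))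
    | .inr (.inl (.inr (.inr x))) => .inr (.inr (.inr (.inr (.inr (.inr x)))))
    | .inr (.inr (.inl x)) => .inr (.inl (.inl x))
    | .inr (.inr (.inr (.inl x))) => .inr (.inl (.inr (.inr (.inl x))))
    | .inr (.inr (.inr (.inr x))) => .inr (.inl (.inr (.inr (.inr (.inr x)))))
  invFun
    | .inr (.inr (.inl (.inl x))) => .inl (.inl (.inl (.inl (.inl x))))
    | .inr (.inr (.inl (.inr (.inl x)))) => .inl (.inl (.inl (.inl (.inr (.inl (.inl x))))))
    | .inr (.inl (.inr (.inl (.inr (.inl (.inl (.inl x))))))) =>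
        .inl (.inl (.inl (.inl (.inr (.inl (.inr (.inl x)))))))
    | .inr (.inl (.inr (.inr (.inr (.inl (.inl (.inl x))))))) =>
        .inl (.inl (.inl (.inl (.inr (.inl (.inr (.inr x)))))))
    | .inr (.inr (.inl (.inr (.inr x)))) => .inl (.inl (.inl (.inl (.inr (.inr x)))))
    | .inr (.inl (.inr (.inl (.inr (.inl (.inl (.inr x))))))) =>
        .inl (.inl (.inl (.inr (.inl (.inl x)))))
    | .inr (.inl (.inr (.inl (.inr (.inl (.inr x)))))) =>
        .inl (.inl (.inl (.inr (.inl (.inr x)))))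
    | .inr (.inl (.inr (.inr (.inr (.inl (.inl (.inr x))))))) =>
        .inl (.inl (.inl (.inr (.inr (.inl x)))))
    | .inr (.inl (.inr (.inr (.inr (.inl (.inr x)))))) =>
        .inl (.inl (.inl (.inr (.inr (.inr x)))))
    | .inl x => .inl (.inl (.inr (.inl x)))
    | .inr (.inr (.inr (.inl x))) => .inl (.inl (.inr (.inr x)))
    | .inr (.inl (.inr (.inl (.inl x)))) => .inl (.inr x)
    | .inr (.inr (.inr (.inr (.inl x)))) => .inr (.inl (.inl x))
    | .inr (.inr (.inr (.inr (.inr (.inl x))))) => .inr (.inl (.inr (.inl (.inl x))))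
    | .inr (.inl (.inr (.inl (.inr (.inr x))))) => .inr (.inl (.inr (.inl (.inr x))))
    | .inr (.inr (.inr (.inr (.inr (.inr x))))) => .inr (.inl (.inr (.inr x)))
    | .inr (.inl (.inl x)) => .inr (.inr (.inl x))
    | .inr (.inl (.inr (.inr (.inl x)))) => .inr (.inr (.inr (.inl x)))
    | .inr (.inl (.inr (.inr (.inr (.inr x))))) => .inr (.inr (.inr (.inr x)))
  left_inv := by
    rintro (((((x | (x | x | x) | x) | (x | x) | (x | x)) | (x | x)) | x) |
      (x | (x | x) | x) | (x | x | x)) <;> rfl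
  right_inv := by
    rintro (x | ((x | ((x | ((x | x) | x) | x) | (x | ((x | x) | x) | x))) |
      ((x | x | x) | (x | x | x | x)))) <;> rfl

/-- The wires of the reduction as the wires of a player. -/
def reductionEquiv : ReductionWires m P Y B C A wA wB wC w wH ≃
    PlayWires P Y (FollowerInput m B A wB) (FollowerInput m C A wC) (Fin 1) A
      (LeaderWork m P Y A wA w wH) Empty Empty :=
  Equiv.sumCongr leaderEquiv (Equiv.refl _)

variable [Fintype P] [DecidableEq P] [Fintype Y] [DecidableEq Y] [Fintype B] [DecidableEq B]
  [Fintype C] [DecidableEq C] [Fintype A] [DecidableEq A] [Fintype wA] [DecidableEq wA]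
  [Fintype wB] [DecidableEq wB] [Fintype wC] [DecidableEq wC] [Fintype w] [DecidableEq w]
  [Fintype wH] [DecidableEq wH]

/-- The first stage of the reduction as a circuit. -/
def leaderCircuit (gs : List (Gate (LeaderWires m P Y B C A wA wB wC w wH))) :
    QCircuit P (Y ⊕ (FollowerInput m B A wB ⊕ FollowerInput m C A wC)) where
  work := LeaderWork m P Y A wA w wH
  gates := gs.map (Gate.map leaderEquiv.toEmbedding)

/-- A local party of the reduction as a circuit. -/
def followerCircuit (gs : List (Gate (LocalWires m B A wB))) :
    QCircuit (FollowerInput m B A wB ⊕ Fin 1) A where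
  work := Empty
  gates := gs

/-- Only wires are renamed here; afterwards `sum_born_play` applies to the circuit analysed above.
-/
theorem playGates_reduction (gL : List (Gate (LeaderWires m P Y B C A wA wB wC w wH)))
    (gB : List (Gate (LocalWires m B A wB))) (gC : List (Gate (LocalWires m C A wC))) :
    playGates (gL.map (Gate.map leaderEquiv.toEmbedding)) gB gC =
      (gL.map (Gate.map Function.Embedding.inl) ++ gB.map (Gate.map firstParty) ++
        gC.map (Gate.map secondParty)).map (Gate.map reductionEquiv.toEmbedding) := by
  rw [playGates, List.map_append, List.map_append, map_gate_map, map_gate_map, map_gate_map,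
    map_gate_map]
  congr 1
  · congr 2
    congr 1
    refine DFunLike.ext _ _ ?_
    rintro (((x | x | x) | x) | (x | x))
    · rfl
    · rcases x with (x | x) | x | x <;> rfl
    · rfl
    · rfl
    · rfl
    · rfl
  · congr 2
    refine DFunLike.ext _ _ ?_
    rintro (((x | x | x) | x) | (x | x))
    · rfl
    · rcases x with (x | x) | x | x <;> rfl
    · rfl
    · rfl
    · rfl
    · rfl

theorem gateProd_map_equiv {ι κ : Type} [Fintype ι] [DecidableEq ι] [Fintype κ] [DecidableEq κ]
    (e : ι ≃ κ) (gs : List (Gate ι)) (t s : Bits κ) :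
    (gateProd (gs.map (Gate.map e.toEmbedding)) *ᵥ Pi.single t 1) s =
      (gateProd gs *ᵥ Pi.single (t ∘ e) 1) (s ∘ e) := by
  rw [map_mulVec]
  have : (fun u => (Pi.single t 1 : Bits κ → ℂ) (Function.extend e.toEmbedding u s)) =
      Pi.single (t ∘ e) 1 := by
    funext u
    rw [Pi.single_apply, Pi.single_apply]
    congr 1
    rw [eq_iff_iff]
    constructor
    · rintro rfl
      exact (extend_comp_embedding e.toEmbedding u s).symm
    · rintro rfl
      funext x
      obtain ⟨y, rfl⟩ := e.surjective x
      exact e.toEmbedding.injective.extend_apply _ _ y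
  rw [this]
  rfl

/-- The winning probability of the reduction on the challenge `c`. -/
theorem sum_born_reduction (i : Fin m) (q : Bits (Fin m × P))
    (gM : List (Gate (FlaggedWires m P Y B C A wA wB wC w)))
    (gH : List (Gate (P ⊕ ((Y ⊕ A) ⊕ wH)))) (b₀ b₁ : Bits (Fin m))
    (gB : List (Gate (PartyWires m B A wB))) (gC : List (Gate (PartyWires m C A wC)))
    (pk : Bits P) (c : Bool) (acc : Bits Y → Bits A → Bits A → Prop)
    [∀ y a a', Decidable (acc y a a')] :
    (∑ y, ∑ aB, ∑ aC, if acc y aB aC then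
      born (tensor (restrict ((followerCircuit (localGates i b₀ b₁ gB)).effect aB)
          (fun s => Sum.elim s fun _ => c))
        (restrict ((followerCircuit (localGates i b₀ b₁ gC)).effect aC)
          (fun s => Sum.elim s fun _ => c)))
        (postMeasure ((leaderCircuit (leaderGates i q gM gH)).output pk) y) else 0) =
    ∑ s : Bits (ReductionWires m P Y B C A wA wB wC w wH),
      if acc (fun y => s (.inl (.inr (.inr (.inl y))))) (fun j => s (.inr (.inl (.inr (.inl j)))))
        (fun j => s (.inr (.inr (.inr (.inl j))))) then
      ‖(gateProd (reductionGates i q gM gH b₀ b₁ gB gC) *ᵥ Pi.single (reductionInit pk c) 1) s‖ ^ 2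
      else 0 := by
  refine (sum_born_play _ _ _ pk (fun _ => c) acc).trans ?_
  refine Fintype.sum_equiv (Equiv.arrowCongr reductionEquiv (Equiv.refl Bool)).symm _ _ fun s => ?_
  have h1 : (gateProd (playGates ((leaderGates i q gM gH).map (Gate.map leaderEquiv.toEmbedding))
      (localGates i b₀ b₁ gB) (localGates i b₀ b₁ gC)) *ᵥ Pi.single (playInit pk fun _ => c) 1) s =
      (gateProd (reductionGates i q gM gH b₀ b₁ gB gC) *ᵥ Pi.single (reductionInit pk c) 1)
        (s ∘ reductionEquiv) := by
    rw [playGates_reduction, gateProd_map_equiv]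
    have : (playInit pk fun _ => c) ∘ reductionEquiv = (reductionInit pk c :
        Bits (ReductionWires m P Y B C A wA wB wC w wH)) := by
      funext x
      rcases x with (((((x | (x | x | x) | x) | (x | x) | (x | x)) | (x | x)) | x) |
        (x | (x | x) | x) | (x | x | x)) | (x | x) | (x | x) <;> rfl
    rw [this]
    rfl
  have e1 : ∀ {p p' : Prop} [Decidable p] [Decidable p'] {x y : ℝ}, (p ↔ p') → x = y →
      (if p then x else 0) = if p' then y else 0 := by
    intro p q _ _ x y h1 h2
    simp only [h1, h2]
  exact e1 Iff.rfl (congrArg (fun z : ℂ => ‖z‖ ^ 2) h1)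

end Reduction

/-! ### The winning probability of the reduction -/

section Reduction

set_option linter.unusedSectionVars false
set_option synthInstance.maxSize 100000
set_option synthInstance.maxHeartbeats 200000

variable {m : ℕ} {P Y B C A wA wB wC w wH : Type}
  [Fintype P] [DecidableEq P] [Fintype Y] [DecidableEq Y] [Fintype B] [DecidableEq B]
  [Fintype C] [DecidableEq C] [Fintype A] [DecidableEq A] [Fintype wA] [DecidableEq wA]
  [Fintype wB] [DecidableEq wB] [Fintype wC] [DecidableEq wC] [Fintype w] [DecidableEq w]
  [Fintype wH] [DecidableEq wH]

/-- The verification wires end in the known state `r`, so only the flag and the player's wires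
remain to be summed. -/
theorem sum_flagged {α ρ : Type} [Fintype α] [DecidableEq α] [Fintype ρ] [DecidableEq ρ]
    {H : Type} [Fintype H] (r : Bits ρ) (Ξ : Bool → Bits α → ℂ) (η : H → ℂ)
    (p : Bits ((α ⊕ ρ) ⊕ Unit) → H → Prop) [∀ u h, Decidable (p u h)] :
    (∑ u : Bits ((α ⊕ ρ) ⊕ Unit), ∑ h, if p u h then
      ‖Ξ (u (.inr ())) (fun x => u (.inl (.inl x))) *
        if (fun x => u (.inl (.inr x))) = r then 1 else 0‖ ^ 2 * ‖η h‖ ^ 2 else 0) =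
    ∑ f, ∑ a, ∑ h, if p (Sum.elim (Sum.elim a r) fun _ => f) h then
      ‖Ξ f a‖ ^ 2 * ‖η h‖ ^ 2 else 0 := by
  rw [← Fintype.sum_prod_type' (fun f a => ∑ h, if p (Sum.elim (Sum.elim a r) fun _ => f) h then
      ‖Ξ f a‖ ^ 2 * ‖η h‖ ^ 2 else 0)]
  refine (Fintype.sum_of_injective (fun x : Bool × Bits α => (Sum.elim (Sum.elim x.2 r)
    fun _ => x.1 : Bits ((α ⊕ ρ) ⊕ Unit))) ?_ _ _ ?_ ?_).symm
  · rintro ⟨f, a⟩ ⟨f', a'⟩ e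
    exact Prod.ext (congrFun e (.inr ())) (funext fun x => congrFun e (.inl (.inl x)))
  · intro u hu
    have : (fun x => u (.inl (.inr x))) ≠ r := by
      intro h
      refine hu ⟨(u (.inr ()), fun x => u (.inl (.inl x))), funext fun x => ?_⟩
      rcases x with (x | x) | x
      · rfl
      · exact (congrFun h x).symm
      · rfl
    simp [this]
  · rintro ⟨f, a⟩
    refine Finset.sum_congr rfl fun h _ => ?_
    simp

/-- The state of the player on the challenge `b`. -/
def roundState (gA : List (Gate ((Fin m × P) ⊕ (((Fin m × Y) ⊕ (B ⊕ C)) ⊕ wA))))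
    (b : Bits (Fin m)) (gB : List (Gate (PartyWires m B A wB)))
    (gC : List (Gate (PartyWires m C A wC))) (pk : Bits (Fin m × P)) :
    Bits (AdversaryWires m P Y B C A wA wB wC) → ℂ :=
  gateProd (gA.map (Gate.map Function.Embedding.inl) ++ roundGates b gB gC) *ᵥ
    Pi.single (Sum.elim (Sum.elim pk fun _ => false) fun _ => false) 1

/-- The probability that the player succeeds on `b₀` and, after undoing this, also on `b₁`. -/
def sequentialProb (gA : List (Gate ((Fin m × P) ⊕ (((Fin m × Y) ⊕ (B ⊕ C)) ⊕ wA))))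
    (b₀ b₁ : Bits (Fin m)) (gB : List (Gate (PartyWires m B A wB)))
    (gC : List (Gate (PartyWires m C A wC))) (pk : Bits (Fin m × P))
    (acc₀ acc₁ : Bits (Fin m × Y) → Bits (Fin m × A) → Bool) : ℝ :=
  ∑ a, if bothAccept acc₁ a = true then ‖(gateProd (roundGates b₁ gB gC) *ᵥ
    (gateProd (invGates (roundGates b₀ gB gC)) *ᵥ fun u =>
      if bothAccept acc₀ u = true then roundState gA b₀ gB gC pk u else 0)) a‖ ^ 2 else 0

theorem ite_le_ite_of_imp {p q : Prop} [Decidable p] [Decidable q] {x : ℝ} (hx : 0 ≤ x)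
    (h : p → q) : (if p then x else 0) ≤ if q then x else 0 := by
  by_cases hp : p
  · rw [if_pos hp, if_pos (h hp)]
  · rw [if_neg hp]
    split_ifs
    · exact hx
    · exact le_rfl

set_option maxHeartbeats 2000000 in
-- The heart of the reduction, for fixed keys. With p the weight of flag 1 and h the honest success
-- on the challenge 0, the right-hand side is at least p + (1 - p)h from `c = false` plus the
-- sequential probability from `c = true`, and p + (1 - p)h ≥ h because h ≤ 1.
theorem reduction_bound (i : Fin m) (q : Bits (Fin m × P))
    (gA : List (Gate ((Fin m × P) ⊕ (((Fin m × Y) ⊕ (B ⊕ C)) ⊕ wA))))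
    (D : List (Gate (VerifyWires P (Fin m × Y) (Fin m × A) w)))
    (gH : List (Gate (P ⊕ ((Y ⊕ A) ⊕ wH)))) (b₀ b₁ : Bits (Fin m))
    (gB : List (Gate (PartyWires m B A wB))) (gC : List (Gate (PartyWires m C A wC)))
    (pk : Bits P) (pks : Bits (Fin m × P))
    (hpks : (fun p => if p.1 = i then pk p.2 else q p) = pks)
    (acc₀ acc₁ : Bits (Fin m × Y) → Bits (Fin m × A) → Bool)
    (hD : ∀ y a s, gateProd D s (Sum.elim (Sum.elim pk (Sum.elim y a)) fun _ => false) ≠ 0 →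
      s (.inr (.inl ())) = acc₀ y a)
    (ver : Bool → Bits Y → Bits A → Bool)
    (h₀ : ∀ y a, acc₀ y a = true → ver false (block y i) (block a i) = true)
    (h₁ : ∀ y a, acc₁ y a = true → ver true (block y i) (block a i) = true) :
    (∑ h : Bits (P ⊕ ((Y ⊕ A) ⊕ wH)), if ver false (fun y => h (.inr (.inl (.inl y))))
        (fun a => h (.inr (.inl (.inr a)))) = true then
        ‖gateProd gH h (Sum.elim pk fun _ => false)‖ ^ 2 else 0) +
      sequentialProb gA b₀ b₁ gB gC pks acc₀ acc₁ ≤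
    ∑ c : Bool, ∑ y, ∑ aB, ∑ aC, if ver c y aB = true ∧ ver c y aC = true then
      born (tensor (restrict ((followerCircuit (localGates i b₀ b₁ gB)).effect aB)
          (fun s => Sum.elim s fun _ => c))
        (restrict ((followerCircuit (localGates i b₀ b₁ gC)).effect aC)
          (fun s => Sum.elim s fun _ => c)))
        (postMeasure ((leaderCircuit (leaderGates i q (recordGates gA b₀ gB gC D) gH)).output pk) y)
      else 0 := by
  subst hpks
  set φ := roundState gA b₀ gB gC (fun p => if p.1 = i then pk p.2 else q p) with hφ
  set U := gateProd (roundGates (P := P) (Y := Y) (wA := wA) b₀ gB gC) with hU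
  set η := gateProd gH *ᵥ (Pi.single (Sum.elim pk fun _ => false) 1 :
    Bits (P ⊕ ((Y ⊕ A) ⊕ wH)) → ℂ) with hη
  set Ξ : Bool → Bool → Bits (AdversaryWires m P Y B C A wA wB wC) → ℂ := fun c f =>
    gateProd (roundGates (if c then b₁ else b₀) gB gC) *ᵥ
      (gateProd (invGates (roundGates b₀ gB gC)) *ᵥ
        fun u => if f = bothAccept acc₀ u then φ u else 0) with hΞ
  set hon := ∑ h : Bits (P ⊕ ((Y ⊕ A) ⊕ wH)), if ver false (fun y => h (.inr (.inl (.inl y))))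
        (fun a => h (.inr (.inl (.inr a)))) = true then
        ‖gateProd gH h (Sum.elim pk fun _ => false)‖ ^ 2 else 0 with hhon
  have hηn : ∑ h, ‖η h‖ ^ 2 = 1 := by
    have := normSq_gateProd gH (Pi.single (Sum.elim pk fun _ => false) 1)
    rw [normSq_single] at this
    exact this
  have hηa : ∀ h, gateProd gH h (Sum.elim pk fun _ => false) = η h := by
    intro h
    rw [hη, Matrix.mulVec_single_one, Matrix.col_apply]
  have hφn : ∑ a, ‖φ a‖ ^ 2 = 1 := by
    have := normSq_gateProd (gA.map (Gate.map Function.Embedding.inl) ++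
      roundGates (P := P) (Y := Y) (wA := wA) b₀ gB gC)
      (Pi.single (Sum.elim (Sum.elim (fun p => if p.1 = i then pk p.2 else q p) fun _ => false)
        fun _ => false) 1)
    rw [normSq_single] at this
    exact this
  have hst : ∀ c : Bool, gateProd ((roundGates (if c then b₁ else b₀) gB gC).map
      (Gate.map adversary)) *ᵥ (gateProd (recordGates gA b₀ gB gC D) *ᵥ
        Pi.single (Sum.elim (Sum.elim (Sum.elim (Sum.elim
          (fun p => if p.1 = i then pk p.2 else q p) fun _ => false) fun _ => false)
            (Sum.elim pk fun _ => false)) fun _ => false) 1) =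
      fun s => Ξ c (s (.inr ())) (fun i => s (.inl (.inl i))) *
        if (fun i => s (.inl (.inr i))) = (Sum.elim pk fun _ => false : Bits _) then 1 else 0 := by
    intro c
    rw [recordGates_mulVec gA b₀ gB gC D pk acc₀ hD]
    exact adversary_mulVec _ (fun f => gateProd (invGates (roundGates b₀ gB gC)) *ᵥ fun u =>
        if f = bothAccept acc₀ u then φ u else 0)
        (fun r => if r = (Sum.elim pk fun _ => false : Bits _) then (1 : ℂ) else 0)
  -- On the challenge 0 the round that is run again is exactly the one that was undone, so the
  -- recorded component reappears unchanged.
  have hΞf : ∀ f a, Ξ false f a = if f = bothAccept acc₀ a then φ a else 0 := by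
    intro f a
    simp only [hΞ, Bool.false_eq_true, if_false]
    rw [Matrix.mulVec_mulVec, gateProd_invGates, gateProd_mul_conjTranspose_self,
      Matrix.one_mulVec]
  have hwin : ∀ c, (∑ y, ∑ aB, ∑ aC, if ver c y aB = true ∧ ver c y aC = true then
      born (tensor (restrict ((followerCircuit (localGates i b₀ b₁ gB)).effect aB)
          (fun s => Sum.elim s fun _ => c))
        (restrict ((followerCircuit (localGates i b₀ b₁ gC)).effect aC)
          (fun s => Sum.elim s fun _ => c)))
        (postMeasure ((leaderCircuit (leaderGates i q (recordGates gA b₀ gB gC D) gH)).output pk) y)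
      else 0) = ∑ f : Bool, ∑ a : Bits (AdversaryWires m P Y B C A wA wB wC),
        ∑ h : Bits (P ⊕ ((Y ⊕ A) ⊕ wH)),
        if ver c (fun y => if f then a (.inl (.inr (.inl (.inl (i, y)))))
            else h (.inr (.inl (.inl y))))
          (fun j => if f then a (.inr (.inl (.inr (.inl (i, j))))) else h (.inr (.inl (.inr j))))
            = true ∧
          ver c (fun y => if f then a (.inl (.inr (.inl (.inl (i, y)))))
            else h (.inr (.inl (.inl y))))
          (fun j => if f then a (.inr (.inr (.inr (.inl (i, j))))) else h (.inr (.inl (.inr j))))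
            = true
        then ‖Ξ c f a‖ ^ 2 * ‖η h‖ ^ 2 else 0 := by
    intro c
    refine (sum_born_reduction i q (recordGates gA b₀ gB gC D) gH b₀ b₁ gB gC pk c
      (fun y a a' => ver c y a = true ∧ ver c y a' = true)).trans ?_
    rw [reductionGates_mulVec, hst]
    refine (sum_reduction i c (fun s => Ξ c (s (.inr ())) (fun i => s (.inl (.inl i))) *
        if (fun i => s (.inl (.inr i))) = (Sum.elim pk fun _ => false : Bits _) then 1 else 0)
      η (fun y a a' => ver c y a = true ∧ ver c y a' = true)).trans ?_
    exact sum_flagged (Sum.elim pk fun _ => false) (Ξ c) η fun u h =>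
      ver c (fun y => if u (.inr ()) then u (.inl (.inl (.inl (.inr (.inl (.inl (i, y)))))))
          else h (.inr (.inl (.inl y))))
        (fun j => if u (.inr ()) then u (.inl (.inl (.inr (.inl (.inr (.inl (i, j)))))))
          else h (.inr (.inl (.inr j)))) = true ∧
      ver c (fun y => if u (.inr ()) then u (.inl (.inl (.inl (.inr (.inl (.inl (i, y)))))))
          else h (.inr (.inl (.inl y))))
        (fun j => if u (.inr ()) then u (.inl (.inl (.inr (.inr (.inr (.inl (i, j)))))))
          else h (.inr (.inl (.inr j)))) = true
  simp only [hwin]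
  rw [Fintype.sum_bool, Fintype.sum_bool, Fintype.sum_bool]
  -- When the flag is set, the honest wires do not affect the verdict and their total weight is 1.
  have hsum : ∀ (x : Bits (AdversaryWires m P Y B C A wA wB wC) → ℝ)
      (p : Bits (AdversaryWires m P Y B C A wA wB wC) → Prop) [∀ a, Decidable (p a)],
      (∑ a, ∑ h, if p a then x a * ‖η h‖ ^ 2 else 0) = ∑ a, if p a then x a else 0 := by
    intro x p _
    refine Finset.sum_congr rfl fun a _ => ?_
    by_cases hp : p a
    · simp only [hp, if_true]
      rw [← Finset.mul_sum, hηn, mul_one]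
    · simp [hp]
  -- Challenge 1, flag set: joint acceptance of all copies on b₁ implies acceptance of copy `i`.
  have hq : sequentialProb gA b₀ b₁ gB gC (fun p => if p.1 = i then pk p.2 else q p) acc₀ acc₁ ≤
      ∑ a : Bits (AdversaryWires m P Y B C A wA wB wC), ∑ h : Bits (P ⊕ ((Y ⊕ A) ⊕ wH)),
        if ver true (fun y => if true then a (.inl (.inr (.inl (.inl (i, y)))))
            else h (.inr (.inl (.inl y))))
          (fun j => if true then a (.inr (.inl (.inr (.inl (i, j))))) else h (.inr (.inl (.inr j))))
            = true ∧
          ver true (fun y => if true then a (.inl (.inr (.inl (.inl (i, y)))))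
            else h (.inr (.inl (.inl y))))
          (fun j => if true then a (.inr (.inr (.inr (.inl (i, j))))) else h (.inr (.inl (.inr j))))
            = true
        then ‖Ξ true true a‖ ^ 2 * ‖η h‖ ^ 2 else 0 := by
    simp only [if_true]
    rw [hsum (fun a => ‖Ξ true true a‖ ^ 2)]
    refine Finset.sum_le_sum fun a _ => ?_
    have e1 : (fun u => if true = bothAccept acc₀ u then φ u else 0) =
        fun u => if bothAccept acc₀ u = true then φ u else 0 := by
      funext u
      cases bothAccept acc₀ u <;> rfl
    have e2 : Ξ true true = gateProd (roundGates b₁ gB gC) *ᵥ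
        (gateProd (invGates (roundGates b₀ gB gC)) *ᵥ
          fun u => if bothAccept acc₀ u = true then φ u else 0) := by
      simp only [hΞ, if_true, e1]
    rw [e2]
    refine ite_le_ite_of_imp (sq_nonneg _) fun h => ?_
    rw [bothAccept, Bool.and_eq_true] at h
    exact ⟨h₁ _ _ h.1, h₁ _ _ h.2⟩
  -- Challenge 0, flag set: the reproduced component lies entirely in the accepted subspace, so the
  -- win is certain.
  have hp : (∑ a, if bothAccept acc₀ a = true then ‖φ a‖ ^ 2 else 0) ≤
      ∑ a : Bits (AdversaryWires m P Y B C A wA wB wC), ∑ h : Bits (P ⊕ ((Y ⊕ A) ⊕ wH)),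
        if ver false (fun y => if true then a (.inl (.inr (.inl (.inl (i, y)))))
            else h (.inr (.inl (.inl y))))
          (fun j => if true then a (.inr (.inl (.inr (.inl (i, j))))) else h (.inr (.inl (.inr j))))
            = true ∧
          ver false (fun y => if true then a (.inl (.inr (.inl (.inl (i, y)))))
            else h (.inr (.inl (.inl y))))
          (fun j => if true then a (.inr (.inr (.inr (.inl (i, j))))) else h (.inr (.inl (.inr j))))
            = true
        then ‖Ξ false true a‖ ^ 2 * ‖η h‖ ^ 2 else 0 := by
    simp only [if_true]
    rw [hsum (fun a => ‖Ξ false true a‖ ^ 2)]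
    refine Finset.sum_le_sum fun a _ => ?_
    rw [hΞf]
    by_cases h : bothAccept acc₀ a = true
    · rw [if_pos h, if_pos h.symm]
      rw [bothAccept, Bool.and_eq_true] at h
      exact (if_pos ⟨h₀ _ _ h.1, h₀ _ _ h.2⟩).ge
    · rw [if_neg h]
      split_ifs <;> positivity
  -- Challenge 0, flag not set: both parties return the same honest answer, so the two verdicts
  -- coincide and the weights multiply.
  have hn : (∑ a, if bothAccept acc₀ a = true then 0 else ‖φ a‖ ^ 2) * hon =
      ∑ a : Bits (AdversaryWires m P Y B C A wA wB wC), ∑ h : Bits (P ⊕ ((Y ⊕ A) ⊕ wH)),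
        if ver false (fun y => if false then a (.inl (.inr (.inl (.inl (i, y)))))
            else h (.inr (.inl (.inl y))))
          (fun j => if false then a (.inr (.inl (.inr (.inl (i, j)))))
            else h (.inr (.inl (.inr j)))) = true ∧
          ver false (fun y => if false then a (.inl (.inr (.inl (.inl (i, y)))))
            else h (.inr (.inl (.inl y))))
          (fun j => if false then a (.inr (.inr (.inr (.inl (i, j)))))
            else h (.inr (.inl (.inr j)))) = true
        then ‖Ξ false false a‖ ^ 2 * ‖η h‖ ^ 2 else 0 := by
    simp only [Bool.false_eq_true, if_false, and_self]
    rw [Finset.sum_mul]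
    refine Finset.sum_congr rfl fun a _ => ?_
    rw [hhon, Finset.mul_sum]
    refine Finset.sum_congr rfl fun h _ => ?_
    rw [hΞf, hηa]
    cases bothAccept acc₀ a <;> simp
  have hle : hon ≤ 1 := by
    rw [← hηn, hhon]
    refine Finset.sum_le_sum fun h _ => ?_
    rw [hηa]
    split_ifs
    · exact le_rfl
    · positivity
  have hpn : (∑ a, if bothAccept acc₀ a = true then 0 else ‖φ a‖ ^ 2) =
      1 - ∑ a, if bothAccept acc₀ a = true then ‖φ a‖ ^ 2 else 0 := by
    rw [eq_sub_iff_add_eq, ← Finset.sum_add_distrib, ← hφn]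
    refine Finset.sum_congr rfl fun a _ => ?_
    split_ifs <;> simp
  have hp0 : 0 ≤ ∑ a, if bothAccept acc₀ a = true then ‖φ a‖ ^ 2 else 0 :=
    Finset.sum_nonneg fun a _ => by split_ifs <;> positivity
  -- Challenge 1, flag not set: nothing is claimed beyond nonnegativity, since the honest answer
  -- belongs to the challenge 0.
  have hr : 0 ≤ ∑ a : Bits (AdversaryWires m P Y B C A wA wB wC),
      ∑ h : Bits (P ⊕ ((Y ⊕ A) ⊕ wH)),
        if ver true (fun y => if false then a (.inl (.inr (.inl (.inl (i, y)))))
            else h (.inr (.inl (.inl y))))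
          (fun j => if false then a (.inr (.inl (.inr (.inl (i, j)))))
            else h (.inr (.inl (.inr j)))) = true ∧
          ver true (fun y => if false then a (.inl (.inr (.inl (.inl (i, y)))))
            else h (.inr (.inl (.inl y))))
          (fun j => if false then a (.inr (.inr (.inr (.inl (i, j)))))
            else h (.inr (.inl (.inr j)))) = true
        then ‖Ξ true false a‖ ^ 2 * ‖η h‖ ^ 2 else 0 :=
    Finset.sum_nonneg fun a _ => Finset.sum_nonneg fun h _ => by split_ifs <;> positivity
  rw [hpn] at hn
  have h1 := mul_nonneg hp0 (sub_nonneg.2 hle)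
  have h2 := add_le_add (add_le_add hq hr) (add_le_add hp hn.le)
  refine le_trans ?_ h2
  linarith

end Reduction

/-! ### Circuits with a deterministic output -/

/-- The diagonal entry is the total weight of the final basis states that show `o`. All weights add
up to 1, so the basis states that show anything else have weight 0. -/
theorem QCircuit.eq_of_output_eq_one {ι ο : Type} [Fintype ι] [DecidableEq ι] [Fintype ο]
    [DecidableEq ο] (V : QCircuit ι ο) (x : Bits ι) (o : Bits ο) (h : V.output x o o = 1)
    (s : Bits (ι ⊕ (ο ⊕ V.work)))
    (hs : gateProd V.gates s (Sum.elim x fun _ => false) ≠ 0) (j : ο) : s (.inr (.inl j)) = o j := by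
  have h1 : ∑ u : Bits ι × Bits V.work,
      ‖gateProd V.gates (Sum.elim u.1 (Sum.elim o u.2)) (Sum.elim x fun _ => false)‖ ^ 2 = 1 := by
    have e : ∀ z : ℂ, z * star z = ((‖z‖ ^ 2 : ℝ) : ℂ) := fun z => by
      rw [Complex.star_def, Complex.mul_conj']
      push_cast
      rfl
    rw [V.output_apply] at h
    simp only [e, ← Complex.ofReal_sum] at h
    exact_mod_cast h
  have h2 := sum_normSq_gateProd V.gates (Sum.elim x fun _ => false)
  have h3 : ∑ u : Bits ι × Bits V.work,
      ‖gateProd V.gates (Sum.elim u.1 (Sum.elim o u.2)) (Sum.elim x fun _ => false)‖ ^ 2 =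
      ∑ s : Bits (ι ⊕ (ο ⊕ V.work)), if ∀ j, s (.inr (.inl j)) = o j then
        ‖gateProd V.gates s (Sum.elim x fun _ => false)‖ ^ 2 else 0 := by
    refine Fintype.sum_of_injective (fun u => Sum.elim u.1 (Sum.elim o u.2)) ?_ _ _ ?_ ?_
    · rintro ⟨u1, u2⟩ ⟨u1', u2'⟩ e
      exact Prod.ext (funext fun i => congrFun e (.inl i))
        (funext fun i => congrFun e (.inr (.inr i)))
    · intro s hs
      refine if_neg fun hj => hs ⟨(fun i => s (.inl i), fun i => s (.inr (.inr i))), ?_⟩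
      funext w
      rcases w with w | w | w
      · rfl
      · exact (hj w).symm
      · rfl
    · intro u
      exact (if_pos fun _ => rfl).symm
  have h4 := (Finset.sum_eq_sum_iff_of_le (s := Finset.univ)
    (f := fun s : Bits (ι ⊕ (ο ⊕ V.work)) => if ∀ j, s (.inr (.inl j)) = o j then
        ‖gateProd V.gates s (Sum.elim x fun _ => false)‖ ^ 2 else 0)
    (g := fun s => ‖gateProd V.gates s (Sum.elim x fun _ => false)‖ ^ 2) (fun s _ => by
      split_ifs
      · exact le_rfl
      · positivity)).1 (h3.symm.trans (h1.trans h2.symm)) s (Finset.mem_univ s)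
  by_contra hj
  rw [if_neg fun h' => hj (h' j)] at h4
  exact hs (norm_eq_zero.1 (pow_eq_zero_iff two_ne_zero |>.1 h4.symm))

/-! ### One round with the challenge written by the local parties -/

section Round

set_option linter.unusedSectionVars false
set_option synthInstance.maxSize 100000
set_option synthInstance.maxHeartbeats 200000

variable {m : ℕ} {P Y B C A wA wB wC : Type}
  [Fintype P] [DecidableEq P] [Fintype Y] [DecidableEq Y] [Fintype B] [DecidableEq B]
  [Fintype C] [DecidableEq C] [Fintype A] [DecidableEq A] [Fintype wA] [DecidableEq wA]
  [Fintype wB] [DecidableEq wB] [Fintype wC] [DecidableEq wC]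

set_option maxHeartbeats 2000000 in
-- Writing the challenge by gates just before each party runs agrees with starting from it: these
-- gates commute with `𝒜` and with the other party. In the first form only the local parties depend
-- on the challenge, as undoing a round requires.
theorem roundState_eq_play (gA : List (Gate ((Fin m × P) ⊕ (((Fin m × Y) ⊕ (B ⊕ C)) ⊕ wA))))
    (b : Bits (Fin m)) (gB : List (Gate (PartyWires m B A wB)))
    (gC : List (Gate (PartyWires m C A wC))) (pk : Bits (Fin m × P)) :
    roundState gA b gB gC pk = gateProd (playGates gA gB gC) *ᵥ Pi.single (playInit pk b) 1 := by
  set X : List (Gate (Fin m)) := (constLayer (Function.Embedding.refl (Fin m)) b).map Gate.rev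
    with hX
  set kB : Fin m ↪ AdversaryWires m P Y B C A wA wB wC := partyChallenge.trans bobWires with hkB
  set kC : Fin m ↪ AdversaryWires m P Y B C A wA wB wC := partyChallenge.trans charlieWires with hkC
  have hXp : ∀ {B' wB' : Type}, (constLayer (partyChallenge (m := m) (B := B') (A := A)
      (wB := wB')) b).map Gate.rev = X.map (Gate.map partyChallenge) := by
    intro B' wB'
    rw [hX, map_rev_map, constLayer_map]
    rfl
  have hsplit : ∀ (f : PartyWires m B A wB ↪ AdversaryWires m P Y B C A wA wB wC),
      (partyGates b gB).map (Gate.map f) =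
        X.map (Gate.map (partyChallenge.trans f)) ++ gB.map (Gate.map f) := by
    intro f
    rw [partyGates, hXp, List.map_append, map_gate_map]
  have hsplit' : ∀ (f : PartyWires m C A wC ↪ AdversaryWires m P Y B C A wA wB wC),
      (partyGates b gC).map (Gate.map f) =
        X.map (Gate.map (partyChallenge.trans f)) ++ gC.map (Gate.map f) := by
    intro f
    rw [partyGates, hXp, List.map_append, map_gate_map]
  have c1 := gateProd_map_commute kC (bobWires : _ ↪ AdversaryWires m P Y B C A wA wB wC)
    (fun i j h => bobWires_ne_charlieWires j (partyChallenge i) h.symm) X gB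
  have c2 := gateProd_map_commute kB (Function.Embedding.inl :
    _ ↪ AdversaryWires m P Y B C A wA wB wC) (fun i j h => by cases h) X gA
  have c3 := gateProd_map_commute kC (Function.Embedding.inl :
    _ ↪ AdversaryWires m P Y B C A wA wB wC) (fun i j h => by cases h) X gA
  have hinit : gateProd (X.map (Gate.map kC)) *ᵥ (gateProd (X.map (Gate.map kB)) *ᵥ
      Pi.single (Sum.elim (Sum.elim pk fun _ => false) fun _ => false) 1) =
      (Pi.single (playInit pk b) 1 : Bits (AdversaryWires m P Y B C A wA wB wC) → ℂ) := by
    rw [hX, map_rev_map, map_rev_map, constLayer_map, constLayer_map, gateProd_rev_single,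
      gateProd_rev_single, actList_constLayer, actList_constLayer]
    congr 1
    have hk : ∀ (u : Bits (Fin m)) (t : Bits (AdversaryWires m P Y B C A wA wB wC)) x,
        (∀ y, ((Function.Embedding.refl _).trans kB) y ≠ x) →
          Function.extend ((Function.Embedding.refl _).trans kB) u t x = t x :=
      fun u t x hx => Function.extend_apply' _ _ _ (by rintro ⟨y, hy⟩; exact hx y hy)
    have hc : ∀ (u : Bits (Fin m)) (t : Bits (AdversaryWires m P Y B C A wA wB wC)) x,
        (∀ y, ((Function.Embedding.refl _).trans kC) y ≠ x) →
          Function.extend ((Function.Embedding.refl _).trans kC) u t x = t x :=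
      fun u t x hx => Function.extend_apply' _ _ _ (by rintro ⟨y, hy⟩; exact hx y hy)
    funext x
    rcases x with x | (x | x) | x | x
    · exact (hc _ _ _ (fun y h => by cases h)).trans (hk _ _ _ (fun y h => by cases h))
    · exact (hc _ _ _ (fun y h => by cases h)).trans
        ((((Function.Embedding.refl _).trans kB).injective.extend_apply _ _ x).trans
          (Bool.false_xor _))
    · exact (hc _ _ _ (fun y h => by cases h)).trans (hk _ _ _ (fun y h => by cases h))
    · refine (((Function.Embedding.refl _).trans kC).injective.extend_apply _ _ x).trans ?_
      rw [hk _ _ _ (fun y h => by cases h)]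
      exact Bool.false_xor _
    · exact (hc _ _ _ (fun y h => by cases h)).trans (hk _ _ _ (fun y h => by cases h))
  rw [roundState, roundGates, hsplit, hsplit', playGates, ← hinit]
  simp only [gateProd_append, Matrix.mulVec_mulVec]
  congr 1
  simp only [Matrix.mul_assoc]
  congr 1
  rw [← Matrix.mul_assoc, c1, Matrix.mul_assoc]
  congr 1
  rw [c2, ← Matrix.mul_assoc, c3, Matrix.mul_assoc]

end Round

/-! ### Almost orthogonal projections -/

/-- If a unit vector has average squared overlap `X` with `N` projections whose images of the
vector are almost orthogonal, then `X` is not much larger than `1 / N`. -/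
theorem sq_expect_le_of_inner_le {E ι : Type*} [NormedAddCommGroup E] [InnerProductSpace ℂ E]
    [Fintype ι] [DecidableEq ι] [Nonempty ι] (ψ : E) (hψ : ‖ψ‖ = 1) (v : ι → E) (p : ι → ℝ)
    (hp : ∀ b, inner ℂ ψ (v b) = (p b : ℂ)) (hv : ∀ b, ‖v b‖ ^ 2 = p b) :
    (𝔼 b, p b) ^ 2 ≤ (𝔼 b, p b) / Fintype.card ι +
      𝔼 b, 𝔼 b', if b = b' then 0 else ‖inner ℂ (v b) (v b')‖ := by
  set N : ℝ := ((Fintype.card ι : ℕ) : ℝ) with hN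
  have hN0 : 0 < N := by
    rw [hN]
    exact_mod_cast Fintype.card_pos
  have hp0 : ∀ b, 0 ≤ p b := fun b => by rw [← hv]; positivity
  -- Expand the square; the diagonal gives the `p b`, and the other terms are bounded by their
  -- absolute values.
  have h1 : ‖∑ b, v b‖ ^ 2 ≤ ∑ b, p b + ∑ b, ∑ b', if b = b' then 0 else
      ‖inner ℂ (v b) (v b')‖ := by
    have e1 : ‖∑ b, v b‖ ^ 2 = ‖inner ℂ (∑ b, v b) (∑ b, v b)‖ := by
      rw [inner_self_eq_norm_sq_to_K]
      simp
    rw [e1, sum_inner, ← Finset.sum_add_distrib]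
    simp only [inner_sum]
    refine (norm_sum_le _ _).trans (Finset.sum_le_sum fun b _ => (norm_sum_le _ _).trans ?_)
    rw [← Finset.add_sum_erase _ _ (Finset.mem_univ b),
      ← Finset.add_sum_erase _ (fun b' => if b = b' then 0 else ‖inner ℂ (v b) (v b')‖)
        (Finset.mem_univ b), if_pos rfl, zero_add]
    refine add_le_add ?_ (Finset.sum_le_sum fun b' hb' => ?_)
    · rw [inner_self_eq_norm_sq_to_K, ← hv]
      simp
    · rw [if_neg (Finset.ne_of_mem_erase hb').symm]
  -- Cauchy–Schwarz with the unit vector `ψ`.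
  have h2 : ∑ b, p b ≤ ‖∑ b, v b‖ := by
    have e1 : inner ℂ ψ (∑ b, v b) = ((∑ b, p b : ℝ) : ℂ) := by
      rw [inner_sum]
      simp [hp]
    have e2 := norm_inner_le_norm (𝕜 := ℂ) ψ (∑ b, v b)
    rw [e1, hψ, one_mul, Complex.norm_real] at e2
    exact (le_abs_self _).trans e2
  have h3 := (pow_le_pow_left₀ (Finset.sum_nonneg fun b _ => hp0 b) h2 2).trans h1
  simp only [Fintype.expect_eq_sum_div_card, ← hN, ← Finset.sum_div]
  rw [div_pow, div_div, div_div, ← add_div, ← pow_two]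
  exact div_le_div_of_nonneg_right h3 (by positivity)

/-- If X exceeded a + √d, then X(X - a) ≥ (X - a)² > d, against the hypothesis. -/
theorem le_add_sqrt_of_sq_le {X a d : ℝ} (ha : 0 ≤ a) (hd : 0 ≤ d)
    (h : X ^ 2 ≤ X * a + d) : X ≤ a + √d := by
  by_contra hlt
  rw [not_le] at hlt
  have h1 : √d < X - a := by linarith
  have h2 : d < (X - a) ^ 2 := by
    rw [← Real.sq_sqrt hd]
    exact pow_lt_pow_left₀ h1 (Real.sqrt_nonneg d) two_ne_zero
  nlinarith [Real.sqrt_nonneg d]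

/-! ### Sequential success implies the bound on the winning probability -/

section Overlap

variable {ι β : Type} [Fintype ι] [DecidableEq ι] [Fintype β] [DecidableEq β] [Nonempty β]

/-- Cauchy–Schwarz in which only the coordinates of `x` selected by `p` count; with `p` as
acceptance, the first factor becomes the square root of a sequential success probability. -/
theorem norm_star_dotProduct_le {ι : Type} [Fintype ι] (x y : ι → ℂ) (p : ι → Prop)
    [DecidablePred p] : ‖star x ⬝ᵥ fun s => if p s then y s else 0‖ ≤
      √(∑ s, if p s then ‖x s‖ ^ 2 else 0) * √(∑ s, ‖y s‖ ^ 2) := by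
  have h1 : ‖star x ⬝ᵥ fun s => if p s then y s else 0‖ ≤
      ∑ s, (if p s then ‖x s‖ else 0) * ‖y s‖ := by
    refine (norm_sum_le _ _).trans (Finset.sum_le_sum fun s _ => ?_)
    by_cases h : p s <;> simp [h]
  refine h1.trans ((Real.sum_mul_le_sqrt_mul_sqrt _ _ _).trans_eq ?_)
  congr 2
  refine Finset.sum_congr rfl fun s _ => ?_
  split_ifs <;> simp

/-- An instance of `sq_expect_le_of_inner_le` for the vectors v_b = U_b† P_b U_b ψ. The overlap of
v_b and v_b' is at most the norm of P_b' U_b' v_b, whose square is q(b, b'). -/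
theorem sq_expect_gateProd_le (gs : β → List (Gate ι)) (ψ : Bits ι → ℂ) (hψ : normSq ψ = 1)
    (acc : β → Bits ι → Bool) (p : β → ℝ)
    (hp : ∀ b, p b = ∑ s, if acc b s = true then ‖(gateProd (gs b) *ᵥ ψ) s‖ ^ 2 else 0)
    (q : β → β → ℝ)
    (hq : ∀ b b', q b b' = ∑ s, if acc b' s = true then
      ‖(gateProd (gs b') *ᵥ (gateProd (invGates (gs b)) *ᵥ fun u =>
        if acc b u = true then (gateProd (gs b) *ᵥ ψ) u else 0)) s‖ ^ 2 else 0) :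
    (𝔼 b, p b) ^ 2 ≤ (𝔼 b, p b) / Fintype.card β +
      𝔼 b, 𝔼 b', if b = b' then 0 else √(min (q b b') (q b' b)) := by
  set φ : β → Bits ι → ℂ := fun b => gateProd (gs b) *ᵥ ψ with hφ
  set w : β → Bits ι → ℂ := fun b u => if acc b u = true then φ b u else 0 with hw
  set v : β → Bits ι → ℂ := fun b => gateProd (invGates (gs b)) *ᵥ w b with hv
  have hin : ∀ x y : Bits ι → ℂ, inner ℂ (WithLp.toLp 2 x : EuclideanSpace ℂ (Bits ι))
      (WithLp.toLp 2 y) = star x ⬝ᵥ y := fun x y => by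
    rw [EuclideanSpace.inner_eq_star_dotProduct, dotProduct_comm]
  have hnorm : ∀ x : Bits ι → ℂ, ‖(WithLp.toLp 2 x : EuclideanSpace ℂ (Bits ι))‖ ^ 2 = normSq x :=
    fun x => by rw [EuclideanSpace.norm_sq_eq]; rfl
  have hφ1 : ∀ b, normSq (φ b) = 1 := fun b => (normSq_gateProd _ _).trans hψ
  -- The inverse circuit is the adjoint and moves to the other side of the inner product.
  have hmove : ∀ (b : β) (x : Bits ι → ℂ), star x ⬝ᵥ v b = star (gateProd (gs b) *ᵥ x) ⬝ᵥ w b := by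
    intro b x
    simp only [hv]
    rw [gateProd_invGates, Matrix.star_mulVec, Matrix.dotProduct_mulVec]
  have hpw : ∀ b, normSq (w b) = p b := by
    intro b
    rw [hp]
    refine Finset.sum_congr rfl fun s _ => ?_
    simp only [hw]
    split_ifs <;> simp [hφ]
  have hle : ∀ b b', ‖star (v b) ⬝ᵥ v b'‖ ≤ √(q b b') := by
    intro b b'
    rw [hmove]
    refine (norm_star_dotProduct_le _ _ _).trans_eq ?_
    have h1 : ∑ s, ‖φ b' s‖ ^ 2 = 1 := hφ1 b'
    rw [h1, Real.sqrt_one, mul_one, hq]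
  have key := sq_expect_le_of_inner_le (WithLp.toLp 2 ψ : EuclideanSpace ℂ (Bits ι))
    (by
      have := hnorm ψ
      rw [hψ] at this
      nlinarith [norm_nonneg (WithLp.toLp 2 ψ : EuclideanSpace ℂ (Bits ι))])
    (fun b => WithLp.toLp 2 (v b)) p
    (fun b => by
      rw [hin, hmove, ← hpw, normSq_eq_re]
      simp only [dotProduct, Pi.star_apply]
      refine Finset.sum_congr rfl fun s _ => ?_
      by_cases h : acc b s = true
      · simp [hw, h, hφ]
      · simp [hw, h])
    (fun b => by rw [hnorm, hv, normSq_gateProd, hpw])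
  refine key.trans (add_le_add le_rfl ?_)
  refine Finset.expect_le_expect fun b _ => Finset.expect_le_expect fun b' _ => ?_
  split_ifs
  · exact le_rfl
  · rw [hin]
    -- The overlap is conjugate symmetric, so either order of the two challenges gives a bound. The
    -- minimum allows the convenient order to be chosen later, separately for each pair.
    rcases min_choice (q b b') (q b' b) with h | h
    · rw [h]
      exact hle b b'
    · rw [h, Matrix.star_dotProduct, norm_star]
      exact hle b' b

end Overlap

/-! ### Winning probability for fixed keys against sequential success -/

section Round

set_option linter.unusedSectionVars false
set_option synthInstance.maxSize 100000
set_option synthInstance.maxHeartbeats 200000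

variable {m : ℕ} {P Y B C A wA wB wC : Type}
  [Fintype P] [DecidableEq P] [Fintype Y] [DecidableEq Y] [Fintype B] [DecidableEq B]
  [Fintype C] [DecidableEq C] [Fintype A] [DecidableEq A] [Fintype wA] [DecidableEq wA]
  [Fintype wB] [DecidableEq wB] [Fintype wC] [DecidableEq wC]

/-- The winning probability on the challenge `b`. -/
def roundProb (gA : List (Gate ((Fin m × P) ⊕ (((Fin m × Y) ⊕ (B ⊕ C)) ⊕ wA))))
    (b : Bits (Fin m)) (gB : List (Gate (PartyWires m B A wB)))
    (gC : List (Gate (PartyWires m C A wC))) (pk : Bits (Fin m × P))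
    (acc : Bits (Fin m × Y) → Bits (Fin m × A) → Bool) : ℝ :=
  ∑ a, if bothAccept acc a = true then ‖roundState gA b gB gC pk a‖ ^ 2 else 0

/-- The state prepared by `𝒜` does not depend on the challenge and is the common vector ψ for all
rounds. -/
theorem sq_expect_roundProb_le
    (gA : List (Gate ((Fin m × P) ⊕ (((Fin m × Y) ⊕ (B ⊕ C)) ⊕ wA))))
    (gB : List (Gate (PartyWires m B A wB)))
    (gC : List (Gate (PartyWires m C A wC))) (pk : Bits (Fin m × P))
    (acc : Bits (Fin m) → Bits (Fin m × Y) → Bits (Fin m × A) → Bool) :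
    (𝔼 b, roundProb gA b gB gC pk (acc b)) ^ 2 ≤
      (𝔼 b, roundProb gA b gB gC pk (acc b)) / 2 ^ m +
      𝔼 b, 𝔼 b', if b = b' then 0 else
        √(min (sequentialProb gA b b' gB gC pk (acc b) (acc b'))
          (sequentialProb gA b' b gB gC pk (acc b') (acc b))) := by
  set ψ : Bits (AdversaryWires m P Y B C A wA wB wC) → ℂ :=
    gateProd (gA.map (Gate.map Function.Embedding.inl)) *ᵥ
      Pi.single (Sum.elim (Sum.elim pk fun _ => false) fun _ => false) 1 with hψ
  have hr : ∀ b, roundState gA b gB gC pk = gateProd (roundGates b gB gC) *ᵥ ψ := by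
    intro b
    rw [roundState, gateProd_append, ← Matrix.mulVec_mulVec]
  have key := sq_expect_gateProd_le (fun b => roundGates b gB gC) ψ
    ((normSq_gateProd _ _).trans (normSq_single _)) (fun b => bothAccept (acc b))
    (fun b => roundProb gA b gB gC pk (acc b)) (fun b => by rw [roundProb, hr])
    (fun b b' => sequentialProb gA b b' gB gC pk (acc b) (acc b'))
    (fun b b' => by rw [sequentialProb, hr])
  have hcard : ((Fintype.card (Bits (Fin m)) : ℕ) : ℝ) = 2 ^ m := by simp
  rw [hcard] at key
  exact key

theorem sequentialProb_nonneg
    (gA : List (Gate ((Fin m × P) ⊕ (((Fin m × Y) ⊕ (B ⊕ C)) ⊕ wA)))) (b₀ b₁ : Bits (Fin m))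
    (gB : List (Gate (PartyWires m B A wB)))
    (gC : List (Gate (PartyWires m C A wC))) (pk : Bits (Fin m × P))
    (acc₀ acc₁ : Bits (Fin m × Y) → Bits (Fin m × A) → Bool) :
    0 ≤ sequentialProb gA b₀ b₁ gB gC pk acc₀ acc₁ :=
  Finset.sum_nonneg fun _ _ => by split_ifs <;> positivity

theorem sum_born_round (CA : QCircuit (Fin m × P) ((Fin m × Y) ⊕ (B ⊕ C)))
    (CB : QCircuit (B ⊕ Fin m) (Fin m × A)) (CC : QCircuit (C ⊕ Fin m) (Fin m × A))
    (pk : Bits (Fin m × P)) (b : Bits (Fin m)) (acc : Bits (Fin m × Y) → Bits (Fin m × A) → Bool) :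
    (∑ y, ∑ aB, ∑ aC, if acc y aB = true ∧ acc y aC = true then
      born (tensor (restrict (CB.effect aB) (fun s => Sum.elim s b))
        (restrict (CC.effect aC) (fun s => Sum.elim s b))) (postMeasure (CA.output pk) y) else 0) =
    roundProb CA.gates b CB.gates CC.gates pk acc := by
  refine (sum_born_play CA CB CC pk b fun y a a' => acc y a = true ∧ acc y a' = true).trans ?_
  rw [roundProb, roundState_eq_play]
  have e1 : ∀ {p p' : Prop} [Decidable p] [Decidable p'] {x : ℝ}, (p ↔ p') →
      (if p then x else 0) = if p' then x else 0 := by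
    intro p q _ _ x h1
    simp only [h1]
  refine Finset.sum_congr rfl fun s _ => e1 ?_
  exact Bool.and_eq_true_iff.symm

end Round

/-- The string with the `i`-th block replaced. -/
def setBlock {m : ℕ} {α : Type} (i : Fin m) (r : Bits α) (R : Bits (Fin m × α)) :
    Bits (Fin m × α) := fun p => if p.1 = i then r p.2 else R p

theorem block_setBlock_self {m : ℕ} {α : Type} (i : Fin m) (r : Bits α) (R : Bits (Fin m × α)) :
    block (setBlock i r R) i = r := funext fun _ => if_pos rfl

theorem block_setBlock_of_ne {m : ℕ} {α : Type} {i j : Fin m} (h : j ≠ i) (r : Bits α)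
    (R : Bits (Fin m × α)) : block (setBlock i r R) j = block R j := funext fun _ => if_neg h

/-! ### The reduction for fixed coins of a puzzle -/

namespace Puzzle

section Reduction

set_option linter.unusedSectionVars false
set_option synthInstance.maxSize 100000
set_option synthInstance.maxHeartbeats 200000

variable (Z : Puzzle (fun _ => 1)) (n : ℕ) {m : ℕ} {B C : Type} [Fintype B] [DecidableEq B]
  [Fintype C] [DecidableEq C]

/-- The public keys of `m` copies with the coins `R`. -/
def repeatedPK (R : Bits (Fin m × Z.Coins n)) : Bits (Fin m × Z.PK n) :=
  fun p => (Z.keyGen n (block R p.1)).1 p.2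

/-- The secret keys of `m` copies with the coins `R`. -/
def repeatedSK (R : Bits (Fin m × Z.Coins n)) : Bits (Fin m × Z.SK n) :=
  fun p => (Z.keyGen n (block R p.1)).2 p.2

/-- Verification of `m` copies with the coins `R`. -/
def repeatedVer (R : Bits (Fin m × Z.Coins n)) (b : Bits (Fin m)) (y : Bits (Fin m × Z.Y n))
    (a : Bits (Fin m × Z.Ans n)) : Bool :=
  decide (∀ i, Z.ver n (Z.keyGen n (block R i)).2 (block y i) (fun _ => b i) (block a i) = true)

/-- The probability that the honest parties succeed on the challenge `b`. -/
def honestSuccess (r : Bits (Z.Coins n)) (b : Bits (Fin 1)) : ℝ :=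
  ∑ y, ∑ a, if Z.ver n (Z.keyGen n r).2 y b a = true then Z.honestProb n r b y a else 0

theorem honestSuccess_eq (r : Bits (Z.Coins n)) (b : Bits (Fin 1)) :
    Z.honestSuccess n r b = ∑ h : Bits (HonestWires (Z.PK n) (Z.Y n) (Z.R n) (Fin 1) (Z.Ans n)
      (Z.obligate n).work (Z.solve n).work),
      if Z.ver n (Z.keyGen n r).2 (fun y => h (.inr (.inl (.inl y)))) b
        (fun a => h (.inr (.inl (.inr a)))) = true then
      ‖gateProd (honestGates (Z.obligate n).gates (Z.solve n).gates b) h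
        (Sum.elim (Z.keyGen n r).1 fun _ => false)‖ ^ 2 else 0 := by
  rw [honestSuccess, ← sum_honest (Z.obligate n) (Z.solve n) (Z.keyGen n r).1 b
    fun y a => Z.ver n (Z.keyGen n r).2 y b a = true]
  simp only [honestProb_eq]

theorem honestSuccess_le_one (r : Bits (Z.Coins n)) (b : Bits (Fin 1)) :
    Z.honestSuccess n r b ≤ 1 := by
  rw [honestSuccess_eq, ← sum_normSq_gateProd (honestGates (Z.obligate n).gates (Z.solve n).gates b)
    (Sum.elim (Z.keyGen n r).1 fun _ => false)]
  refine Finset.sum_le_sum fun h _ => ?_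
  split_ifs
  · exact le_rfl
  · positivity

theorem expect_fin_one (F : Bits (Fin 1) → ℝ) : 2 * 𝔼 b, F b = ∑ c : Bool, F fun _ => c := by
  have : ∑ b, F b = ∑ c : Bool, F fun _ => c :=
    Fintype.sum_equiv (Equiv.funUnique (Fin 1) Bool) _ _ fun b => by
      congr 1
      funext i
      rw [Subsingleton.elim i default]
      rfl
  rw [Fintype.expect_eq_sum_div_card, this]
  simp
  ring

/-- Completeness averages the two challenges, and the challenge 1 contributes at most 1; so the
failure probability on the challenge 0 is at most twice the average one. -/
theorem le_expect_honestSuccess :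
    2 * Z.successProb n - 1 ≤ 𝔼 r, Z.honestSuccess n r fun _ => false := by
  have h : 2 * Z.successProb n ≤ (𝔼 r, Z.honestSuccess n r fun _ => false) + 1 := by
    have e : Z.successProb n = 𝔼 r, 𝔼 b, Z.honestSuccess n r b := rfl
    have e1 : (1 : ℝ) = 𝔼 _r : Bits (Z.Coins n), (1 : ℝ) := (Fintype.expect_const _).symm
    rw [e, Finset.mul_expect, e1, ← Finset.expect_add_distrib]
    refine Finset.expect_le_expect fun r _ => ?_
    rw [expect_fin_one, Fintype.sum_bool]
    linarith [Z.honestSuccess_le_one n r fun _ => true]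
  linarith

/-- The work wires of the verification in the reduction. -/
abbrev VerdictWork (m : ℕ) (S ωv ωc : Type) : Type :=
  ((Fin m × S) ⊕ Fin m) ⊕ ((Fin m × (Unit ⊕ ωc)) ⊕ (Fin (m + 1) ⊕ ωv))

/-- The work wires of the honest parties in the reduction. -/
abbrev HonestWork (P Y R wO wS : Type) : Type :=
  ((Y ⊕ R) ⊕ wO) ⊕ (P ⊕ (Fin 1 ⊕ wS))

variable (CA : QCircuit (Fin m × Z.PK n) ((Fin m × Z.Y n) ⊕ (B ⊕ C)))
  (CB : QCircuit (B ⊕ Fin m) (Fin m × Z.Ans n)) (CC : QCircuit (C ⊕ Fin m) (Fin m × Z.Ans n))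
  (V : QCircuit (Z.PK n ⊕ (Z.Y n ⊕ Z.Ans n)) Unit)
  (T : ClassicalCircuit (Z.SK n ⊕ (Z.Y n ⊕ (Fin 1 ⊕ Z.Ans n))) Unit)

/-- The first stage of the reduction that puts its public key into the copy `i`, uses the coins
`R` for the other copies and records success on the challenge `b`. -/
def leadGates (i : Fin m) (b : Bits (Fin m)) (R : Bits (Fin m × Z.Coins n)) :
    List (Gate (LeaderWires m (Z.PK n) (Z.Y n) B C (Z.Ans n) CA.work CB.work CC.work
      (VerdictWork m (Z.SK n) V.work T.work)
      (HonestWork (Z.PK n) (Z.Y n) (Z.R n) (Z.obligate n).work (Z.solve n).work))) :=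
  leaderGates i (Z.repeatedPK n R)
    (recordGates CA.gates b CB.gates CC.gates
      (verdictGates i (Z.repeatedSK n R) b V.gates T.gates))
    (honestGates (Z.obligate n).gates (Z.solve n).gates fun _ => false)

/-- The verdict inside `reduction_bound` must come from public data: `b₀ i = false` makes copy `i`
publicly verifiable, and the other secret keys come from the hardwired coins `R`. Block `i` of `R`
is irrelevant, as `setBlock` replaces it by the challenger's coins `r`. -/
theorem honestSuccess_add_sequentialProb_le
    (hV : ∀ (r : Bits (Z.Coins n)) (y : Bits (Z.Y n)) (a : Bits (Z.Ans n)),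
      V.output (Sum.elim (Z.keyGen n r).1 (Sum.elim y a))
        (fun _ => Z.ver n (Z.keyGen n r).2 y (fun _ => false) a)
        (fun _ => Z.ver n (Z.keyGen n r).2 y (fun _ => false) a) = 1)
    (hT : ∀ sk y b a, T.eval (Sum.elim sk (Sum.elim y (Sum.elim b a))) () = Z.ver n sk y b a)
    (i : Fin m) (b₀ b₁ : Bits (Fin m)) (h₀ : b₀ i = false) (h₁ : b₁ i = true)
    (R : Bits (Fin m × Z.Coins n)) (r : Bits (Z.Coins n)) :
    (Z.honestSuccess n r fun _ => false) + sequentialProb CA.gates b₀ b₁ CB.gates CC.gates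
        (Z.repeatedPK n (setBlock i r R)) (Z.repeatedVer n (setBlock i r R) b₀)
        (Z.repeatedVer n (setBlock i r R) b₁) ≤
      2 * 𝔼 b : Bits (Fin 1), ∑ y, ∑ aB, ∑ aC,
        if Z.ver n (Z.keyGen n r).2 y b aB = true ∧ Z.ver n (Z.keyGen n r).2 y b aC = true then
          born (tensor (restrict ((followerCircuit (localGates i b₀ b₁ CB.gates)).effect aB)
              (fun s => Sum.elim s b))
            (restrict ((followerCircuit (localGates i b₀ b₁ CC.gates)).effect aC)
              (fun s => Sum.elim s b)))
            (postMeasure ((leaderCircuit (Z.leadGates n CA CB CC V T i b₀ R)).output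
              (Z.keyGen n r).1) y)
        else 0 := by
  have hi : ∀ {b : Bits (Fin m)} {y : Bits (Fin m × Z.Y n)} {a : Bits (Fin m × Z.Ans n)},
      Z.repeatedVer n (setBlock i r R) b y a = true →
      Z.ver n (Z.keyGen n r).2 (block y i) (fun _ => b i) (block a i) = true := by
    intro b y a h
    have := of_decide_eq_true h i
    rwa [block_setBlock_self] at this
  rw [expect_fin_one, honestSuccess_eq]
  refine reduction_bound i (Z.repeatedPK n R) CA.gates
    (verdictGates i (Z.repeatedSK n R) b₀ V.gates T.gates)
    (honestGates (Z.obligate n).gates (Z.solve n).gates fun _ => false) b₀ b₁ CB.gates CC.gates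
    (Z.keyGen n r).1 (Z.repeatedPK n (setBlock i r R)) ?_ (Z.repeatedVer n (setBlock i r R) b₀)
    (Z.repeatedVer n (setBlock i r R) b₁) ?_
    (fun c y a => Z.ver n (Z.keyGen n r).2 y (fun _ => c) a) ?_ ?_
  · funext p
    rw [repeatedPK, repeatedPK]
    by_cases h : p.1 = i
    · rw [if_pos h, h, block_setBlock_self]
    · rw [if_neg h, block_setBlock_of_ne h]
  · intro y a s hs
    refine verdictGates_exact i (Z.repeatedSK n R) b₀ V.gates T.gates (Z.keyGen n r).1 y a
      (fun j => Z.ver n (Z.keyGen n (block (setBlock i r R) j)).2 (block y j) (fun _ => b₀ j)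
        (block a j)) ?_ ?_ s hs
    · intro s hs
      rw [block_setBlock_self, h₀]
      -- Probability 1 for the correct bit means that this bit is shown throughout the support, as
      -- compute–uncompute needs.
      exact V.eq_of_output_eq_one _ _ (hV r (block y i) (block a i)) s hs ()
    · intro j hj
      rw [block_setBlock_of_ne hj]
      exact hT (block (Z.repeatedSK n R) j) (block y j) (fun _ => b₀ j) (block a j)
  · intro y a h
    have := hi h
    rwa [h₀] at this
  · intro y a h
    have := hi h
    rwa [h₁] at this

end Reduction

end Puzzle

/-! ### Sizes of the circuits of the reduction -/

section Round

set_option linter.unusedSectionVars false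
set_option synthInstance.maxSize 100000
set_option synthInstance.maxHeartbeats 200000

variable {m : ℕ} {P Y B C A wA wB wC w wH : Type}
  [Fintype P] [DecidableEq P] [Fintype Y] [DecidableEq Y] [Fintype B] [DecidableEq B]
  [Fintype C] [DecidableEq C] [Fintype A] [DecidableEq A] [Fintype wA] [DecidableEq wA]
  [Fintype wB] [DecidableEq wB] [Fintype wC] [DecidableEq wC] [Fintype w] [DecidableEq w]
  [Fintype wH] [DecidableEq wH]

theorem length_roundGates_le (b : Bits (Fin m)) (gB : List (Gate (PartyWires m B A wB)))
    (gC : List (Gate (PartyWires m C A wC))) :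
    (roundGates (P := P) (Y := Y) (wA := wA) b gB gC).length ≤
      2 * m + gB.length + gC.length := by
  have h1 := length_constLayer_le (partyChallenge (m := m) (B := B) (A := A) (wB := wB)) b
  have h2 := length_constLayer_le (partyChallenge (m := m) (B := C) (A := A) (wB := wC)) b
  rw [Fintype.card_fin] at h1 h2
  simp only [roundGates, partyGates, List.length_append, List.length_map]
  omega

/-- The factors 8 count one run of a circuit and its inverse, which has at most seven gates for each
gate. -/
theorem length_recordGates_le (gA : List (Gate ((Fin m × P) ⊕ (((Fin m × Y) ⊕ (B ⊕ C)) ⊕ wA))))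
    (b : Bits (Fin m)) (gB : List (Gate (PartyWires m B A wB)))
    (gC : List (Gate (PartyWires m C A wC)))
    (D : List (Gate (VerifyWires P (Fin m × Y) (Fin m × A) w))) :
    (recordGates gA b gB gC D).length ≤ gA.length + 8 * (2 * m + gB.length + gC.length) +
      (8 * (2 * (Fintype.card P + (m * Fintype.card Y + m * Fintype.card A)) + 2 * D.length + 1) +
        1) := by
  have h1 := length_roundGates_le (P := P) (Y := Y) (wA := wA) b gB gC
  have h2 := length_flagGates_le (α := AdversaryWires m P Y B C A wA wB wC)
    (fun y : Fin m × Y => .inl (.inr (.inl (.inl y)))) (fun a => .inr (.inl (.inr (.inl a))))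
    (fun a => .inr (.inr (.inr (.inl a)))) D
  have h3 := length_invGates_le (roundGates (P := P) (Y := Y) (wA := wA) b gB gC)
  simp only [Fintype.card_prod, Fintype.card_fin] at h2
  simp only [recordGates, List.length_append, List.length_map]
  omega

end Round

/-! ### The reduction as an efficient player with advice -/

namespace Puzzle

section Reduction

set_option linter.unusedSectionVars false
set_option synthInstance.maxSize 100000
set_option synthInstance.maxHeartbeats 200000

variable (Z : Puzzle (fun _ => 1)) {k : ℕ → ℕ} {B C : Reg}
  (CA : ∀ n, QCircuit (Fin (k n) × Z.PK n) ((Fin (k n) × Z.Y n) ⊕ (B n ⊕ C n)))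
  (CB : ∀ n, QCircuit (B n ⊕ Fin (k n)) (Fin (k n) × Z.Ans n))
  (CC : ∀ n, QCircuit (C n ⊕ Fin (k n)) (Fin (k n) × Z.Ans n))
  (V : ∀ n, QCircuit (Z.PK n ⊕ (Z.Y n ⊕ Z.Ans n)) Unit)
  (T : ∀ n, ClassicalCircuit (Z.SK n ⊕ (Z.Y n ⊕ (Fin 1 ⊕ Z.Ans n))) Unit)

/-- What the reduction has hardwired for one value of the security parameter: a copy, two
challenges that differ in it, and the coins of the other copies. -/
abbrev Advice (k : ℕ → ℕ) (n : ℕ) : Type :=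
  Option (Fin (k n) × (Bits (Fin (k n)) × Bits (Fin (k n))) × Bits (Fin (k n) × Z.Coins n))

/-- The player against a 1-of-2 puzzle obtained from a player against its repetition. -/
def reductionPlayer (x : ∀ n, Z.Advice k n) : Z.Player where
  B := { wires := fun n => FollowerInput (k n) (B n) (Z.Ans n) (CB n).work }
  C := { wires := fun n => FollowerInput (k n) (C n) (Z.Ans n) (CC n).work }
  algA n := leaderCircuit ((x n).elim [] fun x =>
    Z.leadGates n (CA n) (CB n) (CC n) (V n) (T n) x.1 x.2.1.1 x.2.2)
  algB n := followerCircuit ((x n).elim [] fun x => localGates x.1 x.2.1.1 x.2.1.2 (CB n).gates)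
  algC n := followerCircuit ((x n).elim [] fun x => localGates x.1 x.2.1.1 x.2.1.2 (CC n).gates)

variable {CA CB CC V T}

/-- The advice enters only through constant bits and the choice of a copy, and the length bounds do
not depend on these. Hence any choice of advice gives a polynomial-size player. -/
theorem qpt_reductionPlayer (hZ : Z.Efficient) (hk : PolyBounded k)
    (hA : PolyBounded fun n => (CA n).size) (hB : PolyBounded fun n => (CB n).size)
    (hC : PolyBounded fun n => (CC n).size) (hV : PolyBounded fun n => (V n).size)
    (hT : PolyBounded fun n => (T n).size) (x : ∀ n, Z.Advice k n) :
    (Z.reductionPlayer CA CB CC V T x).QPT := by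
  obtain ⟨-, hO, hS, -⟩ := hZ
  have hP : PolyBounded fun n => Fintype.card (Z.PK n) :=
    hO.mono fun n => by rw [QCircuit.size]; omega
  have hY : PolyBounded fun n => Fintype.card (Z.Y n) :=
    hO.mono fun n => by rw [QCircuit.size, Fintype.card_sum]; omega
  have hR : PolyBounded fun n => Fintype.card (Z.R n) :=
    hO.mono fun n => by rw [QCircuit.size, Fintype.card_sum]; omega
  have hAns : PolyBounded fun n => Fintype.card (Z.Ans n) :=
    hS.mono fun n => by rw [QCircuit.size]; omega
  have hSK : PolyBounded fun n => Fintype.card (Z.SK n) :=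
    hT.mono fun n => by rw [ClassicalCircuit.size, Fintype.card_sum]; omega
  have hB0 : PolyBounded fun n => Fintype.card (B n) :=
    hB.mono fun n => by rw [QCircuit.size, Fintype.card_sum]; omega
  have hC0 : PolyBounded fun n => Fintype.card (C n) :=
    hC.mono fun n => by rw [QCircuit.size, Fintype.card_sum]; omega
  have wA : PolyBounded fun n => Fintype.card (CA n).work :=
    hA.mono fun n => by rw [QCircuit.size]; omega
  have wB : PolyBounded fun n => Fintype.card (CB n).work :=
    hB.mono fun n => by rw [QCircuit.size]; omega
  have wC : PolyBounded fun n => Fintype.card (CC n).work :=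
    hC.mono fun n => by rw [QCircuit.size]; omega
  have wO : PolyBounded fun n => Fintype.card (Z.obligate n).work :=
    hO.mono fun n => by rw [QCircuit.size]; omega
  have wS : PolyBounded fun n => Fintype.card (Z.solve n).work :=
    hS.mono fun n => by rw [QCircuit.size]; omega
  have wV : PolyBounded fun n => Fintype.card (V n).work :=
    hV.mono fun n => by rw [QCircuit.size]; omega
  have wT : PolyBounded fun n => Fintype.card (T n).work :=
    hT.mono fun n => by rw [ClassicalCircuit.size]; omega
  have gA : PolyBounded fun n => (CA n).gates.length :=
    hA.mono fun n => by rw [QCircuit.size]; omega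
  have gB : PolyBounded fun n => (CB n).gates.length :=
    hB.mono fun n => by rw [QCircuit.size]; omega
  have gC : PolyBounded fun n => (CC n).gates.length :=
    hC.mono fun n => by rw [QCircuit.size]; omega
  have gO : PolyBounded fun n => (Z.obligate n).gates.length :=
    hO.mono fun n => by rw [QCircuit.size]; omega
  have gS : PolyBounded fun n => (Z.solve n).gates.length :=
    hS.mono fun n => by rw [QCircuit.size]; omega
  have gV : PolyBounded fun n => (V n).gates.length :=
    hV.mono fun n => by rw [QCircuit.size]; omega
  have gT : PolyBounded fun n => (T n).gates.length :=
    hT.mono fun n => by rw [ClassicalCircuit.size]; omega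
  have c := PolyBounded.const
  have c1 : PolyBounded fun n => Fintype.card Unit := c _
  have cF : PolyBounded fun n => Fintype.card (FollowerInput (k n) (B n) (Z.Ans n) (CB n).work) := by
    simp only [Fintype.card_sum, Fintype.card_prod, Fintype.card_fin]
    exact c1.add (((hB0.add hk).add ((hk.mul hAns).add wB)).add hAns)
  have cG : PolyBounded fun n => Fintype.card (FollowerInput (k n) (C n) (Z.Ans n) (CC n).work) := by
    simp only [Fintype.card_sum, Fintype.card_prod, Fintype.card_fin]
    exact c1.add (((hC0.add hk).add ((hk.mul hAns).add wC)).add hAns)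
  refine ⟨?_, ?_, ?_⟩
  · have cV : PolyBounded fun n =>
        Fintype.card (VerdictWork (k n) (Z.SK n) (V n).work (T n).work) := by
      simp only [Fintype.card_sum, Fintype.card_prod, Fintype.card_fin]
      exact ((hk.mul hSK).add hk).add ((hk.mul (c1.add wT)).add ((hk.add (c 1)).add wV))
    have cH : PolyBounded fun n => Fintype.card (HonestWork (Z.PK n) (Z.Y n) (Z.R n)
        (Z.obligate n).work (Z.solve n).work) := by
      simp only [Fintype.card_sum, Fintype.card_fin]
      exact ((hY.add hR).add wO).add (hP.add ((c 1).add wS))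
    have cW : PolyBounded fun n => Fintype.card (LeaderWork (k n) (Z.PK n) (Z.Y n) (Z.Ans n)
        (CA n).work (VerdictWork (k n) (Z.SK n) (V n).work (T n).work) (HonestWork (Z.PK n) (Z.Y n)
          (Z.R n) (Z.obligate n).work (Z.solve n).work)) := by
      have cv : PolyBounded fun n => Fintype.card (VerifyWires (Z.PK n) (Fin (k n) × Z.Y n)
          (Fin (k n) × Z.Ans n) (VerdictWork (k n) (Z.SK n) (V n).work (T n).work)) := by
        have := (hP.add ((hk.mul hY).add (hk.mul hAns))).add (c1.add cV)
        refine this.mono fun n => le_of_eq ?_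
        simp only [Fintype.card_sum, Fintype.card_prod, Fintype.card_fin]
      have := ((hk.mul hP).add ((hk.mul hY).add wA)).add (((cv.add cv).add c1).add
        (hP.add (hY.add cH)))
      refine this.mono fun n => le_of_eq ?_
      simp only [Fintype.card_sum, Fintype.card_prod, Fintype.card_fin]
    have gD := ((((hk.mul hSK).add hk).add (hk.mul gT)).add gV).add (hk.add (c 2))
    have gR := (gA.add ((c 8).mul ((((c 2).mul hk).add gB).add gC))).add
      (((c 8).mul ((((c 2).mul (hP.add ((hk.mul hY).add (hk.mul hAns)))).add ((c 2).mul gD)).add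
        (c 1))).add (c 1))
    have gH := (((hP.add (c 1)).add gO).add hY).add gS
    have gL := (((((hk.mul hP).add ((c 2).mul hP)).add gR).add gH).add ((c 1).add hAns)).add
      (hY.mul (c 3))
    refine (((hP.add (hY.add (cF.add cG))).add cW).add gL).mono fun n => ?_
    change Fintype.card (Z.PK n) + Fintype.card (Z.Y n ⊕
      (FollowerInput (k n) (B n) (Z.Ans n) (CB n).work ⊕
        FollowerInput (k n) (C n) (Z.Ans n) (CC n).work)) +
      Fintype.card (LeaderWork (k n) (Z.PK n) (Z.Y n) (Z.Ans n)
        (CA n).work (VerdictWork (k n) (Z.SK n) (V n).work (T n).work) (HonestWork (Z.PK n) (Z.Y n)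
          (Z.R n) (Z.obligate n).work (Z.solve n).work)) + (List.map _ _).length ≤ _
    refine add_le_add (add_le_add (add_le_add le_rfl ?_) le_rfl) ?_
    · rw [Fintype.card_sum, Fintype.card_sum]
    refine (List.length_map _).trans_le ?_
    cases x n with
    | none => exact Nat.zero_le _
    | some x =>
      obtain ⟨i, ⟨b₀, b₁⟩, R⟩ := x
      refine (length_leaderGates_le _ _ _ _).trans ?_
      refine add_le_add (add_le_add (add_le_add (add_le_add le_rfl ?_) ?_) le_rfl) le_rfl
      · refine (length_recordGates_le _ _ _ _ _).trans ?_
        have := length_verdictGates_le i (Z.repeatedSK n R) b₀ (V n).gates (T n).gates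
        gcongr
      · refine (length_honestGates_le _ _ _).trans ?_
        rw [Fintype.card_fin]
  · refine ((((cF.add (c 1)).add hAns).add (c 0)).add
      (((hk.mul (c 2)).add gB).add (hAns.mul (c 3)))).mono fun n => ?_
    refine add_le_add (le_of_eq ?_) ?_
    · congr 2
      exact (Fintype.card_sum.trans (congrArg₂ _ rfl (Fintype.card_fin 1)))
    · change (Option.elim (x n) [] _).length ≤ _
      cases x n with
      | none => exact Nat.zero_le _
      | some x => exact length_localGates_le _ _ _ _
  · refine ((((cG.add (c 1)).add hAns).add (c 0)).add
      (((hk.mul (c 2)).add gC).add (hAns.mul (c 3)))).mono fun n => ?_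
    refine add_le_add (le_of_eq ?_) ?_
    · congr 2
      exact (Fintype.card_sum.trans (congrArg₂ _ rfl (Fintype.card_fin 1)))
    · change (Option.elim (x n) [] _).length ≤ _
      cases x n with
      | none => exact Nat.zero_le _
      | some x => exact length_localGates_le _ _ _ _

end Reduction

end Puzzle

/-! ### Averages over coins -/

theorem sq_expect_le_expect_sq {α : Type} [Fintype α] (f : α → ℝ) :
    (𝔼 a, f a) ^ 2 ≤ 𝔼 a, f a ^ 2 := by
  rcases isEmpty_or_nonempty α with h | h
  · simp
  have h1 := sq_sum_le_card_mul_sum_sq (s := (Finset.univ : Finset α)) (f := f)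
  have h2 : (0 : ℝ) < Fintype.card α := by exact_mod_cast Fintype.card_pos
  rw [Fintype.expect_eq_sum_div_card, Fintype.expect_eq_sum_div_card, div_pow,
    div_le_div_iff₀ (by positivity) h2]
  rw [Finset.card_univ] at h1
  nlinarith

theorem expect_sqrt_le {α : Type} [Fintype α] (f : α → ℝ) (hf : ∀ a, 0 ≤ f a) :
    𝔼 a, √(f a) ≤ √(𝔼 a, f a) := by
  refine Real.le_sqrt_of_sq_le ((sq_expect_le_expect_sq _).trans_eq ?_)
  exact Finset.expect_congr rfl fun a _ => Real.sq_sqrt (hf a)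

/-- Resampling one block of a uniformly random string. -/
theorem expect_setBlock {m : ℕ} {α : Type} [Fintype α] [DecidableEq α] (i : Fin m)
    (F : Bits (Fin m × α) → ℝ) : 𝔼 R, 𝔼 r, F (setBlock i r R) = 𝔼 R, F R := by
  have h1 : ∀ R : Bits (Fin m × α), ∀ r, setBlock i (block R i) (setBlock i r R) = R := by
    intro R r
    funext p
    by_cases h : p.1 = i
    · rw [setBlock, if_pos h, ← h]
      rfl
    · rw [setBlock, if_neg h, setBlock, if_neg h]
  -- Exchanging the block `i` of `R` with the fresh block `r` is an involution, hence preserves the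
  -- uniform distribution of the pair.
  let e : Bits (Fin m × α) × Bits α ≃ Bits (Fin m × α) × Bits α :=
    Function.Involutive.toPerm (fun x => (setBlock i x.2 x.1, block x.1 i)) fun x =>
      Prod.ext (h1 x.1 x.2) (block_setBlock_self i x.2 x.1)
  have h2 : 𝔼 x : Bits (Fin m × α) × Bits α, F (setBlock i x.2 x.1) =
      𝔼 x : Bits (Fin m × α) × Bits α, F x.1 := Fintype.expect_equiv e _ _ fun _ => rfl
  rw [← Finset.univ_product_univ, Finset.expect_product, Finset.expect_product] at h2
  refine h2.trans (Finset.expect_congr rfl fun R _ => Fintype.expect_const (F R))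

/-! ### Soundness of the repetition -/

namespace Puzzle

section Reduction

set_option linter.unusedSectionVars false
set_option synthInstance.maxSize 100000
set_option synthInstance.maxHeartbeats 200000

variable (Z : Puzzle (fun _ => 1)) {k : ℕ → ℕ} {B C : Reg}
  (CA : ∀ n, QCircuit (Fin (k n) × Z.PK n) ((Fin (k n) × Z.Y n) ⊕ (B n ⊕ C n)))
  (CB : ∀ n, QCircuit (B n ⊕ Fin (k n)) (Fin (k n) × Z.Ans n))
  (CC : ∀ n, QCircuit (C n ⊕ Fin (k n)) (Fin (k n) × Z.Ans n))

/-- The probability, for the coins `R`, that a player succeeds on `b` and then on `b'`. -/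
def repeatedSequential (n : ℕ) (R : Bits (Fin (k n) × Z.Coins n)) (b b' : Bits (Fin (k n))) : ℝ :=
  sequentialProb (CA n).gates b b' (CB n).gates (CC n).gates (Z.repeatedPK n R)
    (Z.repeatedVer n R b) (Z.repeatedVer n R b')

/-- There are exponentially many pairs of challenges, so one negligible bound must serve all of
them. It comes from a single player whose advice is, for each `n`, the most successful choice of
copy, challenges and coins. -/
theorem exists_negligible_sequential (hZ : Z.Efficient)
    (hcomplete : ∃ μ : ℕ → ℝ, Negligible μ ∧ Z.HasCompleteness fun n => 1 - μ n)
    (hsound : Z.HasNonLocalSoundness fun _ => 1 / 2)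
    (hpublic : Z.ZeroChallengePubliclyVerifiable) (hk : PolyBounded k)
    (hA : PolyBounded fun n => (CA n).size) (hB : PolyBounded fun n => (CB n).size)
    (hC : PolyBounded fun n => (CC n).size) :
    ∃ ν : ℕ → ℝ, Negligible ν ∧ ∀ n i (b₀ b₁ : Bits (Fin (k n))), b₀ i = false → b₁ i = true →
      𝔼 R, Z.repeatedSequential CA CB CC n R b₀ b₁ ≤ ν n := by
  obtain ⟨μc, hμc, hcomp⟩ := hcomplete
  obtain ⟨V, hVs, hV⟩ := hpublic
  have hver := hZ.2.2.2
  obtain ⟨T, hTs, hT⟩ := hver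
  -- The lower bound for twice the winning probability of the reduction with advice `t`, averaged
  -- over the challenger's coins.
  let G : ∀ n, Fin (k n) × (Bits (Fin (k n)) × Bits (Fin (k n))) × Bits (Fin (k n) × Z.Coins n) →
      ℝ := fun n t => 𝔼 r, ((Z.honestSuccess n r fun _ => false) +
        Z.repeatedSequential CA CB CC n (setBlock t.1 r t.2.2) t.2.1.1 t.2.1.2)
  -- A maximizer exists by finiteness. If no admissible advice exists, as for `k n = 0`, the value
  -- `none` stands for empty circuits and nothing has to be shown.
  have hmax : ∀ n, ∃ x : Z.Advice k n, ∀ t, t.2.1.1 t.1 = false → t.2.1.2 t.1 = true →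
      ∃ t', x = some t' ∧ t'.2.1.1 t'.1 = false ∧ t'.2.1.2 t'.1 = true ∧ G n t ≤ G n t' := by
    intro n
    by_cases hne : {t : Fin (k n) × (Bits (Fin (k n)) × Bits (Fin (k n))) ×
        Bits (Fin (k n) × Z.Coins n) | t.2.1.1 t.1 = false ∧ t.2.1.2 t.1 = true}.Nonempty
    · obtain ⟨t', ht', hle⟩ := Set.exists_max_image _ (G n) (Set.toFinite _) hne
      exact ⟨some t', fun t h0 h1 => ⟨t', rfl, ht'.1, ht'.2, hle t ⟨h0, h1⟩⟩⟩
    · exact ⟨none, fun t h0 h1 => absurd ⟨t, h0, h1⟩ hne⟩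
  choose x hx using hmax
  obtain ⟨μ, hμ, hwin⟩ := hsound (Z.reductionPlayer CA CB CC V T x)
    (Z.qpt_reductionPlayer hZ hk hA hB hC hVs hTs x)
  -- Twice the winning probability is at most `1 + 2 * μ n`, and the average honest success on the
  -- challenge 0 is at least `1 - 2 * μc n`; the difference is the bound.
  refine ⟨fun n => (μ n + μ n) + (μc n + μc n), (hμ.add hμ).add (hμc.add hμc), ?_⟩
  intro n i b₀ b₁ h₀ h₁
  have hG : ∀ R, G n (i, (b₀, b₁), R) ≤ 1 + 2 * μ n := by
    intro R
    obtain ⟨⟨i', ⟨b₀', b₁'⟩, R'⟩, hxn, h₀', h₁', hle⟩ := hx n (i, (b₀, b₁), R) h₀ h₁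
    refine hle.trans ?_
    have hw : Z.nonLocalWinProb (Z.reductionPlayer CA CB CC V T x) n ≤ 1 / 2 + μ n := hwin n
    have h2 : G n (i', (b₀', b₁'), R') ≤
        2 * Z.nonLocalWinProb (Z.reductionPlayer CA CB CC V T x) n := by
      rw [nonLocalWinProb, Finset.mul_expect]
      refine Finset.expect_le_expect fun r _ => ?_
      refine (Z.honestSuccess_add_sequentialProb_le n (CA n) (CB n) (CC n) (V n) (T n) (hV n)
        (fun sk y b a => congrFun (hT n _) ()) i' b₀' b₁' h₀' h₁' R' r).trans_eq ?_
      have hA' : (Z.reductionPlayer CA CB CC V T x).algA n = leaderCircuit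
          (Z.leadGates n (CA n) (CB n) (CC n) (V n) (T n) i' b₀' R') := by
        change leaderCircuit (Option.elim (x n) [] _) = _
        rw [hxn]
        rfl
      have hB' : (Z.reductionPlayer CA CB CC V T x).algB n = followerCircuit
          (localGates i' b₀' b₁' (CB n).gates) := by
        change followerCircuit (Option.elim (x n) [] _) = _
        rw [hxn]
        rfl
      have hC' : (Z.reductionPlayer CA CB CC V T x).algC n = followerCircuit
          (localGates i' b₀' b₁' (CC n).gates) := by
        change followerCircuit (Option.elim (x n) [] _) = _
        rw [hxn]
        rfl
      rw [hA', hB', hC']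
      rfl
    linarith
  have h3 : 𝔼 R, G n (i, (b₀, b₁), R) = (𝔼 r, Z.honestSuccess n r fun _ => false) +
      𝔼 R, Z.repeatedSequential CA CB CC n R b₀ b₁ := by
    -- Embedding a fresh key into copy `i` leaves the joint distribution of the keys unchanged.
    rw [← expect_setBlock i (fun R => Z.repeatedSequential CA CB CC n R b₀ b₁)]
    simp only [G, Finset.expect_add_distrib]
    rw [Fintype.expect_const]
  have h4 : 𝔼 R, G n (i, (b₀, b₁), R) ≤ 1 + 2 * μ n :=
    (Finset.expect_le_expect fun R _ => hG R).trans_eq (Fintype.expect_const _)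
  have h5 := Z.le_expect_honestSuccess n
  have h6 : 1 - μc n ≤ Z.successProb n := hcomp n
  linarith

/-- The quadratic inequality for fixed coins is averaged: Jensen bounds the square of the mean by
the mean of the squares, and concavity of the root carries the bound on the sequential probabilities
to the overlaps. -/
theorem exists_negligible_roundProb (hZ : Z.Efficient)
    (hcomplete : ∃ μ : ℕ → ℝ, Negligible μ ∧ Z.HasCompleteness fun n => 1 - μ n)
    (hsound : Z.HasNonLocalSoundness fun _ => 1 / 2)
    (hpublic : Z.ZeroChallengePubliclyVerifiable) (hk : PolyBounded k)
    (hA : PolyBounded fun n => (CA n).size) (hB : PolyBounded fun n => (CB n).size)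
    (hC : PolyBounded fun n => (CC n).size) :
    ∃ μ : ℕ → ℝ, Negligible μ ∧ ∀ n, (𝔼 R, 𝔼 b, roundProb (CA n).gates b (CB n).gates
      (CC n).gates (Z.repeatedPK n R) (Z.repeatedVer n R b)) ≤ (1 / 2) ^ k n + μ n := by
  obtain ⟨ν, hν, hle⟩ := Z.exists_negligible_sequential CA CB CC hZ hcomplete hsound hpublic hk
    hA hB hC
  -- One root passes from sequential success to the overlap, the other one solves the quadratic
  -- inequality.
  refine ⟨fun n => √(√(ν n)), hν.sqrt.sqrt, fun n => ?_⟩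
  set X : Bits (Fin (k n) × Z.Coins n) → ℝ := fun R => 𝔼 b, roundProb (CA n).gates b
    (CB n).gates (CC n).gates (Z.repeatedPK n R) (Z.repeatedVer n R b) with hX
  set q : Bits (Fin (k n) × Z.Coins n) → Bits (Fin (k n)) → Bits (Fin (k n)) → ℝ := fun R b b' =>
    min (Z.repeatedSequential CA CB CC n R b b') (Z.repeatedSequential CA CB CC n R b' b) with hq
  have hq0 : ∀ R b b', 0 ≤ q R b b' := fun R b b' =>
    le_min (sequentialProb_nonneg _ _ _ _ _ _ _ _) (sequentialProb_nonneg _ _ _ _ _ _ _ _)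
  -- Distinct challenges differ in some bit; the minimum is bounded by the order in which the
  -- challenge with 0 in this bit comes first.
  have hqν : ∀ b b', b ≠ b' → 𝔼 R, q R b b' ≤ ν n := by
    intro b b' hb
    obtain ⟨i, hi⟩ := Function.ne_iff.1 hb
    cases h0 : b i with
    | false =>
      refine le_trans (Finset.expect_le_expect fun R _ => min_le_left _ _) (hle n i b b' h0 ?_)
      rw [h0] at hi
      exact (Bool.eq_true_of_not_eq_false (Ne.symm hi))
    | true =>
      refine le_trans (Finset.expect_le_expect fun R _ => min_le_right _ _) (hle n i b' b ?_ h0)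
      rw [h0] at hi
      exact (Bool.eq_false_of_not_eq_true (Ne.symm hi))
  have h1 : ∀ R, X R ^ 2 ≤ X R / 2 ^ k n + 𝔼 b, 𝔼 b', if b = b' then 0 else √(q R b b') :=
    fun R => sq_expect_roundProb_le (CA n).gates (CB n).gates (CC n).gates (Z.repeatedPK n R)
      (Z.repeatedVer n R)
  have h2 : (𝔼 R, 𝔼 b, 𝔼 b', if b = b' then 0 else √(q R b b')) ≤ √(ν n) := by
    have e : (𝔼 R, 𝔼 b, 𝔼 b', if b = b' then 0 else √(q R b b')) =
        𝔼 b, 𝔼 b', 𝔼 R, if b = b' then 0 else √(q R b b') := by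
      rw [Finset.expect_comm]
      exact Finset.expect_congr rfl fun b _ => Finset.expect_comm _ _ _
    rw [e]
    refine (Finset.expect_le_expect fun b _ => (Finset.expect_le_expect fun b' _ => ?_).trans_eq
      (Fintype.expect_const _)).trans_eq (Fintype.expect_const _)
    by_cases hb : b = b'
    · simp [hb]
    · simp only [if_neg hb]
      exact (expect_sqrt_le _ fun R => hq0 R b b').trans (Real.sqrt_le_sqrt (hqν b b' hb))
  -- Here `a = (1 / 2) ^ k n` and `d = √(ν n)`, for the mean of `X` over the coins.
  refine le_add_sqrt_of_sq_le (by positivity) (Real.sqrt_nonneg _) ?_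
  refine (sq_expect_le_expect_sq X).trans ((Finset.expect_le_expect fun R _ => h1 R).trans ?_)
  rw [Finset.expect_add_distrib, ← Finset.expect_div]
  refine add_le_add (le_of_eq ?_) h2
  rw [one_div, inv_pow, div_eq_mul_inv]

end Reduction

theorem nonLocalSoundness_parallelRepetition {Z : Puzzle (fun _ => 1)} (hZ : Z.Efficient)
    (hcomplete : ∃ μ : ℕ → ℝ, Negligible μ ∧ Z.HasCompleteness fun n => 1 - μ n)
    (hsound : Z.HasNonLocalSoundness fun _ => 1 / 2)
    (hpublic : Z.ZeroChallengePubliclyVerifiable) {k : ℕ → ℕ} (hk : PolyBounded k) :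
    (Z.parallelRepetition k).HasNonLocalSoundness fun n => (1 / 2) ^ k n := by
  rintro ⟨B, C, CA, CB, CC⟩ ⟨hA, hB, hC⟩
  obtain ⟨μ, hμ, hle⟩ := Z.exists_negligible_roundProb (B := B) (C := C) CA CB CC hZ hcomplete
    hsound hpublic hk hA hB hC
  refine ⟨μ, hμ, fun n => le_of_eq_of_le ?_ (hle n)⟩
  refine Finset.expect_congr rfl fun R _ => Finset.expect_congr rfl fun b _ => ?_
  exact sum_born_round (CA n) (CB n) (CC n) (Z.repeatedPK n R) b (Z.repeatedVer n R b)

end Puzzle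

end OneOfTwo

end

theorem mainTheorem4 (Z : OneOfTwo.Puzzle (fun _ => 1)) (hZ : Z.Efficient)
    (hcomplete : ∃ μ : ℕ → ℝ, OneOfTwo.Negligible μ ∧ Z.HasCompleteness (fun n => 1 - μ n))
    (hsound : Z.HasNonLocalSoundness (fun _ => 1 / 2))
    (hpublic : Z.ZeroChallengePubliclyVerifiable)
    (k : ℕ → ℕ) (hk : OneOfTwo.PolyBounded k) :
    (Z.parallelRepetition k).Efficient ∧
      (∃ μ : ℕ → ℝ, OneOfTwo.Negligible μ ∧
        (Z.parallelRepetition k).HasCompleteness (fun n => 1 - μ n)) ∧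
      (Z.parallelRepetition k).HasNonLocalSoundness (fun n => (1 / 2) ^ k n) := by
  exact ⟨OneOfTwo.Puzzle.efficient_parallelRepetition hZ hk,
    OneOfTwo.Puzzle.completeness_parallelRepetition hcomplete hk,
    OneOfTwo.Puzzle.nonLocalSoundness_parallelRepetition hZ hcomplete hsound hpublic hk⟩
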